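/- **Theorem.** Write $|x|$ for the Euclidean norm on $\mathbb R^3$. There is a smooth Riemannian metric $g$ on $\mathbb R^3$, invariant under all rotations about the $x_1$-axis $\{x_2=x_3=0\}$, such that $(\mathbb R^3,g)$ is an asymptotically Schwarzschild manifold of mass $1$, that is, $g$ is complete and, with $g^S_{ij}=\bigl(1+\tfrac{1}{2|x|}\bigr)^4\delta_{ij}$, for every $k\ge 0$ there is $C_k$ with $$\bigl|D^k(g-g^S)(x)\bigr|\le C_k|x|^{-2-k}\qquad\text{for all } |x|>1,$$ and there are real numbers $H_0>H_1>H_2>\cdots>0$ with $H_n\to 0$ and three sequences of smoothly embedded $2$-spheres $\Sigma_n^1,\Sigma_n^2,\Sigma_n^3\subset\{|x|>1\}$, leaving every compact set as $n\to\infty$, such that for every $n$: 1. $\Sigma_n^1,\Sigma_n^2,\Sigma_n^3$ all have constant mean curvature $H_n$ in $(\mathbb R^3,g)$, where the mean curvature is the trace of the second fundamental form with respect to the outward unit normal; 2. each of $\Sigma_n^1,\Sigma_n^2,\Sigma_n^3$ is invariant under all rotations about the $x_1$-axis; 3. $\Sigma_n^3$ separates the compact part $\{|x|\le 1\}$ from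 infinity, i.e. $\{|x|\le 1\}$ lies in the bounded region enclosed by $\Sigma_n^3$; 4. $\Sigma_n^1$ and $\Sigma_n^2$ are outlying: for $i=1,2$ the compact region bounded by $\Sigma_n^i$ is disjoint from the ball $\{|x|<\inf_{y\in\Sigma_n^i}|y|\}$; 5. $\Sigma_n^3$ meets the $x_1$-axis in exactly two points (its poles) $P_n\neq Q_n$; $\Sigma_n^1$ meets $\Sigma_n^3$ exactly at $P_n$ and is tangent to it there, and $\Sigma_n^2$ meets $\Sigma_n^3$ exactly at $Q_n$ and is tangent to it there. (No stability of these surfaces is claimed.) -/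

import Mathlib

open Set Filter Topology Metric
open scoped Manifold ContDiff

noncomputable section

namespace CMC

/-- The space `ℝ³` with its standard coordinates `x 0, x 1, x 2`. -/
abbrev E3 : Type := EuclideanSpace ℝ (Fin 3)

instance factFinrankE3 : Fact (Module.finrank ℝ E3 = 2 + 1) :=
  ⟨by simp⟩

/-- The round unit sphere in `ℝ³`, with Mathlib's structure of a smooth 2-manifold. -/
abbrev S2 : Type := sphere (0 : E3) 1

/-- A smooth Riemannian metric on `ℝ³`. -/
structure Metric3 where
  toFun : E3 → E3 →L[ℝ] E3 →L[ℝ] ℝ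
  smooth : ContDiff ℝ ∞ toFun
  symm : ∀ x u v, toFun x u v = toFun x v u
  pos : ∀ x u, u ≠ 0 → 0 < toFun x u u

namespace Metric3

/-- The `g`-length of a curve parametrized by `[0, 1]`. -/
def curveLength (g : Metric3) (γ : ℝ → E3) : ℝ :=
  ∫ t in (0 : ℝ)..1, √(g.toFun (γ t) (deriv γ t) (deriv γ t))

/-- The Riemannian distance: the infimum of the lengths of the `C¹` curves from `x` to `y`. -/
def gdist (g : Metric3) (x y : E3) : ℝ :=
  sInf {L : ℝ | ∃ γ : ℝ → E3, ContDiff ℝ 1 γ ∧ γ 0 = x ∧ γ 1 = y ∧ L = g.curveLength γ}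

/-- Completeness of `(ℝ³, g)` as a metric space. -/
def Complete (g : Metric3) : Prop :=
  ∀ u : ℕ → E3,
    (∀ ε > 0, ∃ N : ℕ, ∀ m ≥ N, ∀ n ≥ N, g.gdist (u m) (u n) < ε) →
      ∃ x : E3, Tendsto (fun n => g.gdist (u n) x) atTop (𝓝 0)

/-- `⟨Γ(u, v), w⟩`, where `Γ` is the Christoffel map of the Levi-Civita connection of `g` in the
standard coordinates; `∇_u V = DV(u) + Γ(u, V)`. -/
def christoffel (g : Metric3) (x u v w : E3) : ℝ :=
  (fderiv ℝ g.toFun x u v w + fderiv ℝ g.toFun x v u w - fderiv ℝ g.toFun x w u v) / 2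

end Metric3

/-- The Euclidean metric `δ`. -/
def euclid : E3 →L[ℝ] E3 →L[ℝ] ℝ := innerSL ℝ

theorem euclid_apply (u v : E3) : euclid u v = inner ℝ u v := rfl

/-- The Schwarzschild metric of mass `m`, `(1 + m / (2 |x|))⁴ δ`. -/
def schwarzschild (m : ℝ) (x : E3) : E3 →L[ℝ] E3 →L[ℝ] ℝ :=
  (1 + m / (2 * ‖x‖)) ^ 4 • euclid

/-- `(ℝ³, g)` is an asymptotically Schwarzschild manifold of mass `m`: it is complete, and outside
the compact set `K = {|x| ≤ 1}` the metric is Schwarzschild up to `O(|x|⁻²)`, every derivative of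
order `k` of the difference being `O(|x|⁻²⁻ᵏ)`. -/
def IsAsymptoticallySchwarzschild (m : ℝ) (g : Metric3) : Prop :=
  g.Complete ∧
    ∀ k : ℕ, ∃ C : ℝ, ∀ x : E3, 1 < ‖x‖ →
      ‖iteratedFDeriv ℝ k (fun y => g.toFun y - schwarzschild m y) x‖ ≤ C / ‖x‖ ^ (2 + k)

/-- The rotation by the angle `θ` about the `x 0`-axis. -/
def rot (θ : ℝ) (x : E3) : E3 :=
  !₂[x 0, Real.cos θ * x 1 - Real.sin θ * x 2, Real.sin θ * x 1 + Real.cos θ * x 2]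

/-- The `x 0`-axis. -/
def axis : Set E3 := {x | x 1 = 0 ∧ x 2 = 0}

/-- The rotations about the `x 0`-axis (which are linear) are isometries of `g`. -/
def Metric3.IsAxisymmetric (g : Metric3) : Prop :=
  ∀ (θ : ℝ) (x u v : E3), g.toFun (rot θ x) (rot θ u) (rot θ v) = g.toFun x u v

/-- A smoothly embedded 2-sphere in `ℝ³`: an injective smooth immersion of the (compact) sphere. -/
structure EmbeddedSphere where
  toFun : S2 → E3
  smooth : ContMDiff (𝓡 2) 𝓘(ℝ, E3) ∞ toFun
  injective : Function.Injective toFun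
  immersion : ∀ p, Function.Injective (mfderiv (𝓡 2) 𝓘(ℝ, E3) toFun p)

namespace EmbeddedSphere

/-- The underlying surface. -/
def carrier (S : EmbeddedSphere) : Set E3 := range S.toFun

/-- The differential of the embedding. -/
def diff (S : EmbeddedSphere) (p : S2) : TangentSpace (𝓡 2) p →L[ℝ] E3 :=
  mfderiv (𝓡 2) 𝓘(ℝ, E3) S.toFun p

/-- The tangent plane of the surface at the point `S.toFun p`. -/
def tangentPlane (S : EmbeddedSphere) (p : S2) : Submodule ℝ E3 :=
  LinearMap.range (S.diff p).toLinearMap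

/-- The open region enclosed by the surface: the union of the bounded components of its
complement. -/
def enclosed (S : EmbeddedSphere) : Set E3 :=
  {x | x ∉ S.carrier ∧ Bornology.IsBounded (connectedComponentIn S.carrierᶜ x)}

/-- `ν` is the outward-pointing smooth `g`-unit normal field along the surface. -/
structure IsOutwardUnitNormal (S : EmbeddedSphere) (g : Metric3) (ν : S2 → E3) : Prop where
  smooth : ContMDiff (𝓡 2) 𝓘(ℝ, E3) ∞ ν
  unit : ∀ p, g.toFun (S.toFun p) (ν p) (ν p) = 1
  normal : ∀ p X, g.toFun (S.toFun p) (ν p) (S.diff p X) = 0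
  outward : ∀ p, ∀ᶠ t : ℝ in 𝓝[>] 0, S.toFun p + t • ν p ∉ S.enclosed

/-- The second fundamental form `⟨∇_X ν, Y⟩` at `p`, with the Levi-Civita connection of `g`. -/
def secondFundamentalForm (S : EmbeddedSphere) (g : Metric3) (ν : S2 → E3) (p : S2)
    (X Y : TangentSpace (𝓡 2) p) : ℝ :=
  g.toFun (S.toFun p) (mfderiv (𝓡 2) 𝓘(ℝ, E3) ν p X : E3) (S.diff p Y) +
    g.christoffel (S.toFun p) (S.diff p X) (ν p) (S.diff p Y)

/-- The surface has constant mean curvature `H` with respect to its outward unit normal: the trace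
of the second fundamental form, computed in any orthonormal basis of any tangent plane,
equals `H`. (Round spheres of radius `R` in flat space have `H = 2 / R`.) -/
def HasConstantMeanCurvature (S : EmbeddedSphere) (g : Metric3) (H : ℝ) : Prop :=
  ∃ ν : S2 → E3, S.IsOutwardUnitNormal g ν ∧
    ∀ (p : S2) (X Y : TangentSpace (𝓡 2) p),
      g.toFun (S.toFun p) (S.diff p X) (S.diff p X) = 1 →
      g.toFun (S.toFun p) (S.diff p Y) (S.diff p Y) = 1 →
      g.toFun (S.toFun p) (S.diff p X) (S.diff p Y) = 0 →
      S.secondFundamentalForm g ν p X X + S.secondFundamentalForm g ν p Y Y = H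

/-- The surface is a surface of revolution about the `x 0`-axis. -/
def IsAxisymmetric (S : EmbeddedSphere) : Prop :=
  ∀ θ : ℝ, rot θ '' S.carrier = S.carrier

/-- The surface lies in the end `|x| > 1` and encloses the compact part `K = {|x| ≤ 1}`. -/
def SeparatesCompactPart (S : EmbeddedSphere) : Prop :=
  S.carrier ⊆ {x | 1 < ‖x‖} ∧ closedBall (0 : E3) 1 ⊆ S.enclosed

/-- The surface lies in the end `|x| > 1`, and the compact region bounded by it is disjoint from
the ball about `0` of radius `l₀ = inf {|x| : x ∈ S}`. -/
def IsOutlying (S : EmbeddedSphere) : Prop :=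
  S.carrier ⊆ {x | 1 < ‖x‖} ∧
    Disjoint (S.carrier ∪ S.enclosed) (ball (0 : E3) (sInf (norm '' S.carrier)))

/-- The two surfaces meet exactly at the point `q`, and have the same tangent plane there. -/
def TangentExactlyAt (S T : EmbeddedSphere) (q : E3) : Prop :=
  S.carrier ∩ T.carrier = {q} ∧
    ∃ p p' : S2, S.toFun p = q ∧ T.toFun p' = q ∧ S.tangentPlane p = T.tangentPlane p'

end EmbeddedSphere

end CMC

end

open Set Filter Topology Metric
open scoped Manifold ContDiff
noncomputable section
namespace CMC

/-! ### Hadamard division with smooth dependence on parameters -/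

section Hadamard

/-! The metric is conformally flat and is built around the surfaces. At a scale `ε` put `y = ε x`;
up to the constant factor `ε⁻²`, Schwarzschild becomes `w⁻² δ` with `w = (1 + ε / (2|y|))⁻²`. The
sphere `|y| = 1` has constant mean curvature by symmetry. For `ε = 0` the unit spheres about `±2e`
(`e` the axis direction) touch it at `±e` and have the same curvature 2. To first order in `ε` they
can be corrected: the linearized equation has an explicit solution `zeta` (`zeta_equation`), and the
free axial translation is spent on `zeta 1 = 0`, which preserves the contact point. The resulting
sphere `{z = height ε r}` misses the curvature of the centred one by `O(ε²)` only
(`hasDerivAt_defect_zero`).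

This last error is absorbed by the metric, not by the surface: a change of size `ε²` at `|x| ~ 1/ε`
is `O(|x|⁻²)`, which is what the asymptotics allow. In the metric `w⁻² δ` the mean curvature is `w`
times the Euclidean one minus twice the Euclidean normal derivative of `w`
(`hasConstantMeanCurvature_of_conformal`). Adding `ε² f` to `w` therefore leaves the centred sphere
unaffected if `f = ∂ᵣ f` on `|y| = 1`. The ansatz is `f = β z + γ (r - z) + (z - height) (r - 1)²
m`. The first two terms are homogeneous of degree one, so Euler's identity gives `f = ∂ᵣ f`; the
third vanishes doubly at `r = 1`. On the outlying sphere the `β` term has an effect that is nonzero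
at `r = 1`, the `γ` term one with a simple zero there, and the third an arbitrary smooth multiple of
`(r - 1)²`. So `β` and `γ` cancel the error to second order at the contact point and `m` cancels the
rest (`exists_correction`). Hadamard's lemma makes these coefficients smooth in `(ε, r)`, also
across `ε = 0`.

Cutoffs in radius and angle place one copy of `f` at each pole, and the change of the metric becomes
`ε² P(ε, ε x)` with one smooth compactly supported `P` (`exists_profile`). Summing over `ε = δ 64⁻ⁿ`
gives terms with disjoint supports, whose derivatives of order `k` are `O(ε²⁺ᵏ)`, that is
`O(|x|⁻²⁻ᵏ)` (`series_props`). Every scale then carries its own triple of surfaces. -/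

theorem hasFDerivAt_intervalIntegral_of_contDiff {E G : Type} [NormedAddCommGroup E]
    [NormedSpace ℝ E] [ProperSpace E] [NormedAddCommGroup G] [NormedSpace ℝ G]
    {F : E × ℝ → G} (hF : ContDiff ℝ 1 F) (x₀ : E) :
    HasFDerivAt (fun x => ∫ s in (0 : ℝ)..1, F (x, s))
      (∫ s in (0 : ℝ)..1, (fderiv ℝ F (x₀, s)).comp (ContinuousLinearMap.inl ℝ E ℝ)) x₀ := by
  have hF' : Continuous fun p : E × ℝ =>
      (fderiv ℝ F p).comp (ContinuousLinearMap.inl ℝ E ℝ) :=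
    (hF.continuous_fderiv (by simp)).clm_comp continuous_const
  obtain ⟨C, hC⟩ := ((isCompact_closedBall x₀ 1).prod (isCompact_Icc (a := (0 : ℝ)) (b := 1))
    ).exists_bound_of_continuousOn hF'.continuousOn
  refine intervalIntegral.hasFDerivAt_integral_of_dominated_of_fderiv_le (bound := fun _ => C)
    (F' := fun x s => (fderiv ℝ F (x, s)).comp (ContinuousLinearMap.inl ℝ E ℝ))
    (closedBall_mem_nhds x₀ one_pos) ?_ ?_ ?_ ?_ ?_ ?_
  · refine Eventually.of_forall fun x => ?_
    exact (hF.continuous.comp (by fun_prop : Continuous fun s : ℝ => (x, s))).aestronglyMeasurable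
  · exact (hF.continuous.comp
      (by fun_prop : Continuous fun s : ℝ => (x₀, s))).intervalIntegrable _ _
  · exact (hF'.comp (by fun_prop : Continuous fun s : ℝ => (x₀, s))).aestronglyMeasurable
  · refine Eventually.of_forall fun t ht x hx => hC (x, t) ⟨hx, ?_⟩
    rw [uIoc_of_le zero_le_one] at ht
    exact ⟨ht.1.le, ht.2⟩
  · exact intervalIntegrable_const
  · refine Eventually.of_forall fun t _ x _ => ?_
    exact ((hF.differentiable one_ne_zero (x, t)).hasFDerivAt).comp x (hasFDerivAt_prodMk_left x t)

theorem contDiff_intervalIntegral_nat {E : Type} [NormedAddCommGroup E]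
    [NormedSpace ℝ E] [ProperSpace E] (n : ℕ) :
    ∀ {G : Type} [NormedAddCommGroup G] [NormedSpace ℝ G] {F : E × ℝ → G},
      ContDiff ℝ n F → ContDiff ℝ n fun x => ∫ s in (0 : ℝ)..1, F (x, s) := by
  induction n with
  | zero =>
    intro G _ _ F hF
    rw [Nat.cast_zero, contDiff_zero] at hF ⊢
    exact intervalIntegral.continuous_parametric_intervalIntegral_of_continuous'
      (f := fun x s => F (x, s)) hF 0 1
  -- The target space varies in the induction, since the derivative takes values in a space of
  -- linear maps.
  | succ n ih =>
    intro G _ _ F hF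
    have h1 : ContDiff ℝ 1 F := hF.of_le (by exact_mod_cast Nat.le_add_left 1 n)
    rw [Nat.cast_succ, contDiff_succ_iff_hasFDerivAt (n := n)]
    refine ⟨_, ?_, fun x => hasFDerivAt_intervalIntegral_of_contDiff h1 x⟩
    refine ih (F := fun p => (fderiv ℝ F p).comp (ContinuousLinearMap.inl ℝ E ℝ)) ?_
    exact (hF.fderiv_right (m := n) (by norm_cast)).clm_comp contDiff_const

theorem contDiff_intervalIntegral {E G : Type} [NormedAddCommGroup E]
    [NormedSpace ℝ E] [ProperSpace E] [NormedAddCommGroup G] [NormedSpace ℝ G]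
    {F : E × ℝ → G} (hF : ContDiff ℝ ∞ F) :
    ContDiff ℝ ∞ fun x => ∫ s in (0 : ℝ)..1, F (x, s) :=
  contDiff_infty.2 fun n => contDiff_intervalIntegral_nat n (contDiff_infty.1 hF n)

/-- Hadamard's lemma: a smooth function vanishing on `{p.2 = c}` is divisible by `p.2 - c`. -/
theorem exists_contDiff_eq_sub_mul {T : ℝ × ℝ → ℝ} (hT : ContDiff ℝ ∞ T) (c : ℝ)
    (h0 : ∀ a, T (a, c) = 0) :
    ∃ T₁ : ℝ × ℝ → ℝ, ContDiff ℝ ∞ T₁ ∧ ∀ p, T p = (p.2 - c) * T₁ p := by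
  -- The quotient is the average of the second partial derivative over the segment from `(a, c)` to
  -- `(a, r)`.
  refine ⟨fun p => ∫ s in (0 : ℝ)..1, fderiv ℝ T (p.1, c + s * (p.2 - c)) (0, 1), ?_, ?_⟩
  · refine contDiff_intervalIntegral
      (F := fun q : (ℝ × ℝ) × ℝ => fderiv ℝ T (q.1.1, c + q.2 * (q.1.2 - c)) (0, 1)) ?_
    have := hT.fderiv_right (m := ∞) (by simp)
    fun_prop
  · rintro ⟨a, r⟩
    have hd : ∀ s : ℝ, HasDerivAt (fun s => T (a, c + s * (r - c)))
        ((r - c) * fderiv ℝ T (a, c + s * (r - c)) (0, 1)) s := by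
      intro s
      have h1 : HasDerivAt (fun s : ℝ => (a, c + s * (r - c))) (0, r - c) s := by
        refine (hasDerivAt_const s a).prodMk ?_
        simpa using ((hasDerivAt_id s).mul_const (r - c)).const_add c
      have h2 := ((hT.differentiable (by simp) (a, c + s * (r - c))).hasFDerivAt).comp_hasDerivAt s
        h1
      rwa [show ((0 : ℝ), r - c) = (r - c) • ((0 : ℝ), (1 : ℝ)) by simp, map_smul,
        smul_eq_mul] at h2
    have hc : Continuous fun s : ℝ => (r - c) * fderiv ℝ T (a, c + s * (r - c)) (0, 1) := by
      have := hT.continuous_fderiv (by simp)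
      fun_prop
    have := intervalIntegral.integral_eq_sub_of_hasDerivAt (fun s _ => hd s)
      (hc.intervalIntegrable 0 1)
    rw [intervalIntegral.integral_const_mul] at this
    rw [this]
    simp [h0]

theorem contDiff_smul_of_tsupport_subset {E G : Type*} [NormedAddCommGroup E] [NormedSpace ℝ E]
    [NormedAddCommGroup G] [NormedSpace ℝ G] {χ : E → ℝ} {T : E → G} {U : Set E}
    (hU : IsOpen U) (hχ : ContDiff ℝ ∞ χ) (hT : ContDiffOn ℝ ∞ T U) (hsupp : tsupport χ ⊆ U) :
    ContDiff ℝ ∞ fun x => χ x • T x := by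
  rw [contDiff_iff_contDiffAt]
  intro x
  by_cases hx : x ∈ U
  · exact hχ.contDiffAt.smul (hT.contDiffAt (hU.mem_nhds hx))
  · have h0 : (fun x => χ x • T x) =ᶠ[𝓝 x] fun _ => 0 := by
      filter_upwards [notMem_tsupport_iff_eventuallyEq.1 fun h => hx (hsupp h)] with y hy
      simp [hy]
    exact contDiffAt_const.congr_of_eventuallyEq h0

/-- Hadamard's lemma on an open subset of the plane. -/
theorem exists_contDiffOn_eq_sub_mul {U : Set (ℝ × ℝ)} (hU : IsOpen U) {T : ℝ × ℝ → ℝ}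
    (hT : ContDiffOn ℝ ∞ T U) (c : ℝ) (h0 : ∀ a, (a, c) ∈ U → T (a, c) = 0) :
    ∃ T₁ : ℝ × ℝ → ℝ, ContDiffOn ℝ ∞ T₁ U ∧ ∀ p ∈ U, T p = (p.2 - c) * T₁ p := by
  classical
  -- Multiplying by a bump function at `x` reduces to the global version without changing `T` near
  -- `x`.
  have hloc : ∀ x ∈ U, ∃ S : ℝ × ℝ → ℝ, ContDiff ℝ ∞ S ∧ ∀ᶠ p in 𝓝 x, T p = (p.2 - c) * S p := by
    intro x hx
    obtain ⟨δ, hδ, hball⟩ := Metric.nhds_basis_closedBall.mem_iff.1 (hU.mem_nhds hx)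
    let f : ContDiffBump x := ⟨δ / 2, δ, by positivity, by linarith⟩
    have hf0 : ∀ p, p ∉ U → f p = 0 := fun p hp =>
      image_eq_zero_of_notMem_tsupport fun h => hp (hball (f.tsupport_eq ▸ h))
    obtain ⟨S, hS, hSe⟩ := exists_contDiff_eq_sub_mul
      (contDiff_smul_of_tsupport_subset hU f.contDiff hT (f.tsupport_eq ▸ hball)) c
      (fun a => by
        by_cases ha : (a, c) ∈ U
        · simp [h0 a ha]
        · simp [hf0 _ ha])
    refine ⟨S, hS, ?_⟩
    filter_upwards [f.eventuallyEq_one] with p hp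
    rw [← hSe p, hp]
    simp
  -- The local quotients are all given by this one formula: division off the line, the second
  -- partial derivative on it. Hence they glue.
  refine ⟨fun p => if p.2 = c then fderiv ℝ T p (0, 1) else T p / (p.2 - c), ?_, ?_⟩
  · intro x hx
    obtain ⟨S, hS, hSe⟩ := hloc x hx
    refine (hS.contDiffAt.congr_of_eventuallyEq ?_).contDiffWithinAt
    filter_upwards [hSe.eventually_nhds] with p hp
    split_ifs with h
    · have h1 := ((hasFDerivAt_snd (𝕜 := ℝ) (p := p)).sub_const c).mul
        (hS.differentiable (by simp) p).hasFDerivAt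
      have h2 : HasFDerivAt T _ p := h1.congr_of_eventuallyEq hp
      rw [h2.fderiv]
      simp [h]
    · rw [hp.self_of_nhds]
      field_simp [sub_ne_zero.2 h]
  · intro p hp
    dsimp only
    split_ifs with h
    · rw [h, sub_self, zero_mul, ← h0 p.1 (h ▸ hp), ← h]
    · field_simp [sub_ne_zero.2 h]

end Hadamard

/-! ### The outlying sphere to first order -/

section Profile

/-- The first order deviation of the outlying spheres from round ones. -/
def zeta (r : ℝ) : ℝ :=
  r - (r ^ 2 - 5) / 2 * (Real.log (r + 3) - Real.log (r + 1)) - 1 / 2 - 5 / 2 * Real.log 2 +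
    (Real.log 2 - 1) / 2 * r ^ 2

def zetaDeriv (r : ℝ) : ℝ :=
  1 - r * (Real.log (r + 3) - Real.log (r + 1)) - (r ^ 2 - 5) / 2 * ((r + 3)⁻¹ - (r + 1)⁻¹) +
    (Real.log 2 - 1) * r

def zetaDeriv₂ (r : ℝ) : ℝ :=
  -(Real.log (r + 3) - Real.log (r + 1)) - 2 * r * ((r + 3)⁻¹ - (r + 1)⁻¹) -
    (r ^ 2 - 5) / 2 * (-((r + 3) ^ 2)⁻¹ + ((r + 1) ^ 2)⁻¹) + (Real.log 2 - 1)

/-- Multiples of `r² - 5`, which correspond to axial translations of the unit sphere about `2e`,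
solve the homogeneous part of `zeta_equation`. The multiple contained in `zeta` is the one that
gives this zero, so the deformed sphere still passes through the contact point. The logarithms are
regular for `r > 0`, hence at both poles `r = 1` and `r = 3`. -/
theorem zeta_one : zeta 1 = 0 := by
  have : Real.log 4 = 2 * Real.log 2 := by
    rw [show (4 : ℝ) = 2 ^ 2 by norm_num, Real.log_pow]; norm_num
  simp only [zeta]
  norm_num
  rw [this]
  ring

theorem hasDerivAt_zeta {r : ℝ} (hr : 0 < r) : HasDerivAt zeta (zetaDeriv r) r := by
  have h3 : HasDerivAt (fun r : ℝ => Real.log (r + 3)) ((r + 3)⁻¹) r := by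
    simpa using ((hasDerivAt_id r).add_const 3).log (by simp; positivity)
  have h1 : HasDerivAt (fun r : ℝ => Real.log (r + 1)) ((r + 1)⁻¹) r := by
    simpa using ((hasDerivAt_id r).add_const 1).log (by simp; positivity)
  have h2 := hasDerivAt_pow 2 r
  have := ((((hasDerivAt_id r).sub (((h2.sub_const 5).div_const 2).mul (h3.sub h1))).sub_const
    (1 / 2)).sub_const (5 / 2 * Real.log 2)).add (h2.const_mul ((Real.log 2 - 1) / 2))
  refine this.congr_deriv ?_
  simp only [zetaDeriv]
  norm_num
  ring

theorem hasDerivAt_zetaDeriv {r : ℝ} (hr : 0 < r) :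
    HasDerivAt zetaDeriv (zetaDeriv₂ r) r := by
  have h3 : HasDerivAt (fun r : ℝ => Real.log (r + 3)) ((r + 3)⁻¹) r := by
    simpa using ((hasDerivAt_id r).add_const 3).log (by simp; positivity)
  have h1 : HasDerivAt (fun r : ℝ => Real.log (r + 1)) ((r + 1)⁻¹) r := by
    simpa using ((hasDerivAt_id r).add_const 1).log (by simp; positivity)
  have h3' : HasDerivAt (fun r : ℝ => (r + 3)⁻¹) (-((r + 3) ^ 2)⁻¹) r := by
    exact (((hasDerivAt_id r).add_const 3).inv (by simp; positivity)).congr_deriv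
      (by simp [neg_div])
  have h1' : HasDerivAt (fun r : ℝ => (r + 1)⁻¹) (-((r + 1) ^ 2)⁻¹) r := by
    exact (((hasDerivAt_id r).add_const 1).inv (by simp; positivity)).congr_deriv
      (by simp [neg_div])
  have h2 := hasDerivAt_pow 2 r
  have := (((((hasDerivAt_id r).mul (h3.sub h1)).const_sub 1).sub
    (((h2.sub_const 5).div_const 2).mul (h3'.sub h1'))).add
    ((hasDerivAt_id r).const_mul (Real.log 2 - 1)))
  refine this.congr_deriv ?_
  simp only [zetaDeriv₂]
  norm_num
  ring

/-- The linearized constant mean curvature equation on the unit sphere about `2e`. -/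
theorem zeta_equation {r : ℝ} (hr : 0 < r) :
    -2 / r + 2 * (zetaDeriv₂ r + zetaDeriv r / r) -
      4 * (zetaDeriv r * (r ^ 2 - 3) / (2 * r) - zeta r) -
      (3 - r ^ 2) ^ 2 / (2 * r ^ 2) * (zetaDeriv₂ r - zetaDeriv r / r) + (3 - r ^ 2) / r ^ 3 + 4
      = 0 := by
  have h3 : r + 3 ≠ 0 := by positivity
  have h1 : r + 1 ≠ 0 := by positivity
  simp only [zeta, zetaDeriv, zetaDeriv₂]
  generalize Real.log (r + 3) - Real.log (r + 1) = L
  field_simp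
  ring

/-- The factor by which the outlying sphere is dilated onto a round one. -/
def dilation (ε r : ℝ) : ℝ := 1 + 2 * ε * zeta r

/-- The outlying sphere is `{z = height ε r}`, where `z` is the coordinate along the axis. -/
def height (ε r : ℝ) : ℝ := (r ^ 2 + 4 - (dilation ε r ^ 2)⁻¹) / 4

def heightDeriv (ε r : ℝ) : ℝ := r / 2 + ε * zetaDeriv r * (dilation ε r ^ 3)⁻¹

def heightDeriv₂ (ε r : ℝ) : ℝ :=
  1 / 2 + ε * zetaDeriv₂ r * (dilation ε r ^ 3)⁻¹ -
    6 * ε ^ 2 * zetaDeriv r ^ 2 * (dilation ε r ^ 4)⁻¹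

theorem hasDerivAt_dilation {ε r : ℝ} (hr : 0 < r) :
    HasDerivAt (dilation ε) (2 * ε * zetaDeriv r) r :=
  ((hasDerivAt_zeta hr).const_mul (2 * ε)).const_add 1

theorem hasDerivAt_height {ε r : ℝ} (hr : 0 < r) (hD : dilation ε r ≠ 0) :
    HasDerivAt (height ε) (heightDeriv ε r) r := by
  have := (((hasDerivAt_pow 2 r).add_const 4).sub
    (((hasDerivAt_dilation (ε := ε) hr).pow 2).inv (pow_ne_zero 2 hD))).div_const 4
  refine this.congr_deriv ?_
  simp only [heightDeriv, Pi.pow_apply]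
  field_simp
  ring

theorem hasDerivAt_heightDeriv {ε r : ℝ} (hr : 0 < r) (hD : dilation ε r ≠ 0) :
    HasDerivAt (heightDeriv ε) (heightDeriv₂ ε r) r := by
  have := ((hasDerivAt_id r).div_const 2).add (((hasDerivAt_zetaDeriv hr).const_mul ε).mul
    (((hasDerivAt_dilation (ε := ε) hr).pow 3).inv (pow_ne_zero 3 hD)))
  refine this.congr_deriv ?_
  simp only [heightDeriv₂, Pi.pow_apply, Pi.inv_apply]
  field_simp
  ring

/-- The squared length of the normal field `r⁻¹ Z' y - e` of the outlying sphere `{z = Z(r)}`. -/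
def normalSq (ε r : ℝ) : ℝ := 1 - 2 * heightDeriv ε r * height ε r / r + heightDeriv ε r ^ 2

def normalLen (ε r : ℝ) : ℝ := √(normalSq ε r)

/-- Minus the radial component of the normal field of the outlying sphere. -/
def radialPart (ε r : ℝ) : ℝ := height ε r / r - heightDeriv ε r

/-- The Euclidean mean curvature of the outlying sphere. -/
def meanCurv (ε r : ℝ) : ℝ :=
  ((heightDeriv₂ ε r + heightDeriv ε r / r) * normalSq ε r -
    (heightDeriv₂ ε r - heightDeriv ε r / r) * radialPart ε r ^ 2) /
    (normalLen ε r * normalSq ε r)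

/-- The rescaled Schwarzschild factor. -/
def schw (ε r : ℝ) : ℝ := ((1 + ε / (2 * r)) ^ 2)⁻¹

def schwDeriv (ε r : ℝ) : ℝ := ε / r ^ 2 * ((1 + ε / (2 * r)) ^ 3)⁻¹

/-- The rescaled mean curvature of the centred unit sphere. -/
def centredCurv (ε : ℝ) : ℝ := 2 * schw ε 1 - 2 * schwDeriv ε 1

/-- The failure of the outlying sphere to have mean curvature `centredCurv ε` with respect to the
rescaled Schwarzschild metric. -/
def defect (ε r : ℝ) : ℝ :=
  schw ε r * meanCurv ε r + 2 * radialPart ε r * schwDeriv ε r / normalLen ε r - centredCurv ε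

theorem dilation_zero (r : ℝ) : dilation 0 r = 1 := by simp [dilation]
theorem height_zero (r : ℝ) : height 0 r = (r ^ 2 + 3) / 4 := by
  simp [height, dilation_zero]; ring
theorem heightDeriv_zero (r : ℝ) : heightDeriv 0 r = r / 2 := by simp [heightDeriv]
theorem heightDeriv₂_zero (r : ℝ) : heightDeriv₂ 0 r = 1 / 2 := by simp [heightDeriv₂]
theorem normalSq_zero {r : ℝ} (hr : r ≠ 0) : normalSq 0 r = 1 / 4 := by
  simp only [normalSq, height_zero, heightDeriv_zero]; field_simp; ring
theorem normalLen_zero {r : ℝ} (hr : r ≠ 0) : normalLen 0 r = 1 / 2 := by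
  rw [normalLen, normalSq_zero hr, show (1 / 4 : ℝ) = (1 / 2) ^ 2 by norm_num,
    Real.sqrt_sq (by norm_num)]
theorem meanCurv_zero {r : ℝ} (hr : r ≠ 0) : meanCurv 0 r = 2 := by
  simp only [meanCurv, heightDeriv₂_zero, heightDeriv_zero, normalLen_zero hr, normalSq_zero hr]
  field_simp
  ring
theorem schw_zero (r : ℝ) : schw 0 r = 1 := by simp [schw]
theorem schwDeriv_zero (r : ℝ) : schwDeriv 0 r = 0 := by simp [schwDeriv]
theorem centredCurv_zero : centredCurv 0 = 2 := by simp [centredCurv, schw_zero, schwDeriv_zero]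

theorem defect_zero {r : ℝ} (hr : r ≠ 0) : defect 0 r = 0 := by
  simp [defect, schw_zero, schwDeriv_zero, meanCurv_zero hr, centredCurv_zero]

theorem hasDerivAt_dilation_zero (r : ℝ) :
    HasDerivAt (fun ε => dilation ε r) (2 * zeta r) 0 := by
  refine ((((hasDerivAt_id (0 : ℝ)).const_mul 2).mul_const (zeta r)).const_add 1).congr_deriv ?_
  ring

theorem hasDerivAt_height_zero (r : ℝ) : HasDerivAt (fun ε => height ε r) (zeta r) 0 := by
  have := ((((hasDerivAt_dilation_zero r).pow 2).inv
    (by simp [dilation_zero])).const_sub (r ^ 2 + 4)).div_const 4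
  refine this.congr_deriv ?_
  simp [dilation_zero]
  ring

theorem hasDerivAt_heightDeriv_zero (r : ℝ) :
    HasDerivAt (fun ε => heightDeriv ε r) (zetaDeriv r) 0 := by
  have := ((((hasDerivAt_id (0 : ℝ)).mul_const (zetaDeriv r)).mul
    (((hasDerivAt_dilation_zero r).pow 3).inv (by simp [dilation_zero]))).const_add (r / 2))
  refine this.congr_deriv ?_
  simp [dilation_zero]

theorem hasDerivAt_heightDeriv₂_zero (r : ℝ) :
    HasDerivAt (fun ε => heightDeriv₂ ε r) (zetaDeriv₂ r) 0 := by
  have := ((((hasDerivAt_id (0 : ℝ)).mul_const (zetaDeriv₂ r)).mul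
    (((hasDerivAt_dilation_zero r).pow 3).inv (by simp [dilation_zero]))).const_add (1 / 2)).sub
    (((((hasDerivAt_id (0 : ℝ)).pow 2).const_mul 6).mul_const (zetaDeriv r ^ 2)).mul
    (((hasDerivAt_dilation_zero r).pow 4).inv (by simp [dilation_zero])))
  refine this.congr_deriv ?_
  simp [dilation_zero]

theorem hasDerivAt_normalSq_zero {r : ℝ} (hr : r ≠ 0) :
    HasDerivAt (fun ε => normalSq ε r) (zetaDeriv r * (r ^ 2 - 3) / (2 * r) - zeta r) 0 := by
  have := (((((hasDerivAt_heightDeriv_zero r).const_mul 2).mul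
    (hasDerivAt_height_zero r)).div_const r).const_sub 1).add ((hasDerivAt_heightDeriv_zero r).pow 2)
  refine this.congr_deriv ?_
  simp [heightDeriv_zero, height_zero]
  field_simp
  ring

theorem hasDerivAt_normalLen_zero {r : ℝ} (hr : r ≠ 0) :
    HasDerivAt (fun ε => normalLen ε r) (zetaDeriv r * (r ^ 2 - 3) / (2 * r) - zeta r) 0 := by
  refine ((hasDerivAt_normalSq_zero hr).sqrt (by simp [normalSq_zero hr])).congr_deriv ?_
  have := normalLen_zero hr
  rw [normalLen] at this
  rw [this]
  ring

theorem hasDerivAt_schw_zero (r : ℝ) : HasDerivAt (fun ε => schw ε r) (-1 / r) 0 := by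
  have := ((((hasDerivAt_id (0 : ℝ)).div_const (2 * r)).const_add 1).pow 2).inv (by simp)
  refine this.congr_deriv ?_
  simp
  ring

theorem hasDerivAt_schwDeriv_zero (r : ℝ) :
    HasDerivAt (fun ε => schwDeriv ε r) (1 / r ^ 2) 0 := by
  have := ((hasDerivAt_id (0 : ℝ)).div_const (r ^ 2)).mul
    (((((hasDerivAt_id (0 : ℝ)).div_const (2 * r)).const_add 1).pow 3).inv (by simp))
  refine this.congr_deriv ?_
  simp

/-- The derivative of the defect at the round sphere in flat space is the left-hand side of
`zeta_equation`; the final `4` there comes from the centred sphere. -/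
theorem hasDerivAt_defect_zero {r : ℝ} (hr : 0 < r) :
    HasDerivAt (fun ε => defect ε r) 0 0 := by
  have hr' := hr.ne'
  have hb := ((hasDerivAt_height_zero r).div_const r).sub (hasDerivAt_heightDeriv_zero r)
  have hZ1 := (hasDerivAt_heightDeriv_zero r).div_const r
  have hZ2 := hasDerivAt_heightDeriv₂_zero r
  have hN := hasDerivAt_normalLen_zero hr'
  have hNs := hasDerivAt_normalSq_zero hr'
  have hh := (((hZ2.add hZ1).mul hNs).sub ((hZ2.sub hZ1).mul (hb.pow 2))).div (hN.mul hNs)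
    (by simp [normalSq_zero hr', normalLen_zero hr'])
  have := (((hasDerivAt_schw_zero r).mul hh).add
    (((hb.const_mul 2).mul (hasDerivAt_schwDeriv_zero r)).div hN
      (by simp [normalLen_zero hr']))).sub
    (((hasDerivAt_schw_zero 1).const_mul 2).sub ((hasDerivAt_schwDeriv_zero 1).const_mul 2))
  refine this.congr_deriv ?_
  have hode := zeta_equation hr
  simp [normalSq_zero hr', normalLen_zero hr', heightDeriv₂_zero, heightDeriv_zero, height_zero,
    schw_zero, schwDeriv_zero]
  generalize zeta r = a at *
  generalize zetaDeriv r = b at *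
  generalize zetaDeriv₂ r = c at *
  rw [← hode]
  field_simp
  ring

end Profile

/-! ### Cancelling the second order defect -/

section Corrections

theorem contDiffAt_zeta {r : ℝ} (hr : 0 < r) : ContDiffAt ℝ ∞ zeta r := by
  have h3 : r + 3 ≠ 0 := by positivity
  have h1 : r + 1 ≠ 0 := by positivity
  unfold zeta
  fun_prop (disch := assumption)

theorem contDiffAt_zetaDeriv {r : ℝ} (hr : 0 < r) : ContDiffAt ℝ ∞ zetaDeriv r := by
  have h3 : r + 3 ≠ 0 := by positivity
  have h1 : r + 1 ≠ 0 := by positivity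
  unfold zetaDeriv
  fun_prop (disch := assumption)

theorem contDiffAt_zetaDeriv₂ {r : ℝ} (hr : 0 < r) : ContDiffAt ℝ ∞ zetaDeriv₂ r := by
  have h3 : r + 3 ≠ 0 := by positivity
  have h1 : r + 1 ≠ 0 := by positivity
  have h3' : (r + 3) ^ 2 ≠ 0 := by positivity
  have h1' : (r + 1) ^ 2 ≠ 0 := by positivity
  unfold zetaDeriv₂
  fun_prop (disch := assumption)

/-- The parameters for which the profile functions are smooth. -/
structure Regular (p : ℝ × ℝ) : Prop where
  pos : 0 < p.2
  dilation_pos : 0 < dilation p.1 p.2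
  normalSq_pos : 0 < normalSq p.1 p.2
  schw_pos : 0 < 1 + p.1 / (2 * p.2)

variable {p : ℝ × ℝ}

theorem contDiffAt_dilation (hp : 0 < p.2) :
    ContDiffAt ℝ ∞ (fun p : ℝ × ℝ => dilation p.1 p.2) p := by
  have := (contDiffAt_zeta hp).comp p contDiffAt_snd
  unfold dilation
  simp only [Function.comp_def] at this
  fun_prop

theorem contDiffAt_height (hp : 0 < p.2) (hD : 0 < dilation p.1 p.2) :
    ContDiffAt ℝ ∞ (fun p : ℝ × ℝ => height p.1 p.2) p := by
  have h1 := contDiffAt_dilation hp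
  have h2 : dilation p.1 p.2 ^ 2 ≠ 0 := by positivity
  unfold height
  fun_prop (disch := assumption)

theorem contDiffAt_heightDeriv (hp : 0 < p.2) (hD : 0 < dilation p.1 p.2) :
    ContDiffAt ℝ ∞ (fun p : ℝ × ℝ => heightDeriv p.1 p.2) p := by
  have h1 := contDiffAt_dilation hp
  have h2 : dilation p.1 p.2 ^ 3 ≠ 0 := by positivity
  have h3 := (contDiffAt_zetaDeriv hp).comp p contDiffAt_snd
  simp only [Function.comp_def] at h3
  unfold heightDeriv
  fun_prop (disch := assumption)

theorem contDiffAt_heightDeriv₂ (hp : 0 < p.2) (hD : 0 < dilation p.1 p.2) :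
    ContDiffAt ℝ ∞ (fun p : ℝ × ℝ => heightDeriv₂ p.1 p.2) p := by
  have h1 := contDiffAt_dilation hp
  have h2 : dilation p.1 p.2 ^ 3 ≠ 0 := by positivity
  have h2' : dilation p.1 p.2 ^ 4 ≠ 0 := by positivity
  have h3 := (contDiffAt_zetaDeriv hp).comp p contDiffAt_snd
  have h4 := (contDiffAt_zetaDeriv₂ hp).comp p contDiffAt_snd
  simp only [Function.comp_def] at h3 h4
  unfold heightDeriv₂
  fun_prop (disch := assumption)

theorem contDiffAt_normalSq (hp : 0 < p.2) (hD : 0 < dilation p.1 p.2) :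
    ContDiffAt ℝ ∞ (fun p : ℝ × ℝ => normalSq p.1 p.2) p := by
  have h1 := contDiffAt_height hp hD
  have h2 := contDiffAt_heightDeriv hp hD
  have h3 := hp.ne'
  unfold normalSq
  fun_prop (disch := assumption)

theorem contDiffAt_radialPart (hp : 0 < p.2) (hD : 0 < dilation p.1 p.2) :
    ContDiffAt ℝ ∞ (fun p : ℝ × ℝ => radialPart p.1 p.2) p := by
  have h1 := contDiffAt_height hp hD
  have h2 := contDiffAt_heightDeriv hp hD
  have h3 := hp.ne'
  unfold radialPart
  fun_prop (disch := assumption)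

theorem Regular.normalLen_pos (hp : Regular p) : 0 < normalLen p.1 p.2 :=
  Real.sqrt_pos.2 hp.normalSq_pos

theorem Regular.contDiffAt_normalLen (hp : Regular p) :
    ContDiffAt ℝ ∞ (fun p : ℝ × ℝ => normalLen p.1 p.2) p :=
  (contDiffAt_normalSq hp.pos hp.dilation_pos).sqrt hp.normalSq_pos.ne'

theorem Regular.contDiffAt_meanCurv (hp : Regular p) :
    ContDiffAt ℝ ∞ (fun p : ℝ × ℝ => meanCurv p.1 p.2) p := by
  have h1 := contDiffAt_heightDeriv hp.pos hp.dilation_pos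
  have h2 := contDiffAt_heightDeriv₂ hp.pos hp.dilation_pos
  have h3 := hp.pos.ne'
  have h4 := contDiffAt_normalSq hp.pos hp.dilation_pos
  have h5 := contDiffAt_radialPart hp.pos hp.dilation_pos
  have h6 := hp.contDiffAt_normalLen
  have h7 := (mul_pos hp.normalLen_pos hp.normalSq_pos).ne'
  unfold meanCurv
  fun_prop (disch := assumption)

theorem contDiffAt_schw (hp : p.2 ≠ 0) (hw : 0 < 1 + p.1 / (2 * p.2)) :
    ContDiffAt ℝ ∞ (fun p : ℝ × ℝ => schw p.1 p.2) p := by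
  have h1 : 2 * p.2 ≠ 0 := by simpa using hp
  have h2 : (1 + p.1 / (2 * p.2)) ^ 2 ≠ 0 := by positivity
  unfold schw
  fun_prop (disch := assumption)

theorem contDiffAt_schwDeriv (hp : p.2 ≠ 0) (hw : 0 < 1 + p.1 / (2 * p.2)) :
    ContDiffAt ℝ ∞ (fun p : ℝ × ℝ => schwDeriv p.1 p.2) p := by
  have h1 : 2 * p.2 ≠ 0 := by simpa using hp
  have h2 : (1 + p.1 / (2 * p.2)) ^ 3 ≠ 0 := by positivity
  have h3 : p.2 ^ 2 ≠ 0 := pow_ne_zero 2 hp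
  unfold schwDeriv
  fun_prop (disch := assumption)

theorem contDiffAt_centredCurv (hw : 0 < 1 + p.1 / 2) :
    ContDiffAt ℝ ∞ (fun p : ℝ × ℝ => centredCurv p.1) p := by
  have h1 : (1 + p.1 / 2) ^ 2 ≠ 0 := by positivity
  have h2 : (1 + p.1 / 2) ^ 3 ≠ 0 := by positivity
  unfold centredCurv schw schwDeriv
  simp only [mul_one, one_pow, div_one]
  fun_prop (disch := assumption)

theorem Regular.contDiffAt_defect (hp : Regular p) (hw : 0 < 1 + p.1 / 2) :
    ContDiffAt ℝ ∞ (fun p : ℝ × ℝ => defect p.1 p.2) p := by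
  have h1 := contDiffAt_centredCurv hw
  have h2 := contDiffAt_schw hp.pos.ne' hp.schw_pos
  have h3 := contDiffAt_schwDeriv hp.pos.ne' hp.schw_pos
  have h4 := hp.contDiffAt_meanCurv
  have h5 := contDiffAt_radialPart hp.pos hp.dilation_pos
  have h6 := hp.contDiffAt_normalLen
  have h7 := hp.normalLen_pos.ne'
  unfold defect
  fun_prop (disch := assumption)

theorem eventually_regular {r : ℝ} (hr : 0 < r) : ∀ᶠ p in 𝓝 ((0 : ℝ), r), Regular p := by
  have h1 : ∀ᶠ p : ℝ × ℝ in 𝓝 ((0 : ℝ), r), 0 < p.2 :=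
    continuousAt_snd.eventually (lt_mem_nhds hr)
  have h2 : ∀ᶠ p : ℝ × ℝ in 𝓝 ((0 : ℝ), r), 0 < dilation p.1 p.2 :=
    (contDiffAt_dilation (p := (0, r)) hr).continuousAt.eventually
      (lt_mem_nhds (by simp [dilation_zero]))
  have h3 : ∀ᶠ p : ℝ × ℝ in 𝓝 ((0 : ℝ), r), 0 < normalSq p.1 p.2 :=
    (contDiffAt_normalSq (p := (0, r)) hr (by simp [dilation_zero])).continuousAt.eventually
      (lt_mem_nhds (by simp [normalSq_zero hr.ne']))
  have h4 : ∀ᶠ p : ℝ × ℝ in 𝓝 ((0 : ℝ), r), 0 < 1 + p.1 / (2 * p.2) := by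
    have : ContinuousAt (fun p : ℝ × ℝ => 1 + p.1 / (2 * p.2)) (0, r) := by
      have : 2 * ((0 : ℝ), r).2 ≠ 0 := by simpa using hr.ne'
      fun_prop (disch := assumption)
    exact this.eventually (lt_mem_nhds (by simp))
  filter_upwards [h1, h2, h3, h4] with p a b c d using ⟨a, b, c, d⟩

/-- The conditions are open and hold at `ε = 0` for every `r > 0`, so compactness gives a uniform
`δ`. The interval leaves room around `[1/2, 4]`, where the perturbation will live. -/
theorem exists_forall_regular : ∃ δ > 0, δ ≤ 1 ∧ ∀ ε ∈ Ioo (-δ) δ, ∀ r ∈ Icc (1 / 4 : ℝ) 5,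
    Regular (ε, r) := by
  have := (isCompact_Icc (a := (1 / 4 : ℝ)) (b := 5)).eventually_forall_of_forall_eventually
    (x₀ := (0 : ℝ)) (P := fun ε r => Regular (ε, r))
    (fun r hr => eventually_regular (by linarith [hr.1]))
  obtain ⟨δ, hδ, h⟩ := Metric.eventually_nhds_iff.1 this
  refine ⟨min δ 1, by positivity, min_le_right _ _, fun ε hε => h ?_⟩
  rw [Real.dist_eq, sub_zero, abs_lt]
  exact ⟨by linarith [hε.1, min_le_left δ 1], hε.2.trans_le (min_le_left _ _)⟩

/-- The effect of the coordinate `z` on the mean curvature of the outlying sphere. -/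
def effectHeight (ε r : ℝ) : ℝ :=
  meanCurv ε r * height ε r + 2 / normalLen ε r * (1 - heightDeriv ε r * height ε r / r)

/-- The effect of `r - z` on the mean curvature of the outlying sphere. -/
def effectGap (ε r : ℝ) : ℝ :=
  meanCurv ε r * (r - height ε r) +
    2 / normalLen ε r * (radialPart ε r - (1 - heightDeriv ε r * height ε r / r))

theorem Regular.contDiffAt_effectHeight (hp : Regular p) :
    ContDiffAt ℝ ∞ (fun p : ℝ × ℝ => effectHeight p.1 p.2) p := by
  have h1 := contDiffAt_height hp.pos hp.dilation_pos
  have h2 := contDiffAt_heightDeriv hp.pos hp.dilation_pos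
  have h4 := hp.contDiffAt_meanCurv
  have h6 := hp.contDiffAt_normalLen
  have h7 := hp.normalLen_pos.ne'
  have h8 := hp.pos.ne'
  unfold effectHeight
  fun_prop (disch := assumption)

theorem Regular.contDiffAt_effectGap (hp : Regular p) :
    ContDiffAt ℝ ∞ (fun p : ℝ × ℝ => effectGap p.1 p.2) p := by
  have h1 := contDiffAt_height hp.pos hp.dilation_pos
  have h2 := contDiffAt_heightDeriv hp.pos hp.dilation_pos
  have h4 := hp.contDiffAt_meanCurv
  have h5 := contDiffAt_radialPart hp.pos hp.dilation_pos
  have h6 := hp.contDiffAt_normalLen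
  have h7 := hp.normalLen_pos.ne'
  have h8 := hp.pos.ne'
  unfold effectGap
  fun_prop (disch := assumption)

/-- Exact for every `ε` because `zeta 1 = 0`. Both the contact with the centred sphere and the zero
of `effectGap` rest on it. -/
theorem height_one (ε : ℝ) : height ε 1 = 1 := by
  norm_num [height, dilation, zeta_one]

theorem effectGap_one (ε : ℝ) : effectGap ε 1 = 0 := by
  simp [effectGap, height_one, radialPart]

theorem effectHeight_zero_one : effectHeight 0 1 = 4 := by
  simp only [effectHeight, meanCurv_zero one_ne_zero, height_one, normalLen_zero one_ne_zero,
    heightDeriv_zero]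
  norm_num

theorem effectGap_zero {r : ℝ} (hr : r ≠ 0) : effectGap 0 r = r + 3 * r⁻¹ - 4 := by
  simp only [effectGap, meanCurv_zero hr, height_zero, normalLen_zero hr, heightDeriv_zero,
    radialPart]
  field_simp
  ring

theorem exists_division_fst {U : Set (ℝ × ℝ)} (hU : IsOpen U) {T : ℝ × ℝ → ℝ}
    (hT : ContDiffOn ℝ ∞ T U) (h0 : ∀ r, (0, r) ∈ U → T (0, r) = 0) :
    ∃ T₁ : ℝ × ℝ → ℝ, ContDiffOn ℝ ∞ T₁ U ∧ ∀ p ∈ U, T p = p.1 * T₁ p := by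
  obtain ⟨S, hS, hTS⟩ := exists_contDiffOn_eq_sub_mul (U := Prod.swap ⁻¹' U)
    (hU.preimage continuous_swap) (T := T ∘ Prod.swap)
    (hT.comp (contDiff_snd.prodMk contDiff_fst).contDiffOn fun _ h => h) 0 (fun a ha => h0 a ha)
  refine ⟨S ∘ Prod.swap, hS.comp (contDiff_snd.prodMk contDiff_fst).contDiffOn
    fun p hp => by simpa using hp, fun p hp => ?_⟩
  simpa using hTS p.swap (by simpa using hp)

/-- If moreover the first order term vanishes, a smooth function is divisible twice. -/
theorem exists_division_sq_fst {U : Set (ℝ × ℝ)} (hU : IsOpen U) {T : ℝ × ℝ → ℝ}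
    (hT : ContDiffOn ℝ ∞ T U) (h0 : ∀ r, (0, r) ∈ U → T (0, r) = 0)
    (h1 : ∀ r, (0, r) ∈ U → HasDerivAt (fun ε => T (ε, r)) 0 0) :
    ∃ T₁ : ℝ × ℝ → ℝ, ContDiffOn ℝ ∞ T₁ U ∧ ∀ p ∈ U, T p = p.1 ^ 2 * T₁ p := by
  obtain ⟨S, hS, hTS⟩ := exists_division_fst hU hT h0
  -- On `ε = 0` the first quotient equals the `ε`-derivative of `T`, which vanishes; so it can be
  -- divided once more.
  have hS0 : ∀ r, (0, r) ∈ U → S (0, r) = 0 := by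
    intro r hr
    have hm : ContinuousAt (fun ε : ℝ => (ε, r)) 0 := by fun_prop
    have hd : DifferentiableAt ℝ (fun ε => S (ε, r)) 0 := by
      have := (hS.contDiffAt (hU.mem_nhds hr)).differentiableAt (by simp)
      exact this.comp (0 : ℝ) (by fun_prop : DifferentiableAt ℝ (fun ε : ℝ => (ε, r)) 0)
    have h2 : HasDerivAt (fun ε => T (ε, r)) (S (0, r)) 0 := by
      have := (hasDerivAt_id (0 : ℝ)).mul hd.hasDerivAt
      refine (this.congr_of_eventuallyEq ?_).congr_deriv (by simp)
      filter_upwards [hm.eventually (hU.mem_nhds hr)] with ε hε using hTS _ hε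
    exact h2.unique (h1 r hr)
  obtain ⟨S', hS', hSS'⟩ := exists_division_fst hU hS hS0
  exact ⟨S', hS', fun p hp => by rw [hTS p hp, hSS' p hp]; ring⟩

/-- The smooth coefficients of a perturbation of the conformal factor that makes the outlying
sphere a surface of constant mean curvature `centredCurv ε`. -/
theorem exists_correction : ∃ δ > 0, δ ≤ 1 ∧ (∀ ε ∈ Ioo (-δ) δ, ∀ r ∈ Icc (1 / 4 : ℝ) 5,
      Regular (ε, r)) ∧ ∃ (β γ : ℝ → ℝ) (m : ℝ × ℝ → ℝ),
    ContDiffOn ℝ ∞ β (Ioo (-δ) δ) ∧ ContDiffOn ℝ ∞ γ (Ioo (-δ) δ) ∧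
    ContDiffOn ℝ ∞ m (Ioo (-δ) δ ×ˢ Ioo (1 / 4) 5) ∧
    ∀ ε ∈ Ioo (-δ) δ, ∀ r ∈ Ioo (1 / 4 : ℝ) 5,
      defect ε r + ε ^ 2 * (β ε * effectHeight ε r + γ ε * effectGap ε r +
        2 * normalLen ε r * (r - 1) ^ 2 * m (ε, r)) = 0 := by
  obtain ⟨δ, hδ, hδ1, hreg⟩ := exists_forall_regular
  set U : Set (ℝ × ℝ) := Ioo (-δ) δ ×ˢ Ioo (1 / 4) 5 with hUdef
  have hU : IsOpen U := isOpen_Ioo.prod isOpen_Ioo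
  have hregU : ∀ p ∈ U, Regular p := fun p hp => hreg p.1 hp.1 p.2 (Ioo_subset_Icc_self hp.2)
  have hone : ∀ ε ∈ Ioo (-δ) δ, (ε, (1 : ℝ)) ∈ U := fun ε hε => ⟨hε, by norm_num, by norm_num⟩
  -- `q` is the defect divided by `ε²`, smooth across `ε = 0`.
  obtain ⟨q, hq, hqe⟩ := exists_division_sq_fst hU (T := fun p => defect p.1 p.2)
    (fun p hp => ((hregU p hp).contDiffAt_defect
      (by linarith [hp.1.1])).contDiffWithinAt)
    (fun r hr => defect_zero (hregU _ hr).pos.ne')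
    (fun r hr => hasDerivAt_defect_zero (hregU _ hr).pos)
  obtain ⟨B, hB, hBe⟩ := exists_contDiffOn_eq_sub_mul hU (T := fun p => effectGap p.1 p.2)
    (fun p hp => (hregU p hp).contDiffAt_effectGap.contDiffWithinAt) 1
    (fun a _ => effectGap_one a)
  have hA : ContDiffOn ℝ ∞ (fun p : ℝ × ℝ => effectHeight p.1 p.2) U :=
    fun p hp => (hregU p hp).contDiffAt_effectHeight.contDiffWithinAt
  have h00 : ((0 : ℝ), (1 : ℝ)) ∈ U := hone 0 ⟨by linarith, hδ⟩
  -- The zero of `effectGap` at `r = 1` is simple: for `ε = 0` the function is `r + 3/r - 4`, with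
  -- slope `-2` there. This persists for small `ε`.
  have hB0 : B (0, 1) = -2 := by
    have h1 : HasDerivAt (fun r : ℝ => r + 3 * r⁻¹ - 4) (-2) 1 :=
      (((hasDerivAt_id (1 : ℝ)).add ((hasDerivAt_inv one_ne_zero).const_mul 3)).sub_const
        4).congr_deriv (by norm_num)
    have hd : DifferentiableAt ℝ (fun r => B (0, r)) 1 :=
      ((hB.contDiffAt (hU.mem_nhds h00)).differentiableAt (by simp)).comp (1 : ℝ)
        (by fun_prop : DifferentiableAt ℝ (fun r : ℝ => ((0 : ℝ), r)) 1)
    have h2 := ((hasDerivAt_id (1 : ℝ)).sub_const 1).mul hd.hasDerivAt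
    have h3 := h1.congr_of_eventuallyEq (f₁ := fun r => (r - 1) * B (0, r)) (by
      have hc : ContinuousAt (fun r : ℝ => ((0 : ℝ), r)) 1 := by fun_prop
      filter_upwards [hc.eventually (hU.mem_nhds h00)] with r hr
      rw [← hBe _ hr, effectGap_zero (hregU _ hr).pos.ne'])
    simpa using h2.unique h3
  have hat : ∀ᶠ ε : ℝ in 𝓝 0, effectHeight ε 1 ≠ 0 ∧ B (ε, 1) ≠ 0 := by
    have hc : ContinuousAt (fun ε : ℝ => (ε, (1 : ℝ))) 0 := by fun_prop
    have c1 := ((hA.contDiffAt (hU.mem_nhds h00)).continuousAt.comp_of_eq hc rfl)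
    have c2 := ((hB.contDiffAt (hU.mem_nhds h00)).continuousAt.comp_of_eq hc rfl)
    refine (c1.eventually_ne ?_).and (c2.eventually_ne ?_)
    · simp [effectHeight_zero_one]
    · simp [hB0]
  obtain ⟨δ', hδ', hne⟩ := Metric.eventually_nhds_iff.1 hat
  have hsub : Ioo (-min δ δ') (min δ δ') ⊆ Ioo (-δ) δ :=
    Ioo_subset_Ioo (neg_le_neg (min_le_left _ _)) (min_le_left _ _)
  have hne' : ∀ ε ∈ Ioo (-min δ δ') (min δ δ'), effectHeight ε 1 ≠ 0 ∧ B (ε, 1) ≠ 0 := by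
    intro ε hε
    refine hne ?_
    rw [Real.dist_eq, sub_zero, abs_lt]
    exact ⟨by linarith [hε.1, min_le_right δ δ'], hε.2.trans_le (min_le_right _ _)⟩
  refine ⟨min δ δ', by positivity, (min_le_left _ _).trans hδ1, fun ε hε => hreg ε (hsub hε), ?_⟩
  set V : Set (ℝ × ℝ) := Ioo (-min δ δ') (min δ δ') ×ˢ Ioo (1 / 4) 5
  have hVU : V ⊆ U := prod_mono hsub subset_rfl
  have hV : IsOpen V := isOpen_Ioo.prod isOpen_Ioo
  have honeV : ∀ ε ∈ Ioo (-min δ δ') (min δ δ'), (ε, (1 : ℝ)) ∈ V :=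
    fun ε hε => ⟨hε, by norm_num, by norm_num⟩
  have hrestrict : ∀ {S : ℝ × ℝ → ℝ}, ContDiffOn ℝ ∞ S V →
      ContDiffOn ℝ ∞ (fun ε => S (ε, 1)) (Ioo (-min δ δ') (min δ δ')) := fun hS =>
    hS.comp (f := fun ε : ℝ => (ε, (1 : ℝ))) (by fun_prop) honeV
  have hextend : ∀ {s : ℝ → ℝ}, ContDiffOn ℝ ∞ s (Ioo (-min δ δ') (min δ δ')) →
      ContDiffOn ℝ ∞ (fun p : ℝ × ℝ => s p.1) V := fun hs =>
    hs.comp (f := fun p : ℝ × ℝ => p.1) (by fun_prop) fun p hp => hp.1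
  -- `β` cancels the value of `q` at `r = 1`.
  have hβ : ContDiffOn ℝ ∞ (fun ε => -q (ε, 1) / effectHeight ε 1)
      (Ioo (-min δ δ') (min δ δ')) :=
    (hrestrict (hq.mono hVU)).neg.div (hrestrict (hA.mono hVU)) fun ε hε => (hne' ε hε).1
  set β : ℝ → ℝ := fun ε => -q (ε, 1) / effectHeight ε 1 with hβdef
  obtain ⟨T, hT, hTe⟩ := exists_contDiffOn_eq_sub_mul hV
    (T := fun p => q p + β p.1 * effectHeight p.1 p.2)
    ((hq.mono hVU).add ((hextend hβ).mul (hA.mono hVU))) 1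
    (fun a ha => by
      have := (hne' a ha.1).1
      simp only [hβdef]
      field_simp
      ring)
  -- `γ` cancels the first order term at `r = 1`, leaving a multiple of `(r - 1)²`.
  have hγ : ContDiffOn ℝ ∞ (fun ε => -T (ε, 1) / B (ε, 1)) (Ioo (-min δ δ') (min δ δ')) :=
    (hrestrict hT).neg.div (hrestrict (hB.mono hVU)) fun ε hε => (hne' ε hε).2
  set γ : ℝ → ℝ := fun ε => -T (ε, 1) / B (ε, 1) with hγdef
  obtain ⟨T', hT', hTe'⟩ := exists_contDiffOn_eq_sub_mul hV
    (T := fun p => T p + γ p.1 * B p)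
    (hT.add ((hextend hγ).mul (hB.mono hVU))) 1
    (fun a ha => by
      have := (hne' a ha.1).2
      simp only [hγdef]
      field_simp
      ring)
  have hN : ContDiffOn ℝ ∞ (fun p : ℝ × ℝ => 2 * normalLen p.1 p.2) V := fun p hp =>
    ((hregU p (hVU hp)).contDiffAt_normalLen.const_smul (2 : ℝ)).contDiffWithinAt
  -- What remains is `(r - 1)² T'`, matched by `m` after division by the factor `2 * normalLen` with
  -- which it enters.
  refine ⟨β, γ, fun p => -T' p / (2 * normalLen p.1 p.2), hβ, hγ, hT'.neg.div hN fun p hp => ?_,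
    fun ε hε r hr => ?_⟩
  · have := (hregU p (hVU hp)).normalLen_pos
    positivity
  · have hp : (ε, r) ∈ V := ⟨hε, hr⟩
    have hN0 := (hregU _ (hVU hp)).normalLen_pos.ne'
    have e1 := hqe _ (hVU hp)
    have e2 := hBe _ (hVU hp)
    have e3 := hTe _ hp
    have e4 := hTe' _ hp
    simp only at e1 e2 e3 e4 hN0 ⊢
    have e5 : 2 * normalLen ε r * (r - 1) ^ 2 * (-T' (ε, r) / (2 * normalLen ε r)) =
        -((r - 1) ^ 2 * T' (ε, r)) := by
      field_simp
    rw [e5, e1, e2]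
    linear_combination ε ^ 2 * e3 + ε ^ 2 * (r - 1) * e4

end Corrections

/-! ### Images of the unit sphere under diffeomorphisms -/

section Spheres

/-- A smooth diffeomorphism of `ℝ³`. -/
structure Diffeo where
  toFun : E3 → E3
  invFun : E3 → E3
  contDiff : ContDiff ℝ ∞ toFun
  contDiff_inv : ContDiff ℝ ∞ invFun
  left_inv : ∀ x, invFun (toFun x) = x
  right_inv : ∀ x, toFun (invFun x) = x

theorem contMDiff_val_S2 : ContMDiff (𝓡 2) 𝓘(ℝ, E3) ∞ ((↑) : S2 → E3) := contMDiff_coe_sphere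

theorem injective_mfderiv_val_S2 (p : S2) :
    Function.Injective (mfderiv (𝓡 2) 𝓘(ℝ, E3) ((↑) : S2 → E3) p) := by
  convert! injective_mvfderiv_subtypeVal_sphere p

/-- The image of the round unit sphere under a diffeomorphism of `ℝ³`. -/
def Diffeo.sphere (Φ : Diffeo) : EmbeddedSphere where
  toFun p := Φ.toFun p
  smooth := Φ.contDiff.contMDiff.comp contMDiff_val_S2
  injective p q h := Subtype.ext (by rw [← Φ.left_inv p, ← Φ.left_inv q]; exact congrArg _ h)
  immersion p := by
    have hs : ContMDiff (𝓡 2) 𝓘(ℝ, E3) ∞ fun p : S2 => Φ.toFun p :=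
      Φ.contDiff.contMDiff.comp contMDiff_val_S2
    have h := mfderiv_comp (I := 𝓡 2) (I' := 𝓘(ℝ, E3)) (I'' := 𝓘(ℝ, E3)) p
      (g := Φ.invFun) (f := fun p : S2 => Φ.toFun p)
      (Φ.contDiff_inv.contMDiff.mdifferentiableAt (by simp)) (hs.mdifferentiableAt (by simp))
    have he : (Φ.invFun ∘ fun p : S2 => Φ.toFun p) = ((↑) : S2 → E3) := by
      funext q; exact Φ.left_inv q
    rw [he] at h
    have hi := injective_mfderiv_val_S2 p
    rw [h] at hi
    exact Function.Injective.of_comp (f := mfderiv 𝓘(ℝ, E3) 𝓘(ℝ, E3) Φ.invFun (Φ.toFun p)) hi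

theorem Diffeo.sphere_apply (Φ : Diffeo) (p : S2) : Φ.sphere.toFun p = Φ.toFun p := rfl

theorem Diffeo.mem_carrier (Φ : Diffeo) {x : E3} : x ∈ Φ.sphere.carrier ↔ ‖Φ.invFun x‖ = 1 := by
  constructor
  · rintro ⟨p, rfl⟩
    rw [Φ.sphere_apply, Φ.left_inv]
    simp
  · intro h
    exact ⟨⟨Φ.invFun x, by simpa using h⟩, Φ.right_inv x⟩

theorem isPreconnected_one_lt_norm : IsPreconnected {y : E3 | 1 < ‖y‖} := by
  have hrank : 1 < Module.rank ℝ E3 := by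
    rw [← Module.finrank_eq_rank]
    simp
  have h := (isPreconnected_Ioi (a := (1 : ℝ))).prod (isPreconnected_sphere hrank (0 : E3) 1)
  have h2 := h.image (fun q : ℝ × E3 => q.1 • q.2) (by fun_prop)
  convert h2 using 1
  ext y
  constructor
  · intro hy
    have hy0 : ‖y‖ ≠ 0 := by
      have : 1 < ‖y‖ := hy
      positivity
    refine ⟨(‖y‖, ‖y‖⁻¹ • y), ⟨hy, ?_⟩, ?_⟩
    · simp [norm_smul, hy0]
    · simp [smul_smul, hy0]
  · rintro ⟨⟨t, u⟩, ⟨ht, hu⟩, rfl⟩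
    have ht' : 1 < t := ht
    have hu' : ‖u‖ = 1 := by simpa using hu
    simp only [mem_ofPred_eq, norm_smul, hu', mul_one, Real.norm_eq_abs]
    exact ht'.trans_le (le_abs_self t)

/-- The image of the exterior of the unit ball is connected and unbounded, since boundedness would
pass back through the continuous inverse by compactness; so no point of it lies in a bounded
component. From an interior point, a connected set avoiding the surface cannot cross the level
`‖Φ⁻¹‖ = 1`, so it stays in the compact image of the closed ball. -/
theorem Diffeo.mem_enclosed (Φ : Diffeo) {x : E3} : x ∈ Φ.sphere.enclosed ↔ ‖Φ.invFun x‖ < 1 := by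
  have hcont : Continuous fun x => ‖Φ.invFun x‖ := Φ.contDiff_inv.continuous.norm
  constructor
  · rintro ⟨hx, hb⟩
    rw [Φ.mem_carrier] at hx
    by_contra hlt
    have hgt : 1 < ‖Φ.invFun x‖ := lt_of_le_of_ne (not_lt.1 hlt) (Ne.symm hx)
    have hsub : Φ.toFun '' {y | 1 < ‖y‖} ⊆ connectedComponentIn Φ.sphere.carrierᶜ x := by
      refine (isPreconnected_one_lt_norm.image _ Φ.contDiff.continuous.continuousOn
        ).subset_connectedComponentIn ⟨_, hgt, Φ.right_inv x⟩ ?_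
      rintro _ ⟨y, hy, rfl⟩
      rw [mem_compl_iff, Φ.mem_carrier, Φ.left_inv]
      exact ne_of_gt hy
    have hK : IsCompact (closure (Φ.toFun '' {y | 1 < ‖y‖})) := (hb.subset hsub).isCompact_closure
    obtain ⟨C, hC⟩ := (hK.image Φ.contDiff_inv.continuous).isBounded.exists_norm_le
    obtain ⟨y, hy⟩ := NormedSpace.exists_lt_norm ℝ E3 (max C 1)
    have := hC y ⟨Φ.toFun y, subset_closure ⟨y, (le_max_right _ _).trans_lt hy, rfl⟩, Φ.left_inv y⟩
    exact absurd ((le_max_left C 1).trans_lt hy) (not_lt.2 this)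
  · intro hx
    have hxc : x ∉ Φ.sphere.carrier := fun h => hx.ne (Φ.mem_carrier.1 h)
    refine ⟨hxc, ?_⟩
    refine (((isCompact_closedBall (0 : E3) 1).image Φ.contDiff.continuous).isBounded).subset ?_
    intro y hy
    refine ⟨Φ.invFun y, ?_, Φ.right_inv y⟩
    rw [mem_closedBall_zero_iff]
    by_contra hgt
    have hpre := (isPreconnected_connectedComponentIn (x := x) (F := Φ.sphere.carrierᶜ)).image _
      hcont.continuousOn
    have : (1 : ℝ) ∈ (fun x => ‖Φ.invFun x‖) '' connectedComponentIn Φ.sphere.carrierᶜ x :=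
      hpre.Icc_subset ⟨x, mem_connectedComponentIn hxc, rfl⟩ ⟨y, hy, rfl⟩ ⟨hx.le, (not_le.1 hgt).le⟩
    obtain ⟨z, hz, hz1⟩ := this
    exact connectedComponentIn_subset _ _ hz (Φ.mem_carrier.2 hz1)

/-- A function which is constant on the surface has vanishing tangential derivatives. -/
theorem EmbeddedSphere.fderiv_diff_eq_zero (S : EmbeddedSphere) {f : E3 → ℝ} {c : ℝ} {p : S2}
    (hf : DifferentiableAt ℝ f (S.toFun p)) (h : ∀ᶠ q in 𝓝 p, f (S.toFun q) = c)
    (X : TangentSpace (𝓡 2) p) : fderiv ℝ f (S.toFun p) (S.diff p X) = 0 := by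
  have h1 := mfderiv_comp (I := 𝓡 2) (I' := 𝓘(ℝ, E3)) (I'' := 𝓘(ℝ, ℝ)) p
    (g := f) (f := S.toFun) hf.mdifferentiableAt (S.smooth.mdifferentiableAt (by simp))
  have h2 : mfderiv (𝓡 2) 𝓘(ℝ, ℝ) (f ∘ S.toFun) p = 0 := by
    have : (f ∘ S.toFun) =ᶠ[𝓝 p] fun _ => c := h
    rw [this.mfderiv_eq, mfderiv_const]
    rfl
  rw [h2, mfderiv_eq_fderiv] at h1
  exact (congrArg (fun L => L X) h1).symm

theorem EmbeddedSphere.finrank_tangentPlane (S : EmbeddedSphere) (p : S2) :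
    Module.finrank ℝ (S.tangentPlane p) = 2 := by
  have := LinearMap.finrank_range_of_inj (f := (S.diff p).toLinearMap) (S.immersion p)
  rw [EmbeddedSphere.tangentPlane, this]
  exact (finrank_euclideanSpace_fin (𝕜 := ℝ) (n := 2))

theorem EmbeddedSphere.tangentPlane_eq_of_inner_eq_zero (S : EmbeddedSphere) (p : S2) {u : E3}
    (hu : u ≠ 0) (h : ∀ X, inner ℝ u (S.diff p X) = 0) :
    S.tangentPlane p = (Submodule.span ℝ {u})ᗮ := by
  refine Submodule.eq_of_le_of_finrank_eq ?_ ?_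
  · rintro _ ⟨X, rfl⟩
    rw [Submodule.mem_orthogonal_singleton_iff_inner_right]
    exact h X
  · rw [S.finrank_tangentPlane]
    exact (Submodule.finrank_orthogonal_span_singleton (n := 2) hu).symm

/-- A map of the form `x ↦ ε x - c + Θ (ε x)` with `Θ` sufficiently Lipschitz is inverse to a
diffeomorphism. -/
theorem exists_diffeo {Θ : E3 → E3} (hΘ : ContDiff ℝ ∞ Θ) {K : NNReal} (hK : K < 1)
    (hL : LipschitzWith K Θ) (c : E3) {ε : ℝ} (hε : 0 < ε) :
    ∃ Φ : Diffeo, ∀ x, Φ.invFun x = ε • x - c + Θ (ε • x) := by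
  -- `G` differs from a translation by a `K`-Lipschitz map with `K < 1`. This makes it a
  -- homeomorphism, and `v + DΘ v = 0` forces `v = 0`, so the inverse function theorem gives a
  -- smooth inverse.
  let G : E3 → E3 := fun y => y - c + Θ y
  have hG : ContDiff ℝ ∞ G := (contDiff_id.sub contDiff_const).add hΘ
  have happ : ApproximatesLinearOn G ((ContinuousLinearEquiv.refl ℝ E3 : E3 →L[ℝ] E3)) univ K := by
    rw [ApproximatesLinearOn.approximatesLinearOn_iff_lipschitzOnWith, lipschitzOnWith_univ]
    have : G - ⇑((ContinuousLinearEquiv.refl ℝ E3 : E3 →L[ℝ] E3)) = fun y => Θ y - c := by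
      funext y; simp [G]; abel
    rw [this]
    exact LipschitzWith.of_dist_le_mul fun x y => by simpa using hL.dist_le_mul x y
  have hnorm : ‖((ContinuousLinearEquiv.refl ℝ E3).symm : E3 →L[ℝ] E3)‖₊ = 1 := by
    have : ‖ContinuousLinearMap.id ℝ E3‖₊ = 1 := by
      ext; simp
    exact this
  let h : E3 ≃ₜ E3 := happ.toHomeomorph G (Or.inr (by rw [hnorm]; simpa using hK))
  have hh : ∀ y, h y = G y := fun y => rfl
  have hder : ∀ y, ∃ L : E3 ≃L[ℝ] E3, HasFDerivAt G (L : E3 →L[ℝ] E3) y := by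
    intro y
    have hd := (hG.differentiable (by simp) y).hasFDerivAt
    have hinj : Function.Injective (fderiv ℝ G y) := by
      rw [injective_iff_map_eq_zero]
      intro v hv
      have h1 : fderiv ℝ G y v = v + fderiv ℝ Θ y v := by
        have := (((hasFDerivAt_id y).sub_const c).add
          (hΘ.differentiable (by simp) y).hasFDerivAt).fderiv
        rw [show fderiv ℝ G y = _ from this]
        simp
      have h2 : ‖fderiv ℝ Θ y v‖ ≤ K * ‖v‖ :=
        (ContinuousLinearMap.le_opNorm _ _).trans
          (mul_le_mul_of_nonneg_right (norm_fderiv_le_of_lipschitz ℝ hL) (norm_nonneg _))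
      have h3 : v = -fderiv ℝ Θ y v := eq_neg_of_add_eq_zero_left (h1 ▸ hv)
      have h4 : ‖v‖ ≤ K * ‖v‖ := by
        calc ‖v‖ = ‖fderiv ℝ Θ y v‖ := by conv_lhs => rw [h3, norm_neg]
          _ ≤ _ := h2
      by_contra hv0
      have : 0 < ‖v‖ := norm_pos_iff.2 hv0
      have hK' : (K : ℝ) < 1 := by exact_mod_cast hK
      nlinarith
    let L := (LinearEquiv.ofInjectiveEndo (fderiv ℝ G y).toLinearMap hinj).toContinuousLinearEquiv
    refine ⟨L, ?_⟩
    have hLe : (L : E3 →L[ℝ] E3) = fderiv ℝ G y := ContinuousLinearMap.ext fun v => rfl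
    rw [hLe]
    exact hd
  have hinv : ContDiff ℝ ∞ h.symm := by
    rw [contDiff_iff_contDiffAt]
    intro a
    obtain ⟨L, hL'⟩ := hder (h.symm a)
    exact h.toOpenPartialHomeomorph.contDiffAt_symm (f₀' := L) (mem_univ _) hL' hG.contDiffAt
  refine ⟨⟨fun p => ε⁻¹ • h.symm p, fun x => G (ε • x), ?_, ?_, ?_, ?_⟩, fun x => rfl⟩
  · exact hinv.const_smul ε⁻¹
  · exact hG.comp (contDiff_const_smul ε)
  · intro p
    rw [smul_smul, mul_inv_cancel₀ hε.ne', one_smul, ← hh, h.apply_symm_apply]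
  · intro x
    rw [← hh, h.symm_apply_apply, smul_smul, inv_mul_cancel₀ hε.ne', one_smul]

end Spheres

/-! ### Mean curvature in a conformally flat metric -/

section MeanCurvature

theorem hasFDerivAt_smul_vec {E F : Type*} [NormedAddCommGroup E] [NormedSpace ℝ E]
    [NormedAddCommGroup F] [NormedSpace ℝ F] {f : E → ℝ} {f' : E →L[ℝ] ℝ} {x : E}
    (h : HasFDerivAt f f' x) (c : F) : HasFDerivAt (fun y => f y • c) (f'.smulRight c) x :=
  h.smul_const c

theorem contDiff_smul_vec {E F : Type*} [NormedAddCommGroup E] [NormedSpace ℝ E]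
    [NormedAddCommGroup F] [NormedSpace ℝ F] {f : E → ℝ} (h : ContDiff ℝ ∞ f) (c : F) :
    ContDiff ℝ ∞ (fun y => f y • c) :=
  h.smul contDiff_const

theorem norm_iteratedFDeriv_smul_vec_le {E F : Type*} [NormedAddCommGroup E] [NormedSpace ℝ E]
    [NormedAddCommGroup F] [NormedSpace ℝ F] {f : E → ℝ} (h : ContDiff ℝ ∞ f) (c : F) {k : ℕ}
    {x : E} {B : ℝ} (hB : ‖iteratedFDeriv ℝ k f x‖ ≤ B) :
    ‖iteratedFDeriv ℝ k (fun y => f y • c) x‖ ≤ ‖c‖ * B := by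
  refine le_trans ?_ (mul_le_mul_of_nonneg_left hB (norm_nonneg c))
  have := (ContinuousLinearMap.toSpanSingleton ℝ c).norm_iteratedFDeriv_comp_left (f := f)
    (x := x) (N := ∞) (n := k) h.contDiffAt (by exact_mod_cast le_top)
  simpa [Function.comp_def] using this

/-- Applied to two tangent vectors and the unit normal, it expresses a sum over the tangent plane as
the full trace minus the normal contribution. -/
theorem trace_eq_of_orthonormal (T : E3 →L[ℝ] E3) {a b c : E3}
    (haa : inner ℝ a a = 1) (hbb : inner ℝ b b = 1) (hcc : inner ℝ c c = 1)
    (hab : inner ℝ a b = 0) (hac : inner ℝ a c = 0) (hbc : inner ℝ b c = 0) :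
    LinearMap.trace ℝ E3 T.toLinearMap =
      inner ℝ a (T a) + inner ℝ b (T b) + inner ℝ c (T c) := by
  have hon : Orthonormal ℝ ![a, b, c] := by
    rw [orthonormal_iff_ite]
    intro i j
    have hba := real_inner_comm a b
    have hca := real_inner_comm a c
    have hcb := real_inner_comm b c
    fin_cases i <;> fin_cases j <;> simp_all
  have hspan : ⊤ ≤ Submodule.span ℝ (Set.range ![a, b, c]) := by
    rw [hon.linearIndependent.span_eq_top_of_card_eq_finrank' (by simp)]
  rw [LinearMap.trace_eq_sum_inner _ (OrthonormalBasis.mk hon hspan)]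
  simp [Fin.sum_univ_three]

/-- The derivative of a conformally flat metric. -/
theorem fderiv_conformal {g : Metric3} {w : E3 → ℝ} {x : E3}
    (hg : ∀ᶠ y in 𝓝 x, g.toFun y = (w y ^ 2)⁻¹ • euclid) (hw : DifferentiableAt ℝ w x)
    (hwpos : 0 < w x) (u a b : E3) :
    fderiv ℝ g.toFun x u a b = -2 * (w x ^ 3)⁻¹ * fderiv ℝ w x u * inner ℝ a b := by
  have h1 : HasDerivAt (fun t : ℝ => (t ^ 2)⁻¹) (-2 * (w x ^ 3)⁻¹) (w x) := by
    refine ((hasDerivAt_pow 2 (w x)).inv (by positivity)).congr_deriv ?_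
    field_simp
    norm_num [mul_comm]
  have h2 : HasFDerivAt (fun y => (w y ^ 2)⁻¹ • euclid) _ x :=
    hasFDerivAt_smul_vec (h1.comp_hasFDerivAt x hw.hasFDerivAt) euclid
  have h3 : HasFDerivAt g.toFun _ x := h2.congr_of_eventuallyEq hg
  rw [h3.fderiv]
  simp [euclid_apply]

/-- Mean curvature with respect to a conformally flat metric `w⁻² δ`, in terms of a normal field
`v` that is the gradient of a defining function `ψ` along the surface. -/
theorem hasConstantMeanCurvature_of_conformal (S : EmbeddedSphere) (g : Metric3) (H : ℝ)
    (w ψ : E3 → ℝ) (v : E3 → E3)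
    (hg : ∀ p, ∀ᶠ x in 𝓝 (S.toFun p), g.toFun x = (w x ^ 2)⁻¹ • euclid)
    (hw : ∀ p, ContDiffAt ℝ ∞ w (S.toFun p)) (hwpos : ∀ p, 0 < w (S.toFun p))
    (hv : ∀ p, ContDiffAt ℝ ∞ v (S.toFun p)) (hv0 : ∀ p, v (S.toFun p) ≠ 0)
    (hψ : ∀ p, HasFDerivAt ψ (innerSL ℝ (v (S.toFun p))) (S.toFun p))
    (hψ0 : ∀ p, ψ (S.toFun p) = 0)
    (hout : ∀ p, ∀ᶠ x in 𝓝 (S.toFun p), 0 < ψ x → x ∉ S.enclosed)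
    (hH : ∀ p, w (S.toFun p) / ‖v (S.toFun p)‖ *
      (LinearMap.trace ℝ E3 (fderiv ℝ v (S.toFun p)).toLinearMap -
        inner ℝ (v (S.toFun p)) (fderiv ℝ v (S.toFun p) (v (S.toFun p))) / ‖v (S.toFun p)‖ ^ 2) -
      2 * fderiv ℝ w (S.toFun p) (v (S.toFun p)) / ‖v (S.toFun p)‖ = H) :
    S.HasConstantMeanCurvature g H := by
  -- For the metric `w⁻² δ` the unit normal is `w` times the Euclidean one.
  set n : E3 → E3 := fun x => (w x / ‖v x‖) • v x with hn
  have hφ : ∀ p, ContDiffAt ℝ ∞ (fun x => w x / ‖v x‖) (S.toFun p) := fun p =>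
    (hw p).div ((hv p).norm ℝ (hv0 p)) (norm_ne_zero_iff.2 (hv0 p))
  have hns : ∀ p, ContDiffAt ℝ ∞ n (S.toFun p) := fun p => (hφ p).smul (hv p)
  have htan : ∀ p X, inner ℝ (v (S.toFun p)) (S.diff p X) = 0 := by
    intro p X
    have := S.fderiv_diff_eq_zero (c := 0) (hψ p).differentiableAt (Eventually.of_forall hψ0) X
    rwa [(hψ p).fderiv] at this
  have hgx : ∀ p a b, g.toFun (S.toFun p) a b = (w (S.toFun p) ^ 2)⁻¹ * inner ℝ a b := by
    intro p a b
    rw [(hg p).self_of_nhds]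
    simp [euclid_apply]
  refine ⟨fun p => n (S.toFun p), ⟨?_, ?_, ?_, ?_⟩, ?_⟩
  · intro p
    exact (hns p).contMDiffAt.comp p (S.smooth p)
  · intro p
    have h1 := hwpos p
    have h2 := norm_pos_iff.2 (hv0 p)
    rw [hgx]
    simp only [hn, inner_smul_left, inner_smul_right, real_inner_self_eq_norm_sq]
    simp only [RCLike.conj_to_real]
    field_simp
  · intro p X
    rw [hgx]
    simp only [hn, inner_smul_left, htan p X, mul_zero]
  · intro p
    -- Along the normal `ψ` starts at zero with positive slope `w ‖v‖`, so it is positive just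
    -- outside the surface.
    have hline : HasDerivAt (fun t : ℝ => ψ (S.toFun p + t • n (S.toFun p)))
        (w (S.toFun p) * ‖v (S.toFun p)‖) 0 := by
      have h1 : HasDerivAt (fun t : ℝ => S.toFun p + t • n (S.toFun p)) (n (S.toFun p)) 0 := by
        simpa using ((hasDerivAt_id (0 : ℝ)).smul_const (n (S.toFun p))).const_add (S.toFun p)
      have h2 := (hψ p).comp_hasDerivAt_of_eq (0 : ℝ) h1 (by simp)
      refine h2.congr_deriv ?_
      have h2 := norm_pos_iff.2 (hv0 p)
      simp only [hn, innerSL_apply_apply, inner_smul_right, real_inner_self_eq_norm_sq]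
      field_simp
    have hpos : 0 < w (S.toFun p) * ‖v (S.toFun p)‖ :=
      mul_pos (hwpos p) (norm_pos_iff.2 (hv0 p))
    have hc : Tendsto (fun t : ℝ => S.toFun p + t • n (S.toFun p)) (𝓝[>] 0) (𝓝 (S.toFun p)) := by
      have : ContinuousAt (fun t : ℝ => S.toFun p + t • n (S.toFun p)) 0 := by fun_prop
      have h := this.tendsto
      simp only [zero_smul, add_zero] at h
      exact h.mono_left nhdsWithin_le_nhds
    have hsl := (hasDerivAt_iff_tendsto_slope.1 hline).mono_left
      (nhdsWithin_mono (0 : ℝ) fun t (ht : 0 < t) => ht.ne')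
    filter_upwards [hc.eventually (hout p), hsl.eventually (lt_mem_nhds hpos),
      self_mem_nhdsWithin] with t ht1 ht2 ht3
    have ht3' : 0 < t := ht3
    refine ht1 ?_
    rw [slope_def_field] at ht2
    simp only [zero_smul, add_zero, sub_zero, hψ0 p] at ht2
    exact (div_pos_iff_of_pos_right ht3').1 ht2
  · intro p X Y hX hY hXY
    set x := S.toFun p with hx
    set ξ := S.diff p X with hξ
    set η := S.diff p Y with hη
    have hwp := hwpos p
    have hvp := norm_pos_iff.2 (hv0 p)
    rw [← hx] at hwp hvp
    rw [hgx] at hX hY hXY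
    have hX' : inner ℝ ξ ξ = w x ^ 2 := by
      rw [← hx] at hX; field_simp at hX; exact hX
    have hY' : inner ℝ η η = w x ^ 2 := by
      rw [← hx] at hY; field_simp at hY; exact hY
    have hXY' : inner ℝ ξ η = 0 := by
      rw [← hx] at hXY
      exact (mul_eq_zero.1 hXY).resolve_left (by positivity)
    -- The derivative of `w / ‖v‖` multiplies `v` and is lost against the tangent vector. Of the
    -- three Christoffel terms two cancel, and the derivative of the metric along the normal gives
    -- the term `-Dw(v) / ‖v‖`.
    have hII : ∀ Z : TangentSpace (𝓡 2) p, inner ℝ (S.diff p Z) (S.diff p Z) = w x ^ 2 →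
        S.secondFundamentalForm g (fun p => n (S.toFun p)) p Z Z =
          (w x * ‖v x‖)⁻¹ * inner ℝ (S.diff p Z) (fderiv ℝ v x (S.diff p Z)) -
            fderiv ℝ w x (v x) / ‖v x‖ := by
      intro Z hZ
      have hm : (mfderiv (𝓡 2) 𝓘(ℝ, E3) (fun p => n (S.toFun p)) p Z : E3) =
          fderiv ℝ n x (S.diff p Z) := by
        have h1 := mfderiv_comp (I := 𝓡 2) (I' := 𝓘(ℝ, E3)) (I'' := 𝓘(ℝ, E3)) p
          (g := n) (f := S.toFun) ((hns p).differentiableAt (by simp)).mdifferentiableAt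
          (S.smooth.mdifferentiableAt (by simp))
        rw [mfderiv_eq_fderiv] at h1
        exact congrArg (fun L => L Z) h1
      have hnd : fderiv ℝ n x (S.diff p Z) = (w x / ‖v x‖) • fderiv ℝ v x (S.diff p Z) +
          (fderiv ℝ (fun x => w x / ‖v x‖) x (S.diff p Z)) • v x := by
        have := ((hφ p).differentiableAt (by simp)).hasFDerivAt.smul
          ((hv p).differentiableAt (by simp)).hasFDerivAt
        rw [show fderiv ℝ n x = _ from this.fderiv]
        simp [hx]
      have hdw := (hw p).differentiableAt (by simp)
      simp only [EmbeddedSphere.secondFundamentalForm, Metric3.christoffel]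
      rw [hm, hnd, hgx, fderiv_conformal (hg p) hdw (hwpos p), fderiv_conformal (hg p) hdw (hwpos p),
        fderiv_conformal (hg p) hdw (hwpos p)]
      have hZv := htan p Z
      have hZv' : inner ℝ (S.diff p Z) (v x) = 0 := by rw [real_inner_comm]; exact hZv
      rw [← hx] at hZv ⊢
      have hfw : fderiv ℝ w x (n x) = w x / ‖v x‖ * fderiv ℝ w x (v x) := by simp [hn]
      rw [hfw, hZ, inner_add_left, real_inner_smul_left, real_inner_smul_left, hZv,
        real_inner_comm (S.diff p Z) (n x)]
      simp only [hn, real_inner_smul_right, hZv']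
      rw [real_inner_comm (S.diff p Z) (fderiv ℝ v x (S.diff p Z))]
      field_simp
      ring
    rw [hII X hX', hII Y hY', ← hH p, ← hx]
    have htr := trace_eq_of_orthonormal (fderiv ℝ v x) (a := (w x)⁻¹ • ξ) (b := (w x)⁻¹ • η)
      (c := ‖v x‖⁻¹ • v x)
      (by rw [real_inner_smul_left, real_inner_smul_right, hX']; field_simp)
      (by rw [real_inner_smul_left, real_inner_smul_right, hY']; field_simp)
      (by rw [real_inner_smul_left, real_inner_smul_right, real_inner_self_eq_norm_sq]; field_simp)
      (by rw [real_inner_smul_left, real_inner_smul_right, hXY']; simp)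
      (by rw [real_inner_smul_left, real_inner_smul_right, real_inner_comm, htan p X]; simp)
      (by rw [real_inner_smul_left, real_inner_smul_right, real_inner_comm, htan p Y]; simp)
    rw [htr]
    simp only [map_smul, real_inner_smul_left, real_inner_smul_right]
    field_simp
    ring

end MeanCurvature

/-! ### The localized perturbation of the conformal factor -/

section Perturbation

theorem hasFDerivAt_norm_of_ne_zero {y : E3} (hy : y ≠ 0) :
    HasFDerivAt (fun y : E3 => ‖y‖) (‖y‖⁻¹ • innerSL ℝ y) y := by
  have h1 : HasFDerivAt (fun y : E3 => ‖y‖ ^ 2) (2 • innerSL ℝ y) y :=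
    (hasStrictFDerivAt_norm_sq y).hasFDerivAt
  have h2 := h1.sqrt (by simpa using hy)
  simp only [Real.sqrt_sq (norm_nonneg _)] at h2
  refine h2.congr_fderiv ?_
  have : ‖y‖ ≠ 0 := norm_ne_zero_iff.2 hy
  ext v
  simp
  field_simp

theorem hasFDerivAt_comp_norm {κ : ℝ → ℝ} {κ' : ℝ} {y : E3} (hy : y ≠ 0)
    (hκ : HasDerivAt κ κ' ‖y‖) :
    HasFDerivAt (fun y : E3 => κ ‖y‖) ((κ' / ‖y‖) • innerSL ℝ y) y := by
  refine (hκ.comp_hasFDerivAt y (hasFDerivAt_norm_of_ne_zero hy)).congr_fderiv ?_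
  rw [smul_smul, div_eq_mul_inv]

/-- A smooth cutoff function, equal to `1` on `[4/5, 7/2]` and supported in `[1/2, 4]`. -/
def radialCutoff (r : ℝ) : ℝ :=
  Real.smoothTransition ((r - 1 / 2) / (3 / 10)) * Real.smoothTransition ((4 - r) / (1 / 2))

/-- A smooth cutoff function, equal to `1` for `t ≥ 4/5` and vanishing for `t ≤ 0`. -/
def angularCutoff (t : ℝ) : ℝ := Real.smoothTransition (t / (4 / 5))

theorem contDiff_radialCutoff : ContDiff ℝ ∞ radialCutoff := by
  unfold radialCutoff
  exact (Real.smoothTransition.contDiff.comp (by fun_prop)).mul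
    (Real.smoothTransition.contDiff.comp (by fun_prop))

theorem contDiff_angularCutoff : ContDiff ℝ ∞ angularCutoff :=
  Real.smoothTransition.contDiff.comp (by fun_prop)

theorem radialCutoff_eq_one {r : ℝ} (h1 : 4 / 5 ≤ r) (h2 : r ≤ 7 / 2) : radialCutoff r = 1 := by
  rw [radialCutoff, Real.smoothTransition.one_of_one_le, Real.smoothTransition.one_of_one_le,
    one_mul]
  · rw [le_div_iff₀ (by norm_num)]; linarith
  · rw [le_div_iff₀ (by norm_num)]; linarith

theorem radialCutoff_eq_zero {r : ℝ} (h : r ≤ 1 / 2 ∨ 4 ≤ r) : radialCutoff r = 0 := by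
  rcases h with h | h
  · rw [radialCutoff, Real.smoothTransition.zero_of_nonpos, zero_mul]
    exact div_nonpos_of_nonpos_of_nonneg (by linarith) (by norm_num)
  · rw [radialCutoff, mul_comm, Real.smoothTransition.zero_of_nonpos, zero_mul]
    exact div_nonpos_of_nonpos_of_nonneg (by linarith) (by norm_num)

theorem angularCutoff_eq_one {t : ℝ} (h : 4 / 5 ≤ t) : angularCutoff t = 1 :=
  Real.smoothTransition.one_of_one_le (by rw [le_div_iff₀ (by norm_num)]; linarith)

theorem angularCutoff_eq_zero {t : ℝ} (h : t ≤ 0) : angularCutoff t = 0 :=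
  Real.smoothTransition.zero_of_nonpos (div_nonpos_of_nonpos_of_nonneg h (by norm_num))

theorem tsupport_radialCutoff_norm :
    tsupport (fun y : E3 => radialCutoff ‖y‖) ⊆ {y | 1 / 2 ≤ ‖y‖ ∧ ‖y‖ ≤ 4} := by
  refine closure_minimal ?_ ?_
  · intro y hy
    by_contra h
    refine hy (radialCutoff_eq_zero ?_)
    by_contra! h'
    exact h ⟨h'.1.le, h'.2.le⟩
  · exact (isClosed_le continuous_const continuous_norm).inter
      (isClosed_le continuous_norm continuous_const)

theorem contDiff_radialCutoff_norm : ContDiff ℝ ∞ fun y : E3 => radialCutoff ‖y‖ := by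
  rw [contDiff_iff_contDiffAt]
  intro y
  by_cases hy : y = 0
  · refine (contDiffAt_const (c := (0 : ℝ))).congr_of_eventuallyEq ?_
    have : ∀ᶠ y' in 𝓝 y, ‖y'‖ < 1 / 2 :=
      continuous_norm.continuousAt.eventually (gt_mem_nhds (by simp [hy]))
    filter_upwards [this] with y' hy'
    exact radialCutoff_eq_zero (Or.inl hy'.le)
  · exact contDiff_radialCutoff.contDiffAt.comp y (contDiffAt_norm ℝ hy)

/-- Coefficients of a perturbation of the conformal factor that makes the outlying sphere a
surface of constant mean curvature `centredCurv ε`. -/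
structure Correction where
  δ : ℝ
  pos : 0 < δ
  le_one : δ ≤ 1
  regular : ∀ ε ∈ Ioo (-δ) δ, ∀ r ∈ Icc (1 / 4 : ℝ) 5, Regular (ε, r)
  β : ℝ → ℝ
  γ : ℝ → ℝ
  m : ℝ × ℝ → ℝ
  contDiffOn_β : ContDiffOn ℝ ∞ β (Ioo (-δ) δ)
  contDiffOn_γ : ContDiffOn ℝ ∞ γ (Ioo (-δ) δ)
  contDiffOn_m : ContDiffOn ℝ ∞ m (Ioo (-δ) δ ×ˢ Ioo (1 / 4) 5)
  defect_add : ∀ ε ∈ Ioo (-δ) δ, ∀ r ∈ Ioo (1 / 4 : ℝ) 5,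
    defect ε r + ε ^ 2 * (β ε * effectHeight ε r + γ ε * effectGap ε r +
      2 * normalLen ε r * (r - 1) ^ 2 * m (ε, r)) = 0

theorem nonempty_correction : Nonempty Correction := by
  obtain ⟨δ, h1, h2, h3, β, γ, m, h4, h5, h6, h7⟩ := exists_correction
  exact ⟨⟨δ, h1, h2, h3, β, γ, m, h4, h5, h6, h7⟩⟩

namespace Correction

variable (K : Correction)

/-- The perturbation near the outlying sphere in the direction `c`. -/
def core (c : E3) (q : ℝ × E3) : ℝ :=
  K.β q.1 * inner ℝ c q.2 + K.γ q.1 * (‖q.2‖ - inner ℝ c q.2) +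
    (inner ℝ c q.2 - height q.1 ‖q.2‖) * ((‖q.2‖ - 1) ^ 2 * K.m (q.1, ‖q.2‖))

/-- The angular cutoff is constant along rays, so it does not disturb the homogeneity of the linear
part of `core`. It vanishes where `⟨c, y⟩ ≤ 0`, which keeps the copies for `c` and `-c` from
interacting. -/
def localized (c : E3) (q : ℝ × E3) : ℝ :=
  radialCutoff ‖q.2‖ * (angularCutoff (inner ℝ c q.2 / ‖q.2‖) * K.core c q)

/-- The direction of the axis of symmetry. -/
def axisDir : E3 := EuclideanSpace.single 0 1

theorem norm_axisDir : ‖axisDir‖ = 1 := by simp [axisDir]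

theorem inner_axisDir (y : E3) : inner ℝ axisDir y = y 0 := by
  simp [axisDir, EuclideanSpace.inner_single_left]

def perturbation (q : ℝ × E3) : ℝ := K.localized axisDir q + K.localized (-axisDir) q

variable {K}

theorem contDiffAt_core {c : E3} {q : ℝ × E3} (h1 : q.1 ∈ Ioo (-K.δ) K.δ)
    (h2 : ‖q.2‖ ∈ Ioo (1 / 4 : ℝ) 5) : ContDiffAt ℝ ∞ (K.core c) q := by
  have hq0 : q.2 ≠ 0 := by
    rw [← norm_pos_iff]; linarith [h2.1]
  have hn : ContDiffAt ℝ ∞ (fun q : ℝ × E3 => ‖q.2‖) q := contDiffAt_snd.norm ℝ hq0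
  have hp : ContDiffAt ℝ ∞ (fun q : ℝ × E3 => (q.1, ‖q.2‖)) q := contDiffAt_fst.prodMk hn
  have hreg := K.regular q.1 h1 ‖q.2‖ (Ioo_subset_Icc_self h2)
  have hβ := (K.contDiffOn_β.contDiffAt (isOpen_Ioo.mem_nhds h1)).comp q contDiffAt_fst
  have hγ := (K.contDiffOn_γ.contDiffAt (isOpen_Ioo.mem_nhds h1)).comp q contDiffAt_fst
  have hm := (K.contDiffOn_m.contDiffAt
    ((isOpen_Ioo.prod isOpen_Ioo).mem_nhds (mk_mem_prod h1 h2))).comp q hp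
  have hz := (contDiffAt_height (p := (q.1, ‖q.2‖)) hreg.pos hreg.dilation_pos).comp q hp
  have hi : ContDiffAt ℝ ∞ (fun q : ℝ × E3 => inner ℝ c q.2) q :=
    contDiffAt_const.inner ℝ contDiffAt_snd
  simp only [Function.comp_def] at hβ hγ hm hz
  unfold core
  exact ((hβ.mul hi).add (hγ.mul (hn.sub hi))).add
    ((hi.sub hz).mul (((hn.sub contDiffAt_const).pow 2).mul hm))

theorem contDiffAt_localized {c : E3} {q : ℝ × E3} (h1 : q.1 ∈ Ioo (-K.δ) K.δ) :
    ContDiffAt ℝ ∞ (K.localized c) q := by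
  by_cases h2 : ‖q.2‖ ∈ Ioo (1 / 4 : ℝ) 5
  · have hq0 : q.2 ≠ 0 := by
      rw [← norm_pos_iff]; linarith [h2.1]
    have hn : ContDiffAt ℝ ∞ (fun q : ℝ × E3 => ‖q.2‖) q := contDiffAt_snd.norm ℝ hq0
    have hi : ContDiffAt ℝ ∞ (fun q : ℝ × E3 => inner ℝ c q.2) q :=
      contDiffAt_const.inner ℝ contDiffAt_snd
    exact (contDiff_radialCutoff.contDiffAt.comp q hn).mul
      ((contDiff_angularCutoff.contDiffAt.comp q (hi.div hn (norm_ne_zero_iff.2 hq0))).mul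
        (contDiffAt_core h1 h2))
  · refine (contDiffAt_const (c := (0 : ℝ))).congr_of_eventuallyEq ?_
    have hc : ContinuousAt (fun q : ℝ × E3 => ‖q.2‖) q := by fun_prop
    have : ∀ᶠ q' in 𝓝 q, ‖(q' : ℝ × E3).2‖ ≤ 1 / 2 ∨ 4 ≤ ‖q'.2‖ := by
      rw [mem_Ioo, not_and_or, not_lt, not_lt] at h2
      rcases h2 with h2 | h2
      · filter_upwards [hc.eventually (gt_mem_nhds (by linarith : ‖q.2‖ < 1 / 2))] with q' h
          using Or.inl h.le
      · filter_upwards [hc.eventually (lt_mem_nhds (by linarith : 4 < ‖q.2‖))] with q' h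
          using Or.inr h.le
    filter_upwards [this] with q' h
    rw [localized, radialCutoff_eq_zero h, zero_mul]

theorem contDiffAt_perturbation {q : ℝ × E3} (h1 : q.1 ∈ Ioo (-K.δ) K.δ) :
    ContDiffAt ℝ ∞ K.perturbation q :=
  (contDiffAt_localized h1).add (contDiffAt_localized h1)

theorem perturbation_eq_zero {q : ℝ × E3} (h : ‖q.2‖ ≤ 1 / 2 ∨ 4 ≤ ‖q.2‖) :
    K.perturbation q = 0 := by
  simp [perturbation, localized, radialCutoff_eq_zero h]

theorem localized_eventuallyEq_core {c : E3} {ε : ℝ} {y : E3} (h1 : 4 / 5 < ‖y‖)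
    (h2 : ‖y‖ < 7 / 2) (h3 : 4 / 5 < inner ℝ c y / ‖y‖) :
    ∀ᶠ y' in 𝓝 y, K.localized c (ε, y') = K.core c (ε, y') ∧ K.localized (-c) (ε, y') = 0 := by
  have hn : ContinuousAt (fun y : E3 => ‖y‖) y := continuous_norm.continuousAt
  have hy : ‖y‖ ≠ 0 := by positivity
  have hi : ContinuousAt (fun y : E3 => inner ℝ c y / ‖y‖) y := by
    have : ContinuousAt (fun y : E3 => (inner ℝ c y : ℝ)) y := by fun_prop
    exact this.div hn hy
  filter_upwards [hn.eventually (lt_mem_nhds h1), hn.eventually (gt_mem_nhds h2),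
    hi.eventually (lt_mem_nhds h3)] with y' a b d
  constructor
  · rw [localized, radialCutoff_eq_one a.le b.le, angularCutoff_eq_one d.le, one_mul, one_mul]
  · rw [localized, angularCutoff_eq_zero, zero_mul, mul_zero]
    rw [inner_neg_left, neg_div]
    linarith

theorem perturbation_eventuallyEq_core {c : E3} (hc : c = axisDir ∨ c = -axisDir) {ε : ℝ} {y : E3}
    (h1 : 4 / 5 < ‖y‖) (h2 : ‖y‖ < 7 / 2) (h3 : 4 / 5 < inner ℝ c y / ‖y‖) :
    ∀ᶠ y' in 𝓝 y, K.perturbation (ε, y') = K.core c (ε, y') := by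
  filter_upwards [localized_eventuallyEq_core (K := K) (ε := ε) h1 h2 h3] with y' h
  rcases hc with rfl | rfl
  · rw [perturbation, h.1, h.2, add_zero]
  · rw [neg_neg] at h
    rw [perturbation, h.1, h.2, zero_add]

/-- The perturbation does not affect the centred unit sphere. -/
theorem fderiv_localized_self (c : E3) {ε : ℝ} (hε : ε ∈ Ioo (-K.δ) K.δ) {y : E3} (hy : ‖y‖ = 1) :
    fderiv ℝ (fun y => K.localized c (ε, y)) y y = K.localized c (ε, y) := by
  have hd : HasFDerivAt (fun y => K.localized c (ε, y)) _ y :=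
    (((contDiffAt_localized (K := K) (c := c) (q := (ε, y)) hε).comp y
      (contDiffAt_const.prodMk contDiffAt_id)).differentiableAt (by simp)).hasFDerivAt
  have hline : HasDerivAt (fun t : ℝ => t • y) y 1 := by
    simpa using (hasDerivAt_id (1 : ℝ)).smul_const y
  have h1 := hd.comp_hasDerivAt_of_eq (1 : ℝ) hline (by simp)
  set a : ℝ := inner ℝ c y
  have hm : DifferentiableAt ℝ (fun t : ℝ => (t * a - height ε t) * K.m (ε, t)) 1 := by
    have hreg := K.regular ε hε 1 (by norm_num)
    have hp : ContDiffAt ℝ ∞ (fun t : ℝ => (ε, t)) 1 := contDiffAt_const.prodMk contDiffAt_id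
    have hm := ((K.contDiffOn_m.contDiffAt ((isOpen_Ioo.prod isOpen_Ioo).mem_nhds
      (mk_mem_prod hε (by norm_num : (1 : ℝ) ∈ Ioo (1 / 4 : ℝ) 5)))).comp (1 : ℝ)
      hp).differentiableAt (by simp)
    have hz := (hasDerivAt_height (ε := ε) one_pos hreg.dilation_pos.ne').differentiableAt
    simp only [Function.comp_def] at hm
    fun_prop
  -- Along the ray the function is `t` times a constant plus `(t - 1)²` times a differentiable
  -- function; at `t = 1` both its value and its derivative are that constant.
  have h2 := ((hasDerivAt_id (1 : ℝ)).mul_const (angularCutoff a * (K.β ε * a + K.γ ε * (1 - a)))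
    ).add (((((hasDerivAt_id (1 : ℝ)).sub_const 1).pow 2).mul hm.hasDerivAt).const_mul
      (angularCutoff a))
  have h3 := h2.congr_of_eventuallyEq (f₁ := fun t : ℝ => K.localized c (ε, t • y)) (by
    filter_upwards [lt_mem_nhds (by norm_num : (4 / 5 : ℝ) < 1),
      gt_mem_nhds (by norm_num : (1 : ℝ) < 7 / 2)] with t ht1 ht2
    have ht0 : 0 < t := by linarith
    have hnt : ‖t • y‖ = t := by rw [norm_smul, hy, mul_one, Real.norm_of_nonneg ht0.le]
    simp only [localized, core, hnt, radialCutoff_eq_one ht1.le ht2.le, real_inner_smul_right]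
    rw [show t * inner ℝ c y / t = a by field_simp; rfl]
    simp only [id, Pi.add_apply, Pi.mul_apply, Pi.pow_apply]
    change _ = t * (angularCutoff a * (K.β ε * a + K.γ ε * (1 - a))) + _
    rw [show (inner ℝ c y : ℝ) = a from rfl]
    ring)
  have h4 := h1.unique h3
  refine h4.trans ?_
  simp only [localized, core, hy, radialCutoff_eq_one (by norm_num : (4 / 5 : ℝ) ≤ 1)
    (by norm_num : (1 : ℝ) ≤ 7 / 2), div_one]
  rw [show (inner ℝ c y : ℝ) = a from rfl]
  simp

theorem fderiv_perturbation_self {ε : ℝ} (hε : ε ∈ Ioo (-K.δ) K.δ) {y : E3} (hy : ‖y‖ = 1) :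
    fderiv ℝ (fun y => K.perturbation (ε, y)) y y = K.perturbation (ε, y) := by
  have hd : ∀ c, DifferentiableAt ℝ (fun y => K.localized c (ε, y)) y := fun c =>
    ((contDiffAt_localized (K := K) (c := c) (q := (ε, y)) hε).comp y
      (contDiffAt_const.prodMk contDiffAt_id)).differentiableAt (by simp)
  have := ((hd axisDir).hasFDerivAt.add (hd (-axisDir)).hasFDerivAt).fderiv
  rw [show fderiv ℝ (fun y => K.perturbation (ε, y)) y = _ from this]
  rw [add_apply, fderiv_localized_self _ hε hy, fderiv_localized_self _ hε hy,
    perturbation]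

theorem norm_rot (θ : ℝ) (x : E3) : ‖rot θ x‖ = ‖x‖ := by
  rw [EuclideanSpace.norm_eq, EuclideanSpace.norm_eq]
  congr 1
  simp only [Fin.sum_univ_three, rot, Real.norm_eq_abs, sq_abs]
  simp
  linear_combination (x 1 ^ 2 + x 2 ^ 2) * (Real.sin_sq_add_cos_sq θ)

theorem inner_axisDir_rot (θ : ℝ) (x : E3) : inner ℝ axisDir (rot θ x) = inner ℝ axisDir x := by
  simp [inner_axisDir, rot]

theorem perturbation_rot (θ ε : ℝ) (y : E3) :
    K.perturbation (ε, rot θ y) = K.perturbation (ε, y) := by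
  simp only [perturbation, localized, core, inner_neg_left, norm_rot, inner_axisDir_rot]

end Correction

end Perturbation

/-! ### From the conformal factor to the metric, and superposition of scales -/

section Factor

namespace Correction

variable (K : Correction)

/-- The rescaled conformal factor: the metric is `conformal⁻² δ`. -/
def conformal (q : ℝ × E3) : ℝ := schw q.1 ‖q.2‖ + q.1 ^ 2 * K.perturbation q

/-- The term `t` for which the perturbed conformal factor is `(1 + t)` times the rescaled
Schwarzschild factor. -/
def ratio (q : ℝ × E3) : ℝ := q.1 ^ 2 * K.perturbation q * (1 + q.1 / (2 * ‖q.2‖)) ^ 2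

/-- With `φ = 1 + ε / (2|y|)` and `t` the ratio, the metric factor is `φ⁴ (1 + t)⁻²`, which differs
from `φ⁴` by `-φ⁴ t (2 + t) / (1 + t)²`. The profile is this difference with the factor `ε²` of `t`
removed. -/
def rawProfile (q : ℝ × E3) : ℝ :=
  -((1 + q.1 / (2 * ‖q.2‖)) ^ 6 * K.perturbation q * (2 + K.ratio q)) / (1 + K.ratio q) ^ 2

/-- Keeps `1 + ratio` away from zero. The perturbation is bounded, and where it is nonzero `|y| >
1/2`, so the Schwarzschild term is at most 2. The range `2 δ₁` leaves room for a cutoff in `ε`. -/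
theorem exists_bound_ratio : ∃ δ₁ > 0, 2 * δ₁ ≤ K.δ / 2 ∧ ∀ q : ℝ × E3, |q.1| < 2 * δ₁ →
    |K.ratio q| ≤ 1 / 2 := by
  have hcont : ContinuousOn K.perturbation (Icc (-(K.δ / 2)) (K.δ / 2) ×ˢ closedBall (0 : E3) 4) :=
    fun q hq => (contDiffAt_perturbation (K := K) (q := q)
      ⟨by linarith [hq.1.1, K.pos], by linarith [hq.1.2, K.pos]⟩).continuousAt.continuousWithinAt
  obtain ⟨C, hC⟩ := (isCompact_Icc.prod (isCompact_closedBall (0 : E3) 4)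
    ).exists_bound_of_continuousOn hcont
  have hpos := K.pos
  have hone := K.le_one
  set B := 1 + |C| with hB
  have hBpos : 0 < B := by positivity
  refine ⟨min (K.δ / 4) (1 / (16 * B)), by positivity, ?_, fun q hq => ?_⟩
  · linarith [min_le_left (K.δ / 4) (1 / (16 * B))]
  have h1 : |q.1| < K.δ / 2 := by linarith [min_le_left (K.δ / 4) (1 / (16 * B))]
  have h2 : |q.1| * (8 * B) ≤ 1 := by
    have : |q.1| ≤ 1 / (8 * B) := by
      have := min_le_right (K.δ / 4) (1 / (16 * B))
      have e : 2 * (1 / (16 * B)) = 1 / (8 * B) := by field_simp; norm_num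
      linarith
    rwa [le_div_iff₀ (by positivity)] at this
  by_cases hr : ‖q.2‖ ≤ 1 / 2 ∨ 4 ≤ ‖q.2‖
  · simp [ratio, perturbation_eq_zero hr]
  · push Not at hr
    have hp : |K.perturbation q| ≤ B := by
      have := hC q ⟨⟨by linarith [(abs_lt.1 h1).1], by linarith [(abs_lt.1 h1).2]⟩,
        by simpa using hr.2.le⟩
      rw [Real.norm_eq_abs] at this
      exact this.trans (by linarith [le_abs_self C])
    have hφ : |1 + q.1 / (2 * ‖q.2‖)| ≤ 2 := by
      have : |q.1 / (2 * ‖q.2‖)| ≤ 1 := by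
        rw [abs_div, abs_of_pos (by linarith : 0 < 2 * ‖q.2‖), div_le_one (by linarith)]
        linarith
      calc _ ≤ |(1 : ℝ)| + |q.1 / (2 * ‖q.2‖)| := abs_add_le _ _
        _ ≤ 2 := by rw [abs_one]; linarith
    have hq1 : |q.1| ≤ 1 := by linarith
    have hq2 : |q.1| ^ 2 ≤ |q.1| := by nlinarith [abs_nonneg q.1]
    calc |K.ratio q| = |q.1| ^ 2 * |K.perturbation q| * |1 + q.1 / (2 * ‖q.2‖)| ^ 2 := by
          rw [ratio, abs_mul, abs_mul, abs_pow, abs_pow]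
      _ ≤ |q.1| * B * 2 ^ 2 := by gcongr
      _ ≤ 1 / 2 := by linarith

theorem contDiffAt_rawProfile {q : ℝ × E3} (h1 : q.1 ∈ Ioo (-K.δ) K.δ) (h2 : |K.ratio q| ≤ 1 / 2) :
    ContDiffAt ℝ ∞ K.rawProfile q := by
  by_cases hr : 1 / 4 < ‖q.2‖
  · have hq0 : q.2 ≠ 0 := by rw [← norm_pos_iff]; linarith
    have hn : ContDiffAt ℝ ∞ (fun q : ℝ × E3 => ‖q.2‖) q := contDiffAt_snd.norm ℝ hq0
    have hφ : ContDiffAt ℝ ∞ (fun q : ℝ × E3 => 1 + q.1 / (2 * ‖q.2‖)) q :=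
      contDiffAt_const.add (contDiffAt_fst.div (contDiffAt_const.mul hn) (by simpa using hq0))
    have hf := contDiffAt_perturbation (K := K) h1
    have ht : ContDiffAt ℝ ∞ K.ratio q := ((contDiffAt_fst.pow 2).mul hf).mul (hφ.pow 2)
    have hne : (1 + K.ratio q) ^ 2 ≠ 0 := by
      have := (abs_le.1 h2).1
      have : 0 < 1 + K.ratio q := by linarith
      positivity
    exact (((hφ.pow 6).mul hf).mul (contDiffAt_const.add ht)).neg.div
      ((contDiffAt_const.add ht).pow 2) hne
  · refine (contDiffAt_const (c := (0 : ℝ))).congr_of_eventuallyEq ?_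
    have hc : ContinuousAt (fun q : ℝ × E3 => ‖q.2‖) q := by fun_prop
    filter_upwards [hc.eventually (gt_mem_nhds (by linarith : ‖q.2‖ < 1 / 2))] with q' h
    simp [rawProfile, perturbation_eq_zero (K := K) (Or.inl h.le : ‖q'.2‖ ≤ 1 / 2 ∨ 4 ≤ ‖q'.2‖)]

/-- The smooth, compactly supported profile of the perturbation of the metric. -/
theorem exists_profile : ∃ δ₁ > 0, δ₁ < K.δ ∧ ∃ P : ℝ × E3 → ℝ, ContDiff ℝ ∞ P ∧
    HasCompactSupport P ∧ (∀ q, ‖q.2‖ ≤ 1 / 2 ∨ 4 ≤ ‖q.2‖ → P q = 0) ∧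
    (∀ θ ε y, P (ε, rot θ y) = P (ε, y)) ∧
    ∀ ε, 0 < ε → ε ≤ δ₁ → ∀ y : E3, y ≠ 0 → 0 < K.conformal (ε, y) ∧
      (1 + ε / (2 * ‖y‖)) ^ 4 + ε ^ 2 * P (ε, y) = (K.conformal (ε, y) ^ 2)⁻¹ := by
  obtain ⟨δ₁, hδ₁, hδK, hratio⟩ := K.exists_bound_ratio
  have hKpos := K.pos
  -- Cutting off in `ε` as well makes the profile smooth with compact support in both variables
  -- together, so its derivatives are bounded uniformly in `ε`.
  let ξ : ContDiffBump (0 : ℝ) := ⟨δ₁, 3 / 2 * δ₁, hδ₁, by linarith⟩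
  have hξ0 : ∀ ε, 3 / 2 * δ₁ ≤ |ε| → ξ ε = 0 := fun ε h =>
    ξ.zero_of_le_dist (by simpa [Real.dist_eq] using h)
  have hU : IsOpen {q : ℝ × E3 | |q.1| < 2 * δ₁} :=
    isOpen_lt (by fun_prop) continuous_const
  have hts : tsupport (fun q : ℝ × E3 => ξ q.1) ⊆ {q : ℝ × E3 | |q.1| < 2 * δ₁} := by
    have : tsupport (fun q : ℝ × E3 => ξ q.1) ⊆ {q : ℝ × E3 | |q.1| ≤ 3 / 2 * δ₁} := by
      refine closure_minimal ?_ (isClosed_le (by fun_prop) continuous_const)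
      intro q hq
      by_contra h
      exact hq (hξ0 _ (not_le.1 h).le)
    refine this.trans fun q hq => ?_
    have hq' : |q.1| ≤ 3 / 2 * δ₁ := hq
    exact lt_of_le_of_lt hq' (by linarith)
  refine ⟨δ₁, hδ₁, by linarith, fun q => ξ q.1 • K.rawProfile q, ?_, ?_, ?_, ?_, ?_⟩
  · refine contDiff_smul_of_tsupport_subset hU (ξ.contDiff.comp contDiff_fst) (fun q hq => ?_) hts
    have hq' : |q.1| < 2 * δ₁ := hq
    exact (K.contDiffAt_rawProfile (by
      rw [mem_Ioo, ← abs_lt]; linarith) (hratio q hq')).contDiffWithinAt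
  · refine HasCompactSupport.of_support_subset_isCompact
      ((isCompact_Icc (a := -(3 / 2 * δ₁)) (b := 3 / 2 * δ₁)).prod
        (isCompact_closedBall (0 : E3) 4)) ?_
    intro q hq
    by_contra h
    refine hq ?_
    rw [mem_prod, not_and_or] at h
    rcases h with h | h
    · have : 3 / 2 * δ₁ ≤ |q.1| := by
        by_contra hlt
        have := abs_lt.1 (not_le.1 hlt)
        exact h ⟨this.1.le, this.2.le⟩
      simp [hξ0 _ this]
    · have : 4 ≤ ‖q.2‖ := by
        rw [mem_closedBall_zero_iff, not_le] at h
        exact h.le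
      simp [rawProfile, perturbation_eq_zero (K := K) (Or.inr this : ‖q.2‖ ≤ 1 / 2 ∨ 4 ≤ ‖q.2‖)]
  · intro q hq
    simp [rawProfile, perturbation_eq_zero (K := K) hq]
  · intro θ ε y
    simp only [rawProfile, ratio, norm_rot, perturbation_rot]
  · intro ε hε hle y hy
    have hξ : ξ ε = 1 := ξ.one_of_mem_closedBall (by
      rw [mem_closedBall, Real.dist_eq, sub_zero, abs_of_pos hε]; exact hle)
    have ht := (abs_le.1 (hratio (ε, y) (by simp only [abs_of_pos hε]; linarith))).1
    have hn : 0 < ‖y‖ := norm_pos_iff.2 hy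
    have hφ : 0 < 1 + ε / (2 * ‖y‖) := by positivity
    have hconf : K.conformal (ε, y) = (1 + K.ratio (ε, y)) * ((1 + ε / (2 * ‖y‖)) ^ 2)⁻¹ := by
      simp only [conformal, ratio, schw]
      generalize K.perturbation (ε, y) = f
      field_simp
    have h1t : 0 < 1 + K.ratio (ε, y) := by linarith
    refine ⟨by rw [hconf]; positivity, ?_⟩
    rw [hconf]
    simp only [hξ, one_smul, rawProfile]
    have hr : K.ratio (ε, y) = ε ^ 2 * K.perturbation (ε, y) * (1 + ε / (2 * ‖y‖)) ^ 2 := rfl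
    have e1 : ε ^ 2 * (-((1 + ε / (2 * ‖y‖)) ^ 6 * K.perturbation (ε, y) *
        (2 + K.ratio (ε, y))) / (1 + K.ratio (ε, y)) ^ 2) =
        -((1 + ε / (2 * ‖y‖)) ^ 4 * K.ratio (ε, y) * (2 + K.ratio (ε, y))) /
          (1 + K.ratio (ε, y)) ^ 2 := by
      rw [mul_div_assoc']
      congr 1
      rw [show (1 + ε / (2 * ‖y‖)) ^ 4 * K.ratio (ε, y) * (2 + K.ratio (ε, y)) =
        (1 + ε / (2 * ‖y‖)) ^ 4 * (ε ^ 2 * K.perturbation (ε, y) * (1 + ε / (2 * ‖y‖)) ^ 2) *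
          (2 + K.ratio (ε, y)) by rw [← hr]]
      ring
    rw [e1]
    generalize K.ratio (ε, y) = t at *
    generalize 1 + ε / (2 * ‖y‖) = φ at *
    field_simp
    ring

end Correction

/-- Each differentiation in `x` brings out one factor `ε`. -/
theorem norm_iteratedFDeriv_rescale_le {P : ℝ × E3 → ℝ} (hP : ContDiff ℝ ∞ P) {C : ℝ} {k : ℕ}
    (hC : ∀ q, ‖iteratedFDeriv ℝ k P q‖ ≤ C) {ε : ℝ} (hε : 0 < ε) (x : E3) :
    ‖iteratedFDeriv ℝ k (fun x => ε ^ 2 * P (ε, ε • x)) x‖ ≤ C * ε ^ (2 + k) := by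
  set L : E3 →L[ℝ] ℝ × E3 :=
    (ContinuousLinearMap.inr ℝ ℝ E3).comp (ε • ContinuousLinearMap.id ℝ E3) with hL
  have hLn : ‖L‖ ≤ ε := by
    refine ContinuousLinearMap.opNorm_le_bound _ hε.le fun v => ?_
    simp [hL, Prod.norm_def, norm_smul, abs_of_pos hε]
    positivity
  set P' : ℝ × E3 → ℝ := fun q => P ((ε, 0) + q) with hP'
  have hP's : ContDiff ℝ ∞ P' := hP.comp (contDiff_const.add contDiff_id)
  have heq : (fun x => ε ^ 2 * P (ε, ε • x)) = ε ^ 2 • (P' ∘ L) := by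
    funext x
    simp [hL, hP']
  have hk : ((k : ℕ) : WithTop ℕ∞) ≤ ∞ := by exact_mod_cast le_top
  have hcomp : ContDiff ℝ ∞ (P' ∘ L) := hP's.comp L.contDiff
  rw [heq, iteratedFDeriv_const_smul_apply (hcomp.of_le hk).contDiffAt,
    L.iteratedFDeriv_comp_right hP's x hk, norm_smul, hP', iteratedFDeriv_comp_add_left]
  have hb := ContinuousMultilinearMap.norm_compContinuousLinearMap_le
    (iteratedFDeriv ℝ k P ((ε, 0) + L x)) (fun _ => L)
  have hC0 : 0 ≤ C := (norm_nonneg _).trans (hC 0)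
  simp only [Finset.prod_const, Finset.card_univ, Fintype.card_fin] at hb
  calc _ ≤ ε ^ 2 * (C * ε ^ k) := by
        rw [Real.norm_of_nonneg (by positivity)]
        refine mul_le_mul_of_nonneg_left (hb.trans ?_) (by positivity)
        exact mul_le_mul (hC _) (pow_le_pow_left₀ (norm_nonneg _) hLn k) (by positivity) hC0
    _ = C * ε ^ (2 + k) := by ring

/-- The scales at which the metric is perturbed. -/
def scale (δ : ℝ) (n : ℕ) : ℝ := δ * (1 / 64) ^ n

theorem scale_pos {δ : ℝ} (hδ : 0 < δ) (n : ℕ) : 0 < scale δ n := by unfold scale; positivity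

theorem scale_le {δ : ℝ} (hδ : 0 < δ) (n : ℕ) : scale δ n ≤ δ :=
  mul_le_of_le_one_right hδ.le (pow_le_one₀ (by norm_num) (by norm_num))

theorem mul_scale_le {δ : ℝ} (hδ : 0 < δ) {m n : ℕ} (h : m < n) :
    64 * scale δ n ≤ scale δ m := by
  have : ((1 : ℝ) / 64) ^ n ≤ (1 / 64) ^ (m + 1) :=
    pow_le_pow_of_le_one (by norm_num) (by norm_num) h
  rw [pow_succ] at this
  unfold scale
  nlinarith

/-- Only one of the perturbations is active at each point. -/
theorem scale_index_unique {δ : ℝ} (hδ : 0 < δ) {R : ℝ} {m n : ℕ}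
    (hm : 1 / 2 ≤ scale δ m * R ∧ scale δ m * R ≤ 4)
    (hn : 1 / 2 ≤ scale δ n * R ∧ scale δ n * R ≤ 4) : m = n := by
  have hR : 0 < R := by
    by_contra h
    nlinarith [scale_pos hδ m]
  rcases lt_trichotomy m n with h | h | h
  · nlinarith [mul_scale_le hδ h]
  · exact h
  · nlinarith [mul_scale_le hδ h]

/-- The superposition of the perturbations at all scales. -/
def series (P : ℝ × E3 → ℝ) (δ : ℝ) (x : E3) : ℝ :=
  ∑' n, scale δ n ^ 2 * P (scale δ n, scale δ n • x)

section Series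

variable {P : ℝ × E3 → ℝ} {δ : ℝ}

theorem contDiff_series_term (hP : ContDiff ℝ ∞ P) (n : ℕ) :
    ContDiff ℝ ∞ fun x : E3 => scale δ n ^ 2 * P (scale δ n, scale δ n • x) :=
  contDiff_const.mul (hP.comp (contDiff_const.prodMk (contDiff_const_smul _)))

theorem exists_bound_iteratedFDeriv (hP : ContDiff ℝ ∞ P) (hc : HasCompactSupport P) (k : ℕ) :
    ∃ C, ∀ q, ‖iteratedFDeriv ℝ k P q‖ ≤ C :=
  (hc.iteratedFDeriv (𝕜 := ℝ) k).exists_bound_of_continuous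
    (hP.continuous_iteratedFDeriv (by exact_mod_cast le_top))

theorem series_eq (h0 : ∀ q : ℝ × E3, ‖q.2‖ ≤ 1 / 2 ∨ 4 ≤ ‖q.2‖ → P q = 0) (hδ : 0 < δ) {n : ℕ}
    {x : E3} (h : 1 / 2 ≤ scale δ n * ‖x‖ ∧ scale δ n * ‖x‖ ≤ 4) :
    series P δ x = scale δ n ^ 2 * P (scale δ n, scale δ n • x) := by
  refine tsum_eq_single n fun m hm => ?_
  rw [h0, mul_zero]
  by_contra! h'
  simp only [norm_smul, Real.norm_of_nonneg (scale_pos hδ m).le] at h'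
  exact hm (scale_index_unique hδ ⟨h'.1.le, h'.2.le⟩ h)

/-- Geometric decay of the scales permits termwise differentiation. At a given `x` at most one term
is active, and then `ε ≤ 4 / ‖x‖` turns the bound `C ε²⁺ᵏ` into the required decay. -/
theorem series_props (hP : ContDiff ℝ ∞ P) (hc : HasCompactSupport P)
    (h0 : ∀ q : ℝ × E3, ‖q.2‖ ≤ 1 / 2 ∨ 4 ≤ ‖q.2‖ → P q = 0) (hδ : 0 < δ) (hδ1 : δ ≤ 1) :
    ContDiff ℝ ∞ (series P δ) ∧ ∀ k : ℕ, ∃ C : ℝ, ∀ x : E3, x ≠ 0 →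
      ‖iteratedFDeriv ℝ k (series P δ) x‖ ≤ C / ‖x‖ ^ (2 + k) := by
  choose C hC using exists_bound_iteratedFDeriv hP hc
  have hC0 : ∀ k, 0 ≤ C k := fun k => (norm_nonneg _).trans (hC k 0)
  have hterm : ∀ k n (x : E3), ‖iteratedFDeriv ℝ k
      (fun x : E3 => scale δ n ^ 2 * P (scale δ n, scale δ n • x)) x‖ ≤
      C k * scale δ n ^ (2 + k) := fun k n x =>
    norm_iteratedFDeriv_rescale_le hP (hC k) (scale_pos hδ n) x
  have hbound : ∀ (k n : ℕ) (x : E3), ((k : ℕ∞) ≤ (⊤ : ℕ∞)) → ‖iteratedFDeriv ℝ k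
      (fun x : E3 => scale δ n ^ 2 * P (scale δ n, scale δ n • x)) x‖ ≤
      C k * (δ * (1 / 64) ^ n) := by
    intro k n x _
    refine (hterm k n x).trans (mul_le_mul_of_nonneg_left ?_ (hC0 k))
    calc scale δ n ^ (2 + k) ≤ scale δ n ^ 1 :=
          pow_le_pow_of_le_one (scale_pos hδ n).le ((scale_le hδ n).trans hδ1) (by omega)
      _ = δ * (1 / 64) ^ n := pow_one _
  have hsum : ∀ k : ℕ, ((k : ℕ∞) ≤ (⊤ : ℕ∞)) → Summable fun n : ℕ => C k * (δ * (1 / 64 : ℝ) ^ n) :=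
    fun k _ => ((summable_geometric_of_lt_one (by norm_num) (by norm_num)).mul_left δ).mul_left _
  refine ⟨contDiff_tsum (N := (⊤ : ℕ∞)) (fun n => contDiff_series_term hP n) hsum hbound, ?_⟩
  intro k
  refine ⟨C k * 4 ^ (2 + k), fun x hx => ?_⟩
  have hxn : 0 < ‖x‖ := norm_pos_iff.2 hx
  have hit : iteratedFDeriv ℝ k (series P δ) x = ∑' n, iteratedFDeriv ℝ k
      (fun x : E3 => scale δ n ^ 2 * P (scale δ n, scale δ n • x)) x :=
    iteratedFDeriv_tsum_apply (N := (⊤ : ℕ∞)) (fun n => contDiff_series_term hP n) hsum hbound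
      le_top x
  have hsupp : ∀ n, ¬ (1 / 2 ≤ scale δ n * ‖x‖ ∧ scale δ n * ‖x‖ ≤ 4) → iteratedFDeriv ℝ k
      (fun x : E3 => scale δ n ^ 2 * P (scale δ n, scale δ n • x)) x = 0 := by
    intro n hn
    by_contra hne
    have hmem := support_iteratedFDeriv_subset (𝕜 := ℝ) k (Function.mem_support.2 hne)
    have hcl : tsupport (fun x : E3 => scale δ n ^ 2 * P (scale δ n, scale δ n • x)) ⊆
        {x | 1 / 2 ≤ scale δ n * ‖x‖ ∧ scale δ n * ‖x‖ ≤ 4} := by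
      have hcont : Continuous fun x : E3 => scale δ n * ‖x‖ := by fun_prop
      refine closure_minimal ?_ ((isClosed_le continuous_const hcont).inter
        (isClosed_le hcont continuous_const))
      intro y hy
      by_contra h
      refine hy ?_
      dsimp only
      rw [h0, mul_zero]
      by_contra! h'
      simp only [norm_smul, Real.norm_of_nonneg (scale_pos hδ n).le] at h'
      exact h ⟨h'.1.le, h'.2.le⟩
    exact hn (hcl hmem)
  by_cases hex : ∃ n, 1 / 2 ≤ scale δ n * ‖x‖ ∧ scale δ n * ‖x‖ ≤ 4
  · obtain ⟨n, hn⟩ := hex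
    rw [hit, tsum_eq_single n fun m hm => hsupp m fun h => hm (scale_index_unique hδ h hn)]
    refine (hterm k n x).trans ?_
    rw [mul_div_assoc, ← div_pow]
    refine mul_le_mul_of_nonneg_left (pow_le_pow_left₀ (scale_pos hδ n).le ?_ _) (hC0 k)
    rw [le_div_iff₀ hxn]
    exact hn.2
  · push Not at hex
    have : ∀ n, iteratedFDeriv ℝ k
      (fun x : E3 => scale δ n ^ 2 * P (scale δ n, scale δ n • x)) x = 0 := fun n =>
      hsupp n fun h => absurd (hex n h.1) (not_lt.2 h.2)
    rw [hit]
    simp only [this, tsum_zero, norm_zero]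
    have := hC0 k
    positivity

theorem abs_series_le (h0 : ∀ q : ℝ × E3, ‖q.2‖ ≤ 1 / 2 ∨ 4 ≤ ‖q.2‖ → P q = 0) {C : ℝ}
    (hC : ∀ q, |P q| ≤ C) (hδ : 0 < δ) (x : E3) : |series P δ x| ≤ δ ^ 2 * C := by
  have hC0 : 0 ≤ C := (abs_nonneg _).trans (hC 0)
  by_cases hex : ∃ n, 1 / 2 ≤ scale δ n * ‖x‖ ∧ scale δ n * ‖x‖ ≤ 4
  · obtain ⟨n, hn⟩ := hex
    rw [series_eq h0 hδ hn, abs_mul, abs_of_nonneg (sq_nonneg _)]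
    exact mul_le_mul (pow_le_pow_left₀ (scale_pos hδ n).le (scale_le hδ n) 2) (hC _)
      (abs_nonneg _) (by positivity)
  · have : ∀ n, scale δ n ^ 2 * P (scale δ n, scale δ n • x) = 0 := by
      intro n
      rw [h0, mul_zero]
      by_contra! h'
      simp only [norm_smul, Real.norm_of_nonneg (scale_pos hδ n).le] at h'
      exact hex ⟨n, h'.1.le, h'.2.le⟩
    simp only [series, this, tsum_zero, abs_zero]
    positivity

end Series

end Factor

/-! ### The metric: completeness and asymptotics -/

section Metric

/-- The conformally flat metric `F δ`. -/
def conformalMetric (F : E3 → ℝ) (hF : ContDiff ℝ ∞ F) (hpos : ∀ x, 0 < F x) : Metric3 where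
  toFun x := F x • euclid
  smooth := contDiff_smul_vec hF euclid
  symm x u v := by
    change F x * inner ℝ u v = F x * inner ℝ v u
    rw [real_inner_comm]
  pos x u hu := by
    change 0 < F x * inner ℝ u u
    rw [real_inner_self_eq_norm_sq]
    have := hpos x
    have := norm_pos_iff.2 hu
    positivity

theorem conformalMetric_apply {F : E3 → ℝ} (hF : ContDiff ℝ ∞ F) (hpos : ∀ x, 0 < F x)
    (x u v : E3) : (conformalMetric F hF hpos).toFun x u v = F x * inner ℝ u v := rfl

section Completeness

variable {F : E3 → ℝ} {hF : ContDiff ℝ ∞ F} {hpos : ∀ x, 0 < F x} {a b : ℝ}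

theorem curveLength_conformalMetric (γ : ℝ → E3) :
    (conformalMetric F hF hpos).curveLength γ = ∫ t in (0 : ℝ)..1, √(F (γ t)) * ‖deriv γ t‖ := by
  unfold Metric3.curveLength
  congr 1
  funext t
  rw [conformalMetric_apply, real_inner_self_eq_norm_sq, Real.sqrt_mul (hpos _).le,
    Real.sqrt_sq (norm_nonneg _)]

theorem curveLength_nonneg (γ : ℝ → E3) : 0 ≤ (conformalMetric F hF hpos).curveLength γ := by
  rw [curveLength_conformalMetric]
  exact intervalIntegral.integral_nonneg zero_le_one fun t _ => by positivity

theorem le_curveLength (ha : ∀ x, a ≤ F x) {γ : ℝ → E3} (hγ : ContDiff ℝ 1 γ) :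
    √a * ‖γ 1 - γ 0‖ ≤ (conformalMetric F hF hpos).curveLength γ := by
  have hd : Continuous (deriv γ) := hγ.continuous_deriv (by simp)
  have hc : Continuous fun t => √(F (γ t)) * ‖deriv γ t‖ :=
    ((Real.continuous_sqrt.comp (hF.continuous.comp hγ.continuous))).mul hd.norm
  have h1 : ∫ t in (0 : ℝ)..1, deriv γ t = γ 1 - γ 0 :=
    intervalIntegral.integral_deriv_eq_sub (fun t _ => hγ.differentiable one_ne_zero t)
      (hd.intervalIntegrable _ _)
  rw [curveLength_conformalMetric, ← h1]
  calc √a * ‖∫ t in (0 : ℝ)..1, deriv γ t‖ ≤ √a * ∫ t in (0 : ℝ)..1, ‖deriv γ t‖ := by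
        gcongr
        exact intervalIntegral.norm_integral_le_integral_norm zero_le_one
    _ = ∫ t in (0 : ℝ)..1, √a * ‖deriv γ t‖ := (intervalIntegral.integral_const_mul _ _).symm
    _ ≤ _ := by
        refine intervalIntegral.integral_mono_on zero_le_one
          ((continuous_const.mul hd.norm).intervalIntegrable _ _) (hc.intervalIntegrable _ _) ?_
        intro t _
        have := ha (γ t)
        gcongr

theorem gdist_nonneg (x y : E3) : 0 ≤ (conformalMetric F hF hpos).gdist x y := by
  refine Real.sInf_nonneg ?_
  rintro _ ⟨γ, -, -, -, rfl⟩
  exact curveLength_nonneg γ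

theorem hasDerivAt_segment (x y : E3) (t : ℝ) :
    HasDerivAt (fun t : ℝ => x + t • (y - x)) (y - x) t := by
  simpa using ((hasDerivAt_id t).smul_const (y - x)).const_add x

theorem gdist_le (hb : ∀ x, F x ≤ b) (x y : E3) :
    (conformalMetric F hF hpos).gdist x y ≤ √b * ‖y - x‖ := by
  have hs : ContDiff ℝ 1 fun t : ℝ => x + t • (y - x) := by fun_prop
  have hle : (conformalMetric F hF hpos).gdist x y ≤
      (conformalMetric F hF hpos).curveLength fun t : ℝ => x + t • (y - x) := by
    refine csInf_le ⟨0, ?_⟩ ⟨_, hs, by simp, by simp, rfl⟩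
    rintro _ ⟨γ, -, -, -, rfl⟩
    exact curveLength_nonneg γ
  refine hle.trans ?_
  rw [curveLength_conformalMetric]
  have hc : Continuous fun t : ℝ => √(F (x + t • (y - x))) * ‖y - x‖ :=
    ((Real.continuous_sqrt.comp (hF.continuous.comp hs.continuous))).mul continuous_const
  simp only [(hasDerivAt_segment x y _).deriv]
  calc _ ≤ ∫ _ in (0 : ℝ)..1, √b * ‖y - x‖ := by
        refine intervalIntegral.integral_mono_on zero_le_one (hc.intervalIntegrable _ _)
          intervalIntegrable_const ?_
        intro t _
        have := hb (x + t • (y - x))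
        gcongr
    _ = _ := by simp

theorem le_gdist (ha : ∀ x, a ≤ F x) (x y : E3) :
    √a * ‖y - x‖ ≤ (conformalMetric F hF hpos).gdist x y := by
  refine le_csInf ⟨_, fun t : ℝ => x + t • (y - x), by fun_prop, by simp, by simp, rfl⟩ ?_
  rintro _ ⟨γ, hγ, rfl, rfl, rfl⟩
  exact le_curveLength ha hγ

/-- A conformally flat metric with bounded conformal factor is complete. -/
theorem complete_conformalMetric (ha0 : 0 < a) (ha : ∀ x, a ≤ F x) (hb : ∀ x, F x ≤ b) :
    (conformalMetric F hF hpos).Complete := by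
  intro u hu
  have hsa : 0 < √a := Real.sqrt_pos.2 ha0
  -- Bounds on the factor make the Riemannian distance comparable to the Euclidean one, so
  -- completeness is inherited.
  have hcau : CauchySeq u := by
    rw [Metric.cauchySeq_iff]
    intro ε hε
    obtain ⟨N, hN⟩ := hu (√a * ε) (by positivity)
    refine ⟨N, fun m hm n hn => ?_⟩
    have := (le_gdist (hF := hF) (hpos := hpos) ha (u m) (u n)).trans_lt (hN m hm n hn)
    rw [dist_comm, dist_eq_norm]
    exact lt_of_mul_lt_mul_left this hsa.le
  obtain ⟨x, hx⟩ := cauchySeq_tendsto_of_complete hcau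
  refine ⟨x, ?_⟩
  have h0 : Tendsto (fun n => √b * ‖x - u n‖) atTop (𝓝 0) := by
    have : Tendsto (fun n => x - u n) atTop (𝓝 (x - x)) := tendsto_const_nhds.sub hx
    simpa using (this.norm.const_mul (√b))
  exact squeeze_zero (fun n => gdist_nonneg _ _) (fun n => gdist_le hb _ _) h0

end Completeness

/-- The conformal factor of the Schwarzschild metric, filled in near the origin. -/
def baseFactor (x : E3) : ℝ := (1 + Real.smoothTransition (4 * ‖x‖ ^ 2 - 1) / (2 * ‖x‖)) ^ 4

theorem contDiff_baseFactor : ContDiff ℝ ∞ baseFactor := by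
  rw [contDiff_iff_contDiffAt]
  intro x
  by_cases hx : x = 0
  · refine (contDiffAt_const (c := (1 : ℝ))).congr_of_eventuallyEq ?_
    have : ∀ᶠ y in 𝓝 x, ‖y‖ < 1 / 2 :=
      continuous_norm.continuousAt.eventually (gt_mem_nhds (by simp [hx]))
    filter_upwards [this] with y hy
    rw [baseFactor, Real.smoothTransition.zero_of_nonpos (by nlinarith [norm_nonneg y])]
    simp
  · have hn : ContDiffAt ℝ ∞ (fun x : E3 => ‖x‖) x := contDiffAt_norm ℝ hx
    exact (contDiffAt_const.add ((Real.smoothTransition.contDiff.contDiffAt.comp x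
      ((contDiffAt_const.mul (hn.pow 2)).sub contDiffAt_const)).div
      (contDiffAt_const.mul hn) (by simpa using hx))).pow 4

theorem one_le_baseFactor (x : E3) : 1 ≤ baseFactor x := by
  refine one_le_pow₀ ?_
  have := Real.smoothTransition.nonneg (4 * ‖x‖ ^ 2 - 1)
  have : 0 ≤ Real.smoothTransition (4 * ‖x‖ ^ 2 - 1) / (2 * ‖x‖) := by positivity
  linarith

theorem baseFactor_le (x : E3) : baseFactor x ≤ 16 := by
  have h0 := Real.smoothTransition.nonneg (4 * ‖x‖ ^ 2 - 1)
  have h1 := Real.smoothTransition.le_one (4 * ‖x‖ ^ 2 - 1)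
  have : Real.smoothTransition (4 * ‖x‖ ^ 2 - 1) / (2 * ‖x‖) ≤ 1 := by
    by_cases hx : ‖x‖ ≤ 1 / 2
    · rw [Real.smoothTransition.zero_of_nonpos (by nlinarith [norm_nonneg x])]
      simp
    · rw [div_le_one (by linarith)]
      linarith
  calc baseFactor x ≤ 2 ^ 4 := by
        refine pow_le_pow_left₀ (by positivity) (by linarith) 4
    _ = 16 := by norm_num

theorem baseFactor_eq {x : E3} (hx : 1 ≤ ‖x‖) : baseFactor x = (1 + 1 / (2 * ‖x‖)) ^ 4 := by
  rw [baseFactor, Real.smoothTransition.one_of_one_le (by nlinarith)]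

theorem inner_rot (θ : ℝ) (u v : E3) : inner ℝ (rot θ u) (rot θ v) = inner ℝ u v := by
  simp only [PiLp.inner_apply, Fin.sum_univ_three, rot]
  simp
  linear_combination (u 1 * v 1 + u 2 * v 2) * Real.sin_sq_add_cos_sq θ

/-- A metric with a superposition of small perturbations of the Schwarzschild factor. -/
theorem exists_metric {P : ℝ × E3 → ℝ} (hP : ContDiff ℝ ∞ P) (hc : HasCompactSupport P)
    (h0 : ∀ q : ℝ × E3, ‖q.2‖ ≤ 1 / 2 ∨ 4 ≤ ‖q.2‖ → P q = 0)
    (hrot : ∀ θ ε y, P (ε, rot θ y) = P (ε, y)) {C δ : ℝ} (hC : ∀ q, |P q| ≤ C)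
    (hδ : 0 < δ) (hδ1 : δ ≤ 1) (hδC : δ ^ 2 * C ≤ 1 / 2) :
    ∃ g : Metric3, IsAsymptoticallySchwarzschild 1 g ∧ g.IsAxisymmetric ∧
      ∀ x, g.toFun x = (baseFactor x + series P δ x) • euclid := by
  obtain ⟨hs, hd⟩ := series_props hP hc h0 hδ hδ1
  have habs := fun x => (abs_series_le h0 hC hδ x).trans hδC
  have hlow : ∀ x, 1 / 2 ≤ baseFactor x + series P δ x := fun x => by
    linarith [one_le_baseFactor x, (abs_le.1 (habs x)).1]
  have hupp : ∀ x, baseFactor x + series P δ x ≤ 17 := fun x => by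
    linarith [baseFactor_le x, (abs_le.1 (habs x)).2]
  refine ⟨conformalMetric (fun x => baseFactor x + series P δ x) (contDiff_baseFactor.add hs)
    (fun x => by linarith [hlow x]), ⟨?_, ?_⟩, ?_, fun x => rfl⟩
  · exact complete_conformalMetric (by norm_num) hlow hupp
  · intro k
    obtain ⟨D, hD⟩ := hd k
    refine ⟨‖euclid‖ * D, fun x hx => ?_⟩
    -- For `|x| > 1` the filled-in factor is exactly Schwarzschild, so only the series remains.
    have heq : (fun y => (conformalMetric (fun x => baseFactor x + series P δ x)
        (contDiff_baseFactor.add hs) (fun x => by linarith [hlow x])).toFun y - schwarzschild 1 y)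
        =ᶠ[𝓝 x] fun y => series P δ y • euclid := by
      filter_upwards [continuous_norm.continuousAt.eventually (lt_mem_nhds hx)] with y hy
      ext u v
      change (baseFactor y + series P δ y) * inner ℝ u v - (1 + 1 / (2 * ‖y‖)) ^ 4 * inner ℝ u v =
        series P δ y * inner ℝ u v
      rw [baseFactor_eq (le_of_lt hy)]
      ring
    rw [(Filter.EventuallyEq.iteratedFDeriv ℝ heq k).self_of_nhds, mul_div_assoc]
    have hx0 : x ≠ 0 := by rw [← norm_pos_iff]; linarith
    exact norm_iteratedFDeriv_smul_vec_le hs euclid (hD x hx0)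
  · intro θ x u v
    have hser : series P δ (rot θ x) = series P δ x := by
      unfold series
      congr 1
      funext n
      have : scale δ n • rot θ x = rot θ (scale δ n • x) := by
        ext i; fin_cases i <;> simp [rot] <;> ring
      rw [this, hrot]
    change (baseFactor (rot θ x) + series P δ (rot θ x)) * inner ℝ (rot θ u) (rot θ v) =
      (baseFactor x + series P δ x) * inner ℝ u v
    rw [inner_rot, hser, baseFactor, baseFactor, Correction.norm_rot]

end Metric

/-! ### Curvature of the centred and outlying spheres -/

section Surfaces

open Correction

/-- The rescaled form of the mean curvature formula. -/
theorem hasConstantMeanCurvature_of_rescaled (S : EmbeddedSphere) (g : Metric3) (H : ℝ) {ε : ℝ}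
    (hε : 0 < ε) (w ψ : E3 → ℝ) (v : E3 → E3)
    (hg : ∀ p, ∀ᶠ x in 𝓝 (S.toFun p), g.toFun x = (w (ε • x) ^ 2)⁻¹ • euclid)
    (hw : ∀ p, ContDiffAt ℝ ∞ w (ε • S.toFun p)) (hwpos : ∀ p, 0 < w (ε • S.toFun p))
    (hv : ∀ p, ContDiffAt ℝ ∞ v (ε • S.toFun p)) (hv0 : ∀ p, v (ε • S.toFun p) ≠ 0)
    (hψ : ∀ p, HasFDerivAt ψ (innerSL ℝ (v (ε • S.toFun p))) (ε • S.toFun p))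
    (hψ0 : ∀ p, ψ (ε • S.toFun p) = 0)
    (hout : ∀ p, ∀ᶠ x in 𝓝 (S.toFun p), 0 < ψ (ε • x) → x ∉ S.enclosed)
    (hH : ∀ p, w (ε • S.toFun p) / ‖v (ε • S.toFun p)‖ *
      (LinearMap.trace ℝ E3 (fderiv ℝ v (ε • S.toFun p)).toLinearMap -
        inner ℝ (v (ε • S.toFun p)) (fderiv ℝ v (ε • S.toFun p) (v (ε • S.toFun p))) /
          ‖v (ε • S.toFun p)‖ ^ 2) -
      2 * fderiv ℝ w (ε • S.toFun p) (v (ε • S.toFun p)) / ‖v (ε • S.toFun p)‖ = H) :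
    S.HasConstantMeanCurvature g (ε * H) := by
  have hsm : ∀ x : E3, ContDiffAt ℝ ∞ (fun x : E3 => ε • x) x := fun x =>
    (contDiff_const_smul ε).contDiffAt
  refine hasConstantMeanCurvature_of_conformal S g (ε * H) (fun x => w (ε • x))
    (fun x => ε⁻¹ * ψ (ε • x)) (fun x => v (ε • x)) hg (fun p => (hw p).comp _ (hsm _)) hwpos
    (fun p => (hv p).comp _ (hsm _)) hv0 ?_ (fun p => by simp [hψ0 p]) ?_ ?_
  · intro p
    have h1 : HasFDerivAt (fun x : E3 => ε • x) (ε • ContinuousLinearMap.id ℝ E3) (S.toFun p) :=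
      (hasFDerivAt_id _).const_smul ε
    refine (((hψ p).comp _ h1).const_mul ε⁻¹).congr_fderiv ?_
    ext u
    simp [hε.ne']
  · intro p
    filter_upwards [hout p] with x hx h
    exact hx (by
      have : ε * (ε⁻¹ * ψ (ε • x)) = ψ (ε • x) := by field_simp
      rw [← this]
      exact mul_pos hε h)
  · intro p
    rw [fderiv_comp_smul, fderiv_comp_smul, ← hH p]
    have : LinearMap.trace ℝ E3 (ε • fderiv ℝ v (ε • S.toFun p)).toLinearMap =
        ε * LinearMap.trace ℝ E3 (fderiv ℝ v (ε • S.toFun p)).toLinearMap := by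
      rw [ContinuousLinearMap.toLinearMap_smul, map_smul, smul_eq_mul]
    rw [this]
    simp only [smul_apply, real_inner_smul_right, smul_eq_mul]
    ring

theorem hasDerivAt_schw {ε r : ℝ} (hr : 0 < r) (hw : 0 < 1 + ε / (2 * r)) :
    HasDerivAt (schw ε) (schwDeriv ε r) r := by
  have h1 : HasDerivAt (fun r : ℝ => 1 + ε / (2 * r)) (-(ε / (2 * r ^ 2))) r := by
    have := ((((hasDerivAt_id r).const_mul 2).inv (by simpa using hr.ne')).const_mul ε).const_add 1
    simp only [Pi.inv_apply, id, ← div_eq_mul_inv] at this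
    refine this.congr_deriv ?_
    field_simp
  refine ((h1.pow 2).inv (by simpa using hw.ne')).congr_deriv ?_
  simp only [schwDeriv, Pi.pow_apply]
  generalize 1 + ε / (2 * r) = φ at *
  field_simp
  norm_num
  ring

section Centred

/-- The dilation by `ε⁻¹`. -/
def scaling {ε : ℝ} (hε : 0 < ε) : Diffeo where
  toFun x := ε⁻¹ • x
  invFun x := ε • x
  contDiff := contDiff_const_smul _
  contDiff_inv := contDiff_const_smul _
  left_inv x := by rw [smul_smul, mul_inv_cancel₀ hε.ne', one_smul]
  right_inv x := by rw [smul_smul, inv_mul_cancel₀ hε.ne', one_smul]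

theorem contDiffAt_conformal {K : Correction} {ε : ℝ} (hε : ε ∈ Ioo (-K.δ) K.δ) {y : E3}
    (hy : y ≠ 0) (hφ : 0 < 1 + ε / (2 * ‖y‖)) :
    ContDiffAt ℝ ∞ (fun y => K.conformal (ε, y)) y := by
  have h1 := (contDiffAt_schw (p := (ε, ‖y‖)) (norm_ne_zero_iff.2 hy) hφ).comp y
    (contDiffAt_const.prodMk (contDiffAt_norm ℝ hy))
  have h2 := (contDiffAt_perturbation (K := K) (q := (ε, y)) hε).comp y
    (contDiffAt_const.prodMk contDiffAt_id)
  exact h1.add ((contDiffAt_const (c := ε ^ 2)).mul h2)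

theorem hasFDerivAt_conformal {K : Correction} {ε : ℝ} (hε : ε ∈ Ioo (-K.δ) K.δ) {y : E3}
    (hy : y ≠ 0) (hφ : 0 < 1 + ε / (2 * ‖y‖)) :
    HasFDerivAt (fun y => K.conformal (ε, y)) ((schwDeriv ε ‖y‖ / ‖y‖) • innerSL ℝ y +
      ε ^ 2 • fderiv ℝ (fun y => K.perturbation (ε, y)) y) y := by
  have h1 := hasFDerivAt_comp_norm hy (hasDerivAt_schw (norm_pos_iff.2 hy) hφ)
  have h2 := ((contDiffAt_perturbation (K := K) (q := (ε, y)) hε).comp y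
    (contDiffAt_const.prodMk contDiffAt_id)).differentiableAt (by simp)
  exact h1.add (h2.hasFDerivAt.const_mul (ε ^ 2))

theorem centred_hasConstantMeanCurvature {K : Correction} {g : Metric3} {ε : ℝ} (hε : 0 < ε)
    (hεK : ε < K.δ) (hpos : ∀ y : E3, y ≠ 0 → 0 < K.conformal (ε, y))
    (hg : ∀ x : E3, 1 / 2 < ‖ε • x‖ → ‖ε • x‖ < 4 →
      g.toFun x = (K.conformal (ε, ε • x) ^ 2)⁻¹ • euclid) :
    (scaling hε).sphere.HasConstantMeanCurvature g (ε * centredCurv ε) := by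
  have hεm : ε ∈ Ioo (-K.δ) K.δ := ⟨by linarith, hεK⟩
  have hn : ∀ p, ‖ε • (scaling hε).sphere.toFun p‖ = 1 := fun p =>
    (scaling hε).mem_carrier.1 ⟨p, rfl⟩
  have hy0 : ∀ p, ε • (scaling hε).sphere.toFun p ≠ 0 := fun p => by
    rw [← norm_pos_iff, hn]; exact one_pos
  have hφ : ∀ p, 0 < 1 + ε / (2 * ‖ε • (scaling hε).sphere.toFun p‖) := fun p => by
    rw [hn]; positivity
  have hcs : ∀ x : E3, ContinuousAt (fun x : E3 => ‖ε • x‖) x := fun x => by fun_prop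
  refine hasConstantMeanCurvature_of_rescaled _ g _ hε (fun y => K.conformal (ε, y))
    (fun y => (‖y‖ ^ 2 - 1) / 2) (fun y => y) ?_ (fun p => contDiffAt_conformal hεm (hy0 p) (hφ p))
    (fun p => hpos _ (hy0 p)) (fun p => contDiffAt_id) hy0 ?_ (fun p => by simp [hn p]) ?_ ?_
  · intro p
    have h1 : 1 / 2 < ‖ε • (scaling hε).sphere.toFun p‖ := by rw [hn p]; norm_num
    have h2 : ‖ε • (scaling hε).sphere.toFun p‖ < 4 := by rw [hn p]; norm_num
    filter_upwards [(hcs _).eventually (lt_mem_nhds h1), (hcs _).eventually (gt_mem_nhds h2)]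
      with x h1 h2
      using hg x h1 h2
  · intro p
    have h1 : HasFDerivAt (fun y : E3 => ‖y‖ ^ 2) _ (ε • (scaling hε).sphere.toFun p) :=
      (hasStrictFDerivAt_norm_sq _).hasFDerivAt
    have h2 := (h1.sub_const 1).const_mul (1 / 2)
    have h3 : HasFDerivAt (fun y : E3 => (‖y‖ ^ 2 - 1) / 2) _ (ε • (scaling hε).sphere.toFun p) :=
      h2.congr_of_eventuallyEq (Eventually.of_forall fun y => by ring)
    refine h3.congr_fderiv ?_
    ext u
    simp
  · intro p
    refine Eventually.of_forall fun x hx h => ?_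
    have h' : ‖ε • x‖ < 1 := (scaling hε).mem_enclosed.1 h
    nlinarith [norm_nonneg (ε • x)]
  · intro p
    set y := ε • (scaling hε).sphere.toFun p with hy
    have hyn : ‖y‖ = 1 := hn p
    have htr : LinearMap.trace ℝ E3 (fderiv ℝ (fun y : E3 => y) y).toLinearMap = 3 := by
      rw [fderiv_fun_id]
      simp
    rw [htr, fderiv_fun_id, (hasFDerivAt_conformal hεm (hy0 p) (hφ p)).fderiv]
    -- The perturbation equals its radial derivative here, so it drops out of `2 w - 2 ∂ᵣ w`.
    have hpert := fderiv_perturbation_self (K := K) hεm hyn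
    rw [← hy]
    simp only [add_apply, smul_apply, hpert,
      innerSL_apply_apply, ContinuousLinearMap.id_apply, real_inner_self_eq_norm_sq, hyn,
      smul_eq_mul, conformal, centredCurv]
    ring

end Centred

section Outlying

/-- The deviation of the outlying sphere from a round one, cut off to an annulus. -/
def cutZeta (y : E3) : ℝ := radialCutoff ‖y‖ * zeta ‖y‖

theorem contDiff_cutZeta_smul {G : Type*} [NormedAddCommGroup G] [NormedSpace ℝ G] {T : E3 → G}
    (hT : ContDiff ℝ ∞ T) : ContDiff ℝ ∞ fun y => cutZeta y • T y := by
  have hU : IsOpen {y : E3 | 0 < ‖y‖} := isOpen_lt continuous_const continuous_norm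
  have := contDiff_smul_of_tsupport_subset hU contDiff_radialCutoff_norm
    (T := fun y => zeta ‖y‖ • T y) (fun y hy => ?_)
    (tsupport_radialCutoff_norm.trans fun y hy => by
      have := hy.1
      exact lt_of_lt_of_le (by norm_num) this)
  · simp only [smul_smul] at this
    exact this
  · have hy' : 0 < ‖y‖ := hy
    exact (((contDiffAt_zeta hy').comp y (contDiffAt_norm ℝ (norm_pos_iff.1 hy'))).smul
      hT.contDiffAt).contDiffWithinAt

theorem cutZeta_eq_zero {y : E3} (h : 4 ≤ ‖y‖) : cutZeta y = 0 := by
  rw [cutZeta, radialCutoff_eq_zero (Or.inr h), zero_mul]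

theorem hasCompactSupport_cutZeta_smul {G : Type*} [NormedAddCommGroup G] [NormedSpace ℝ G]
    (T : E3 → G) : HasCompactSupport fun y => cutZeta y • T y := by
  refine HasCompactSupport.of_support_subset_isCompact (isCompact_closedBall (0 : E3) 4) ?_
  intro y hy
  by_contra h
  rw [mem_closedBall_zero_iff, not_le] at h
  exact hy (by simp [cutZeta_eq_zero h.le])

/-- The diffeomorphisms defining the outlying spheres. -/
theorem exists_outlying_diffeo (c : E3) : ∃ δ > 0, ∀ ε, 0 < ε → ε ≤ δ →
    (∀ y, |2 * ε * cutZeta y| ≤ 1 / 20) ∧ ∃ Φ : Diffeo, ∀ x, Φ.invFun x =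
      (1 + 2 * ε * cutZeta (ε • x)) • (ε • x - (2 : ℝ) • c) := by
  have hs := contDiff_cutZeta_smul (T := fun y : E3 => y - (2 : ℝ) • c) (by fun_prop)
  obtain ⟨L, hL⟩ := hs.lipschitzWith_of_hasCompactSupport
    (hasCompactSupport_cutZeta_smul fun y : E3 => y - (2 : ℝ) • c) (by simp)
  obtain ⟨M, hM⟩ := (hasCompactSupport_cutZeta_smul fun _ : E3 => (1 : ℝ)
    ).exists_bound_of_continuous (contDiff_cutZeta_smul contDiff_const).continuous
  have hM0 : 0 ≤ M := (norm_nonneg _).trans (hM 0)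
  -- Then both `2 ε M` and the Lipschitz constant `2 ε L` are at most `1/20`.
  refine ⟨1 / (40 * (M + L + 1)), by positivity, fun ε hε hle => ?_⟩
  have h40 : ε * (40 * (M + L + 1)) ≤ 1 := by
    rwa [le_div_iff₀ (by positivity)] at hle
  have hL0 : (0 : ℝ) ≤ L := L.2
  refine ⟨fun y => ?_, ?_⟩
  · have := hM y
    simp only [smul_eq_mul, mul_one, Real.norm_eq_abs] at this
    rw [abs_mul, abs_of_pos (by positivity : 0 < 2 * ε)]
    nlinarith
  · have hlip : LipschitzWith (Real.toNNReal (2 * ε) * L)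
        fun y => (2 * ε) • (cutZeta y • (y - (2 : ℝ) • c)) := by
      refine LipschitzWith.of_dist_le_mul fun x y => ?_
      rw [dist_smul₀, NNReal.coe_mul, Real.coe_toNNReal _ (by positivity), mul_assoc,
        Real.norm_of_nonneg (by positivity)]
      exact mul_le_mul_of_nonneg_left (hL.dist_le_mul x y) (by positivity)
    obtain ⟨Φ, hΦ⟩ := exists_diffeo (hs.const_smul (2 * ε)) (by
      rw [← NNReal.coe_lt_coe, NNReal.coe_mul, Real.coe_toNNReal _ (by positivity), NNReal.coe_one]
      nlinarith) hlip ((2 : ℝ) • c) hε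
    refine ⟨Φ, fun x => ?_⟩
    rw [hΦ, add_smul, one_smul, smul_smul]

/-- The normal field of the outlying sphere `{⟪c, y⟫ = height ε ‖y‖}`. -/
def outlyingNormal (ε : ℝ) (c y : E3) : E3 := (heightDeriv ε ‖y‖ / ‖y‖) • y - c

variable {ε : ℝ} {c y : E3}

theorem norm_sub_two_smul_sq (hc : ‖c‖ = 1) (y : E3) :
    ‖y - (2 : ℝ) • c‖ ^ 2 = ‖y‖ ^ 2 - 4 * inner ℝ c y + 4 := by
  rw [norm_sub_sq_real, real_inner_smul_right, norm_smul, hc, real_inner_comm]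
  norm_num
  ring

theorem dilation_eq (h1 : 4 / 5 ≤ ‖y‖) (h2 : ‖y‖ ≤ 7 / 2) :
    1 + 2 * ε * cutZeta y = dilation ε ‖y‖ := by
  rw [cutZeta, radialCutoff_eq_one h1 h2, one_mul, dilation]

/-- The position of the outlying sphere. -/
structure OnOutlying (ε : ℝ) (c y : E3) : Prop where
  lower : 4 / 5 < ‖y‖
  upper : ‖y‖ < 7 / 2
  angle : 4 / 5 < inner ℝ c y / ‖y‖
  inner_eq : inner ℝ c y = height ε ‖y‖

/-- The distance `ρ` from `y` to `2c` is at most `20/19`, so `18/19 ≤ ‖y‖ ≤ 58/19`. The surface thus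
stays where the cutoffs are 1 and its equation is the uncut one. -/
theorem onOutlying_of_norm_eq_one (hc : ‖c‖ = 1) (hb : |2 * ε * cutZeta y| ≤ 1 / 20)
    (h : ‖(1 + 2 * ε * cutZeta y) • (y - (2 : ℝ) • c)‖ = 1) : OnOutlying ε c y := by
  obtain ⟨hb1, hb2⟩ := abs_le.1 hb
  rw [norm_smul, Real.norm_of_nonneg (by linarith)] at h
  have hsq := norm_sub_two_smul_sq hc y
  set D := 1 + 2 * ε * cutZeta y with hD
  set ρ := ‖y - (2 : ℝ) • c‖ with hρ
  have hρ0 : 0 ≤ ρ := norm_nonneg _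
  have hρ1 : ρ ≤ 20 / 19 := by nlinarith
  have h2c : ‖(2 : ℝ) • c‖ = 2 := by rw [norm_smul, hc]; norm_num
  have hlow : 2 - ρ ≤ ‖y‖ := by
    have := norm_sub_norm_le ((2 : ℝ) • c) y
    rw [h2c, norm_sub_rev] at this
    linarith
  have hup : ‖y‖ ≤ 2 + ρ := by
    have := norm_sub_norm_le y ((2 : ℝ) • c)
    rw [h2c] at this
    linarith
  have hl : 4 / 5 < ‖y‖ := by linarith
  have hu : ‖y‖ < 7 / 2 := by linarith
  refine ⟨hl, hu, ?_, ?_⟩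
  · rw [lt_div_iff₀ (by linarith)]
    -- With `r = ‖y‖` and `z = ⟨c, y⟩`, `4z - 16r/5 = (r - 8/5)² + 36/25 - ρ²`, and `ρ² ≤ 400/361 <
    -- 36/25`.
    nlinarith [sq_nonneg (‖y‖ - 8 / 5)]
  · rw [height, ← dilation_eq hl.le hu.le, ← hD]
    have hDpos : 0 < D := by linarith
    have : (D ^ 2)⁻¹ = ρ ^ 2 := by
      rw [inv_eq_iff_eq_inv, ← inv_pow]
      congr 1
      exact eq_inv_of_mul_eq_one_left h
    rw [this]
    linarith

/-- Fixes the sign of the normal: the defining function `height - ⟨c, y⟩` is positive only outside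
the sphere. -/
theorem one_lt_norm_of_inner_lt (hc : ‖c‖ = 1) (h1 : 4 / 5 ≤ ‖y‖) (h2 : ‖y‖ ≤ 7 / 2)
    (hD : 0 < dilation ε ‖y‖) (h : inner ℝ c y < height ε ‖y‖) :
    1 < ‖(1 + 2 * ε * cutZeta y) • (y - (2 : ℝ) • c)‖ := by
  rw [dilation_eq h1 h2, norm_smul, Real.norm_of_nonneg hD.le]
  have hsq := norm_sub_two_smul_sq hc y
  rw [height] at h
  have h3 : (dilation ε ‖y‖ ^ 2)⁻¹ < ‖y - (2 : ℝ) • c‖ ^ 2 := by linarith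
  rw [inv_lt_iff_one_lt_mul₀ (by positivity), ← mul_pow] at h3
  exact (one_lt_sq_iff₀ (by positivity)).1 (by rwa [mul_comm] at h3)

theorem hasFDerivAt_outlyingNormal (hy : y ≠ 0) (hD : dilation ε ‖y‖ ≠ 0) :
    HasFDerivAt (outlyingNormal ε c) ((heightDeriv ε ‖y‖ / ‖y‖) • ContinuousLinearMap.id ℝ E3 +
      (((heightDeriv₂ ε ‖y‖ - heightDeriv ε ‖y‖ / ‖y‖) / ‖y‖ ^ 2) • innerSL ℝ y).smulRight y) y := by
  have hn : 0 < ‖y‖ := norm_pos_iff.2 hy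
  have hk : HasDerivAt (fun r => heightDeriv ε r / r)
      ((heightDeriv₂ ε ‖y‖ - heightDeriv ε ‖y‖ / ‖y‖) / ‖y‖) ‖y‖ := by
    refine ((hasDerivAt_heightDeriv hn hD).div (hasDerivAt_id _) hn.ne').congr_deriv ?_
    simp only [id]
    field_simp
  refine (((hasFDerivAt_comp_norm hy hk).smul (hasFDerivAt_id y)).sub_const c).congr_fderiv ?_
  ext1 u
  simp only [add_apply, smul_apply,
    ContinuousLinearMap.smulRight_apply, id, ContinuousLinearMap.id_apply]
  congr 2
  rw [div_div, sq]

theorem contDiffAt_outlyingNormal (hy : y ≠ 0) (hD : 0 < dilation ε ‖y‖) :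
    ContDiffAt ℝ ∞ (outlyingNormal ε c) y := by
  have hn := contDiffAt_norm (n := ∞) ℝ hy
  have h1 := (contDiffAt_heightDeriv (p := (ε, ‖y‖)) (norm_pos_iff.2 hy) hD).comp y
    (contDiffAt_const.prodMk hn)
  exact ((h1.div hn (norm_ne_zero_iff.2 hy)).smul contDiffAt_id).sub contDiffAt_const

theorem inner_self_outlyingNormal (hy : y ≠ 0) (h : inner ℝ c y = height ε ‖y‖) :
    inner ℝ y (outlyingNormal ε c y) = -(‖y‖ * radialPart ε ‖y‖) := by
  have hn := norm_ne_zero_iff.2 hy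
  rw [outlyingNormal, inner_sub_right, real_inner_smul_right, real_inner_self_eq_norm_sq,
    real_inner_comm, h, radialPart]
  field_simp
  ring

theorem inner_dir_outlyingNormal (hc : ‖c‖ = 1) (h : inner ℝ c y = height ε ‖y‖) :
    inner ℝ c (outlyingNormal ε c y) = heightDeriv ε ‖y‖ * height ε ‖y‖ / ‖y‖ - 1 := by
  rw [outlyingNormal, inner_sub_right, real_inner_smul_right, real_inner_self_eq_norm_sq, hc, h]
  ring

theorem norm_outlyingNormal (hc : ‖c‖ = 1) (hy : y ≠ 0) (h : inner ℝ c y = height ε ‖y‖) :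
    ‖outlyingNormal ε c y‖ = normalLen ε ‖y‖ := by
  have hn := norm_ne_zero_iff.2 hy
  have h1 : ‖outlyingNormal ε c y‖ ^ 2 =
      heightDeriv ε ‖y‖ / ‖y‖ * inner ℝ y (outlyingNormal ε c y) -
        inner ℝ c (outlyingNormal ε c y) := by
    have : ∀ u, inner ℝ (outlyingNormal ε c y) u =
        heightDeriv ε ‖y‖ / ‖y‖ * inner ℝ y u - inner ℝ c u := fun u => by
      rw [outlyingNormal, inner_sub_left, real_inner_smul_left]
    rw [← real_inner_self_eq_norm_sq, this]
  have h2 : normalSq ε ‖y‖ = ‖outlyingNormal ε c y‖ ^ 2 := by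
    rw [h1, inner_self_outlyingNormal hy h, inner_dir_outlyingNormal hc h, normalSq, radialPart]
    field_simp
    ring
  rw [normalLen, h2, Real.sqrt_sq (norm_nonneg _)]

/-- On the surface `⟨c, y⟩ - height` vanishes, so the product rule never sees the derivative of `m`.
-/
theorem hasFDerivAt_core {K : Correction} (hε : ε ∈ Ioo (-K.δ) K.δ) (hy : OnOutlying ε c y) :
    HasFDerivAt (fun y => K.core c (ε, y))
      (K.β ε • innerSL ℝ c + K.γ ε • (‖y‖⁻¹ • innerSL ℝ y - innerSL ℝ c) +
        ((‖y‖ - 1) ^ 2 * K.m (ε, ‖y‖)) •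
          (innerSL ℝ c - (heightDeriv ε ‖y‖ / ‖y‖) • innerSL ℝ y)) y := by
  have hn : 0 < ‖y‖ := by linarith [hy.lower]
  have hy0 := norm_pos_iff.1 hn
  have hI : ‖y‖ ∈ Ioo (1 / 4 : ℝ) 5 := ⟨by linarith [hy.lower], by linarith [hy.upper]⟩
  have hreg := K.regular ε hε ‖y‖ (Ioo_subset_Icc_self hI)
  have hc : HasFDerivAt (fun y : E3 => (inner ℝ c y : ℝ)) (innerSL ℝ c) y :=
    (innerSL ℝ c).hasFDerivAt
  have hz := hasFDerivAt_comp_norm hy0 (hasDerivAt_height hreg.pos hreg.dilation_pos.ne')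
  have hG : DifferentiableAt ℝ (fun y : E3 => (‖y‖ - 1) ^ 2 * K.m (ε, ‖y‖)) y := by
    have hnc := contDiffAt_norm (n := ∞) ℝ hy0
    have hm := (K.contDiffOn_m.contDiffAt ((isOpen_Ioo.prod isOpen_Ioo).mem_nhds
      (mk_mem_prod hε hI))).comp y (contDiffAt_const.prodMk hnc)
    exact (((hnc.sub contDiffAt_const).pow 2).mul hm).differentiableAt (by simp)
  have := ((hc.const_mul (K.β ε)).add (((hasFDerivAt_norm_of_ne_zero hy0).sub hc).const_mul
    (K.γ ε))).add ((hc.sub hz).mul hG.hasFDerivAt)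
  refine this.congr_fderiv ?_
  simp only [Pi.sub_apply, hy.inner_eq, sub_self, zero_smul, zero_add]

theorem hasFDerivAt_outlying_defining (hy : y ≠ 0) (hD : dilation ε ‖y‖ ≠ 0) :
    HasFDerivAt (fun y => height ε ‖y‖ - inner ℝ c y) (innerSL ℝ (outlyingNormal ε c y)) y := by
  have hc : HasFDerivAt (fun y : E3 => (inner ℝ c y : ℝ)) (innerSL ℝ c) y :=
    (innerSL ℝ c).hasFDerivAt
  refine ((hasFDerivAt_comp_norm hy (hasDerivAt_height (norm_pos_iff.2 hy) hD)).sub hc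
    ).congr_fderiv ?_
  rw [outlyingNormal, map_sub, map_smul]

/-- The mean curvature of the outlying sphere with respect to the perturbed metric. -/
theorem outlying_curvature {K : Correction} (hc : ‖c‖ = 1) (hcd : c = axisDir ∨ c = -axisDir)
    (hε : ε ∈ Ioo (-K.δ) K.δ) (hy : OnOutlying ε c y) :
    K.conformal (ε, y) / ‖outlyingNormal ε c y‖ *
      (LinearMap.trace ℝ E3 (fderiv ℝ (outlyingNormal ε c) y).toLinearMap -
        inner ℝ (outlyingNormal ε c y) (fderiv ℝ (outlyingNormal ε c) y (outlyingNormal ε c y)) /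
          ‖outlyingNormal ε c y‖ ^ 2) -
      2 * fderiv ℝ (fun y => K.conformal (ε, y)) y (outlyingNormal ε c y) /
        ‖outlyingNormal ε c y‖ = centredCurv ε := by
  have hn : 0 < ‖y‖ := by linarith [hy.lower]
  have hy0 := norm_pos_iff.1 hn
  have hI : ‖y‖ ∈ Ioo (1 / 4 : ℝ) 5 := ⟨by linarith [hy.lower], by linarith [hy.upper]⟩
  have hreg := K.regular ε hε ‖y‖ (Ioo_subset_Icc_self hI)
  have hpe := perturbation_eventuallyEq_core (K := K) (ε := ε) hcd hy.lower hy.upper hy.angle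
  have hpd : fderiv ℝ (fun y => K.perturbation (ε, y)) y = _ :=
    ((hasFDerivAt_core hε hy).congr_of_eventuallyEq hpe).fderiv
  have htr : LinearMap.trace ℝ E3 (fderiv ℝ (outlyingNormal ε c) y).toLinearMap =
      3 * (heightDeriv ε ‖y‖ / ‖y‖) + (heightDeriv₂ ε ‖y‖ - heightDeriv ε ‖y‖ / ‖y‖) := by
    rw [(hasFDerivAt_outlyingNormal hy0 hreg.dilation_pos.ne').fderiv]
    rw [ContinuousLinearMap.toLinearMap_add, map_add, ContinuousLinearMap.toLinearMap_smul, map_smul]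
    have h1 : LinearMap.trace ℝ E3 (ContinuousLinearMap.id ℝ E3).toLinearMap = 3 := by simp
    have h2 : LinearMap.trace ℝ E3 ((((heightDeriv₂ ε ‖y‖ - heightDeriv ε ‖y‖ / ‖y‖) / ‖y‖ ^ 2) •
        innerSL ℝ y).smulRight y).toLinearMap =
        (heightDeriv₂ ε ‖y‖ - heightDeriv ε ‖y‖ / ‖y‖) / ‖y‖ ^ 2 * ‖y‖ ^ 2 := by
      refine (LinearMap.trace_smulRight _ y).trans ?_
      change (heightDeriv₂ ε ‖y‖ - heightDeriv ε ‖y‖ / ‖y‖) / ‖y‖ ^ 2 * inner ℝ y y = _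
      rw [real_inner_self_eq_norm_sq]
    rw [h1, h2, smul_eq_mul]
    field_simp
  have hdv : inner ℝ (outlyingNormal ε c y)
      (fderiv ℝ (outlyingNormal ε c) y (outlyingNormal ε c y)) =
      heightDeriv ε ‖y‖ / ‖y‖ * normalSq ε ‖y‖ +
        (heightDeriv₂ ε ‖y‖ - heightDeriv ε ‖y‖ / ‖y‖) * radialPart ε ‖y‖ ^ 2 := by
    rw [(hasFDerivAt_outlyingNormal hy0 hreg.dilation_pos.ne').fderiv]
    simp only [add_apply, smul_apply, ContinuousLinearMap.smulRight_apply,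
      ContinuousLinearMap.id_apply, inner_add_right, real_inner_smul_right, innerSL_apply_apply,
      smul_eq_mul, real_inner_self_eq_norm_sq]
    rw [real_inner_comm y (outlyingNormal ε c y), inner_self_outlyingNormal hy0 hy.inner_eq,
      norm_outlyingNormal hc hy0 hy.inner_eq, normalLen, Real.sq_sqrt hreg.normalSq_pos.le]
    field_simp
  -- The gradient of the `m` term is `-(r - 1)² m` times the normal field, whence the factor
  -- `normalSq`.
  have hdw : fderiv ℝ (fun y => K.conformal (ε, y)) y (outlyingNormal ε c y) =
      -(schwDeriv ε ‖y‖ * radialPart ε ‖y‖) + ε ^ 2 *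
        (K.β ε * (heightDeriv ε ‖y‖ * height ε ‖y‖ / ‖y‖ - 1) +
          K.γ ε * (-radialPart ε ‖y‖ - (heightDeriv ε ‖y‖ * height ε ‖y‖ / ‖y‖ - 1)) -
          (‖y‖ - 1) ^ 2 * K.m (ε, ‖y‖) * normalSq ε ‖y‖) := by
    rw [(hasFDerivAt_conformal hε hy0 hreg.schw_pos).fderiv, hpd]
    simp only [add_apply, sub_apply, smul_apply, innerSL_apply_apply, smul_eq_mul,
      inner_self_outlyingNormal hy0 hy.inner_eq, inner_dir_outlyingNormal hc hy.inner_eq]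
    have : normalSq ε ‖y‖ = 1 - heightDeriv ε ‖y‖ * height ε ‖y‖ / ‖y‖ -
        heightDeriv ε ‖y‖ * radialPart ε ‖y‖ := by
      rw [normalSq, radialPart]; ring
    rw [this]
    field_simp
    ring
  have hval : K.conformal (ε, y) = schw ε ‖y‖ + ε ^ 2 *
      (K.β ε * height ε ‖y‖ + K.γ ε * (‖y‖ - height ε ‖y‖)) := by
    rw [conformal, hpe.self_of_nhds, core]
    simp only [hy.inner_eq]
    ring
  have hdef := K.defect_add ε hε ‖y‖ hI
  have hN : normalSq ε ‖y‖ = normalLen ε ‖y‖ ^ 2 := (Real.sq_sqrt hreg.normalSq_pos.le).symm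
  have hN0 := hreg.normalLen_pos
  rw [htr, hdv, hdw, hval, norm_outlyingNormal hc hy0 hy.inner_eq]
  -- The trace expression is the Euclidean mean curvature; once it is recognized, the claim is the
  -- identity `defect_add`.
  have hmc : meanCurv ε ‖y‖ = (3 * (heightDeriv ε ‖y‖ / ‖y‖) +
      (heightDeriv₂ ε ‖y‖ - heightDeriv ε ‖y‖ / ‖y‖) - (heightDeriv ε ‖y‖ / ‖y‖ * normalSq ε ‖y‖ +
        (heightDeriv₂ ε ‖y‖ - heightDeriv ε ‖y‖ / ‖y‖) * radialPart ε ‖y‖ ^ 2) /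
        normalLen ε ‖y‖ ^ 2) / normalLen ε ‖y‖ := by
    rw [meanCurv, hN]
    simp only at hN0
    field_simp
    ring
  rw [div_mul_eq_mul_div, mul_div_assoc, ← hmc]
  rw [defect, effectHeight, effectGap] at hdef
  simp only at hN0
  rw [hN]
  field_simp at hdef ⊢
  linear_combination hdef

end Outlying

end Surfaces

/-! ### Symmetry, position and tangency; assembling the sequences -/

section Construction

open Correction

section Axisymmetry

theorem rot_smul (θ t : ℝ) (x : E3) : rot θ (t • x) = t • rot θ x := by
  ext i
  fin_cases i <;> simp [rot] <;> ring

theorem rot_rot_neg (θ : ℝ) (x : E3) : rot θ (rot (-θ) x) = x := by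
  have h := Real.sin_sq_add_cos_sq θ
  ext i
  fin_cases i
  · simp [rot]
  · simp [rot]
    linear_combination x 1 * h
  · simp [rot]
    linear_combination x 2 * h

theorem Diffeo.isAxisymmetric_sphere {Φ : Diffeo}
    (h : ∀ θ x, ‖Φ.invFun (rot θ x)‖ = ‖Φ.invFun x‖) : Φ.sphere.IsAxisymmetric := by
  intro θ
  ext x
  constructor
  · rintro ⟨y, hy, rfl⟩
    rw [Φ.mem_carrier] at hy ⊢
    rw [h, hy]
  · intro hx
    refine ⟨rot (-θ) x, ?_, rot_rot_neg θ x⟩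
    rw [Φ.mem_carrier] at hx ⊢
    rw [h, hx]

end Axisymmetry

section Centred

variable {ε : ℝ} (hε : 0 < ε)

theorem mem_carrier_scaling {x : E3} : x ∈ (scaling hε).sphere.carrier ↔ ‖ε • x‖ = 1 :=
  (scaling hε).mem_carrier

theorem isAxisymmetric_scaling : (scaling hε).sphere.IsAxisymmetric := by
  refine Diffeo.isAxisymmetric_sphere fun θ x => ?_
  change ‖ε • rot θ x‖ = ‖ε • x‖
  rw [norm_smul, norm_smul, norm_rot]

theorem separatesCompactPart_scaling (h1 : ε < 1) :
    (scaling hε).sphere.SeparatesCompactPart := by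
  constructor
  · intro x hx
    rw [mem_carrier_scaling, norm_smul, Real.norm_of_nonneg hε.le] at hx
    change 1 < ‖x‖
    nlinarith [norm_nonneg x]
  · intro x hx
    rw [mem_closedBall_zero_iff] at hx
    rw [Diffeo.mem_enclosed]
    change ‖ε • x‖ < 1
    rw [norm_smul, Real.norm_of_nonneg hε.le]
    nlinarith [norm_nonneg x]

theorem carrier_scaling_inter_axis : (scaling hε).sphere.carrier ∩ axis =
    {ε⁻¹ • axisDir, ε⁻¹ • -axisDir} := by
  ext x
  rw [mem_inter_iff, mem_carrier_scaling, mem_insert_iff, mem_singleton_iff]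
  constructor
  · rintro ⟨hx, h1, h2⟩
    have hxa : x = x 0 • axisDir := by
      ext i
      fin_cases i <;> simp [axisDir, h1, h2]
    rw [hxa, norm_smul, norm_smul, norm_axisDir, mul_one, Real.norm_of_nonneg hε.le,
      Real.norm_eq_abs] at hx
    have hx' : |x 0| = ε⁻¹ := eq_inv_of_mul_eq_one_right hx
    rcases (abs_eq (by positivity)).1 hx' with h | h
    · left; rw [hxa, h]
    · right; rw [hxa, h, neg_smul, smul_neg]
  · rintro (rfl | rfl)
    · refine ⟨?_, by simp [axisDir, axis]⟩
      rw [smul_smul, mul_inv_cancel₀ hε.ne', one_smul, norm_axisDir]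
    · refine ⟨?_, by simp [axisDir, axis]⟩
      rw [smul_smul, mul_inv_cancel₀ hε.ne', one_smul, norm_neg, norm_axisDir]

theorem inner_diff_scaling {c : E3} {p : S2} (hp : (scaling hε).sphere.toFun p = ε⁻¹ • c)
    (X : TangentSpace (𝓡 2) p) : inner ℝ c ((scaling hε).sphere.diff p X) = 0 := by
  have hd : HasFDerivAt (fun x : E3 => ‖x‖ ^ 2) _ ((scaling hε).sphere.toFun p) :=
    (hasStrictFDerivAt_norm_sq _).hasFDerivAt
  have h := (scaling hε).sphere.fderiv_diff_eq_zero (c := (ε⁻¹) ^ 2) hd.differentiableAt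
    (Eventually.of_forall fun q => by
      have := (mem_carrier_scaling hε).1 ⟨q, rfl⟩
      rw [norm_smul, Real.norm_of_nonneg hε.le] at this
      rw [eq_inv_of_mul_eq_one_right this]) X
  rw [hd.fderiv, hp] at h
  simpa [hε.ne'] using h

end Centred

section Outlying

variable {ε : ℝ} {c : E3} {Φ : Diffeo}

theorem onOutlying_of_mem_carrier (hc : ‖c‖ = 1) (hb : ∀ y, |2 * ε * cutZeta y| ≤ 1 / 20)
    (hΦ : ∀ x, Φ.invFun x = (1 + 2 * ε * cutZeta (ε • x)) • (ε • x - (2 : ℝ) • c)) {x : E3}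
    (hx : x ∈ Φ.sphere.carrier) : OnOutlying ε c (ε • x) := by
  rw [Φ.mem_carrier, hΦ] at hx
  exact onOutlying_of_norm_eq_one hc (hb _) hx

theorem lt_mul_norm_of_mem_carrier (hc : ‖c‖ = 1) (hb : ∀ y, |2 * ε * cutZeta y| ≤ 1 / 20)
    (hΦ : ∀ x, Φ.invFun x = (1 + 2 * ε * cutZeta (ε • x)) • (ε • x - (2 : ℝ) • c)) (hε : 0 < ε)
    {x : E3} (hx : x ∈ Φ.sphere.carrier) : 4 / 5 < ε * ‖x‖ := by
  have := (onOutlying_of_mem_carrier hc hb hΦ hx).lower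
  rwa [norm_smul, Real.norm_of_nonneg hε.le] at this

theorem outlying_hasConstantMeanCurvature {K : Correction} {g : Metric3} (hε : 0 < ε)
    (hεK : ε < K.δ) (hcd : c = axisDir ∨ c = -axisDir) (hc : ‖c‖ = 1)
    (hpos : ∀ y : E3, y ≠ 0 → 0 < K.conformal (ε, y))
    (hg : ∀ x : E3, 1 / 2 < ‖ε • x‖ → ‖ε • x‖ < 4 →
      g.toFun x = (K.conformal (ε, ε • x) ^ 2)⁻¹ • euclid)
    (hb : ∀ y, |2 * ε * cutZeta y| ≤ 1 / 20)
    (hΦ : ∀ x, Φ.invFun x = (1 + 2 * ε * cutZeta (ε • x)) • (ε • x - (2 : ℝ) • c)) :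
    Φ.sphere.HasConstantMeanCurvature g (ε * centredCurv ε) := by
  have hεm : ε ∈ Ioo (-K.δ) K.δ := ⟨by linarith, hεK⟩
  have hon : ∀ p, OnOutlying ε c (ε • Φ.sphere.toFun p) := fun p =>
    onOutlying_of_mem_carrier hc hb hΦ ⟨p, rfl⟩
  have hreg : ∀ y : E3, 4 / 5 < ‖y‖ → ‖y‖ < 7 / 2 → Regular (ε, ‖y‖) := fun y h1 h2 =>
    K.regular ε hεm ‖y‖ ⟨by linarith, by linarith⟩
  have hregp := fun p => hreg _ (hon p).lower (hon p).upper
  have hy0 : ∀ p, ε • Φ.sphere.toFun p ≠ 0 := fun p => norm_pos_iff.1 (hregp p).pos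
  have hnear : ∀ p, ∀ᶠ x in 𝓝 (Φ.sphere.toFun p), 4 / 5 < ‖ε • x‖ ∧ ‖ε • x‖ < 7 / 2 := by
    intro p
    have hcs : ContinuousAt (fun x : E3 => ‖ε • x‖) (Φ.sphere.toFun p) := by fun_prop
    exact (hcs.eventually (lt_mem_nhds (hon p).lower)).and
      (hcs.eventually (gt_mem_nhds (hon p).upper))
  refine hasConstantMeanCurvature_of_rescaled _ g _ hε (fun y => K.conformal (ε, y))
    (fun y => height ε ‖y‖ - inner ℝ c y) (outlyingNormal ε c) ?_
    (fun p => contDiffAt_conformal hεm (hy0 p) (hregp p).schw_pos) (fun p => hpos _ (hy0 p))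
    (fun p => contDiffAt_outlyingNormal (hy0 p) (hregp p).dilation_pos) ?_
    (fun p => hasFDerivAt_outlying_defining (hy0 p) (hregp p).dilation_pos.ne')
    (fun p => by simp [(hon p).inner_eq]) ?_ (fun p => outlying_curvature hc hcd hεm (hon p))
  · intro p
    filter_upwards [hnear p] with x hx
    exact hg x (by linarith [hx.1]) (by linarith [hx.2])
  · intro p
    rw [← norm_pos_iff, norm_outlyingNormal hc (hy0 p) (hon p).inner_eq]
    exact (hregp p).normalLen_pos
  · intro p
    filter_upwards [hnear p] with x hx h hin
    rw [Φ.mem_enclosed, hΦ] at hin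
    exact absurd hin (one_lt_norm_of_inner_lt hc hx.1.le hx.2.le
      (hreg _ hx.1 hx.2).dilation_pos (by linarith)).not_gt

/-- The origin lies outside, so the segment from it to a point `x` of the compact region meets the
surface, at a point of norm at most `‖x‖`. -/
theorem Diffeo.isOutlying_sphere (h0 : 1 < ‖Φ.invFun 0‖)
    (h1 : ∀ x ∈ Φ.sphere.carrier, 1 < ‖x‖) : Φ.sphere.IsOutlying := by
  refine ⟨h1, Set.disjoint_left.2 fun x hx hball => ?_⟩
  have hx' : ‖Φ.invFun x‖ ≤ 1 := by
    rcases hx with hx | hx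
    · exact (Φ.mem_carrier.1 hx).le
    · exact (Φ.mem_enclosed.1 hx).le
  have hcont : Continuous fun t : ℝ => ‖Φ.invFun (t • x)‖ :=
    (Φ.contDiff_inv.continuous.comp (continuous_id.smul continuous_const)).norm
  obtain ⟨t, ht, hteq⟩ := intermediate_value_Icc' zero_le_one hcont.continuousOn
    (show (1 : ℝ) ∈ _ by simpa using ⟨hx', h0.le⟩)
  have hmem : t • x ∈ Φ.sphere.carrier := Φ.mem_carrier.2 hteq
  have hle : sInf (norm '' Φ.sphere.carrier) ≤ ‖t • x‖ :=
    csInf_le ⟨0, by rintro _ ⟨y, _, rfl⟩; exact norm_nonneg y⟩ ⟨_, hmem, rfl⟩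
  rw [mem_ball_zero_iff] at hball
  rw [norm_smul, Real.norm_of_nonneg ht.1] at hle
  nlinarith [norm_nonneg x, ht.2]

theorem isOutlying_of_invFun_eq (hc : ‖c‖ = 1) (hb : ∀ y, |2 * ε * cutZeta y| ≤ 1 / 20)
    (hΦ : ∀ x, Φ.invFun x = (1 + 2 * ε * cutZeta (ε • x)) • (ε • x - (2 : ℝ) • c)) (hε : 0 < ε)
    (hε' : ε ≤ 1 / 2) : Φ.sphere.IsOutlying := by
  refine Diffeo.isOutlying_sphere ?_ fun x hx => ?_
  · rw [hΦ, smul_zero, cutZeta, norm_zero, radialCutoff_eq_zero (Or.inl (by norm_num)), zero_mul,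
      mul_zero, add_zero, one_smul, zero_sub, norm_neg, norm_smul, hc]
    norm_num
  · have := lt_mul_norm_of_mem_carrier hc hb hΦ hε hx
    nlinarith [norm_nonneg x]

theorem isAxisymmetric_of_invFun_eq (hcd : c = axisDir ∨ c = -axisDir) (hc : ‖c‖ = 1)
    (hΦ : ∀ x, Φ.invFun x = (1 + 2 * ε * cutZeta (ε • x)) • (ε • x - (2 : ℝ) • c)) :
    Φ.sphere.IsAxisymmetric := by
  have hinner : ∀ θ y, inner ℝ c (rot θ y) = inner ℝ c y := by
    rcases hcd with rfl | rfl
    · exact inner_axisDir_rot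
    · intro θ y
      rw [inner_neg_left, inner_neg_left, inner_axisDir_rot]
  refine Diffeo.isAxisymmetric_sphere fun θ x => ?_
  have h1 : ‖rot θ (ε • x) - (2 : ℝ) • c‖ = ‖ε • x - (2 : ℝ) • c‖ := by
    rw [← sq_eq_sq₀ (norm_nonneg _) (norm_nonneg _), norm_sub_two_smul_sq hc,
      norm_sub_two_smul_sq hc, norm_rot, hinner]
  rw [hΦ, hΦ, ← rot_smul, norm_smul, norm_smul, h1, cutZeta, cutZeta, norm_rot]

/-- On `‖y‖ = 1` the equation of the outlying sphere reads `⟨c, y⟩ = 1`, the equality case of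
Cauchy–Schwarz, so `y = c`. There the normals of both surfaces are multiples of `c`. -/
theorem tangentExactlyAt_scaling {K : Correction} (hε : 0 < ε) (hεK : ε < K.δ) (hc : ‖c‖ = 1)
    (hb : ∀ y, |2 * ε * cutZeta y| ≤ 1 / 20)
    (hΦ : ∀ x, Φ.invFun x = (1 + 2 * ε * cutZeta (ε • x)) • (ε • x - (2 : ℝ) • c)) :
    Φ.sphere.TangentExactlyAt (scaling hε).sphere (ε⁻¹ • c) := by
  have hεc : ε • ε⁻¹ • c = c := by rw [smul_smul, mul_inv_cancel₀ hε.ne', one_smul]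
  have hc0 : c ≠ 0 := norm_pos_iff.1 (by rw [hc]; exact one_pos)
  have hreg : Regular (ε, 1) :=
    K.regular ε ⟨by linarith, hεK⟩ 1 ⟨by norm_num, by norm_num⟩
  have hz : cutZeta c = 0 := by rw [cutZeta, hc, zeta_one, mul_zero]
  have hmem : ε⁻¹ • c ∈ Φ.sphere.carrier := by
    rw [Φ.mem_carrier, hΦ, hεc, hz, mul_zero, add_zero, one_smul, two_smul, sub_add_cancel_left,
      norm_neg, hc]
  have hmem' : ε⁻¹ • c ∈ (scaling hε).sphere.carrier := by rw [mem_carrier_scaling, hεc, hc]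
  refine ⟨?_, ?_⟩
  · ext x
    rw [mem_inter_iff, mem_singleton_iff]
    refine ⟨fun ⟨hx, hx'⟩ => ?_, by rintro rfl; exact ⟨hmem, hmem'⟩⟩
    rw [mem_carrier_scaling] at hx'
    have h := (onOutlying_of_mem_carrier hc hb hΦ hx).inner_eq
    rw [hx', height_one, inner_eq_one_iff_of_norm_eq_one hc hx'] at h
    rw [h, smul_smul, inv_mul_cancel₀ hε.ne', one_smul]
  · obtain ⟨p, hp⟩ := hmem
    obtain ⟨p', hp'⟩ := hmem'
    refine ⟨p, p', hp, hp', ?_⟩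
    rw [(scaling hε).sphere.tangentPlane_eq_of_inner_eq_zero p' hc0 (inner_diff_scaling hε hp'),
      Φ.sphere.tangentPlane_eq_of_inner_eq_zero p hc0]
    intro X
    have hN : outlyingNormal ε c c = (heightDeriv ε 1 - 1) • c := by
      rw [outlyingNormal, hc, div_one, sub_smul, one_smul]
    -- Otherwise the normal field would vanish at `c`, contradicting `normalLen > 0`.
    have hk : heightDeriv ε 1 - 1 ≠ 0 := by
      intro h0
      have := norm_outlyingNormal (ε := ε) hc hc0
        (by rw [real_inner_self_eq_norm_sq, hc, height_one, one_pow])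
      rw [hN, h0, zero_smul, norm_zero, hc] at this
      exact hreg.normalLen_pos.ne this
    have h1 : HasFDerivAt (fun x : E3 => ε • x) (ε • ContinuousLinearMap.id ℝ E3)
        (Φ.sphere.toFun p) := (hasFDerivAt_id _).const_smul ε
    have h2 : HasFDerivAt (fun y => height ε ‖y‖ - inner ℝ c y) (innerSL ℝ (outlyingNormal ε c c))
        (ε • Φ.sphere.toFun p) := by
      rw [hp, hεc]
      exact hasFDerivAt_outlying_defining hc0 (by rw [hc]; exact hreg.dilation_pos.ne')
    have h3 := h2.comp _ h1
    have h4 := Φ.sphere.fderiv_diff_eq_zero (c := 0) h3.differentiableAt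
      (Eventually.of_forall fun q => sub_eq_zero.2
        (onOutlying_of_mem_carrier hc hb hΦ ⟨q, rfl⟩).inner_eq.symm) X
    rw [h3.fderiv, hN] at h4
    simpa [hε.ne', hk, real_inner_smul_left] using h4

end Outlying

theorem eventually_centredCurv_mem : ∃ δ > 0, ∀ ε, 0 < ε → ε ≤ δ → centredCurv ε ∈ Ioo (1 : ℝ) 3 := by
  have h1 := contDiffAt_centredCurv (p := ((0 : ℝ), (0 : ℝ))) (by norm_num)
  have h2 : ContinuousAt centredCurv 0 :=
    (h1.comp (0 : ℝ) (f := fun ε : ℝ => (ε, (0 : ℝ)))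
      (contDiffAt_id.prodMk contDiffAt_const)).continuousAt
  have h3 : ∀ᶠ ε in 𝓝 (0 : ℝ), centredCurv ε ∈ Ioo (1 : ℝ) 3 :=
    h2.eventually (isOpen_Ioo.mem_nhds (by rw [centredCurv_zero]; norm_num))
  obtain ⟨δ, hδ, h⟩ := Metric.eventually_nhds_iff.1 h3
  refine ⟨δ / 2, by positivity, fun ε h0 hle => h ?_⟩
  rw [Real.dist_eq, sub_zero, abs_of_pos h0]
  linarith

theorem tendsto_scale (δ : ℝ) : Tendsto (scale δ) atTop (𝓝 0) := by
  have := (tendsto_pow_atTop_nhds_zero_of_lt_one (by norm_num : (0 : ℝ) ≤ 1 / 64)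
    (by norm_num)).const_mul δ
  rwa [mul_zero] at this

/-- On the annulus of the `n`-th scale only the `n`-th term is active, and `δ ≤ 1/2` forces `‖x‖ ≥
1`, where the base factor is exactly Schwarzschild. -/
theorem toFun_eq_conformal {K : Correction} {P : ℝ × E3 → ℝ} {g : Metric3} {δ : ℝ}
    (h0 : ∀ q : ℝ × E3, ‖q.2‖ ≤ 1 / 2 ∨ 4 ≤ ‖q.2‖ → P q = 0) (hδ : 0 < δ) (hδ' : δ ≤ 1 / 2)
    (hP : ∀ ε, 0 < ε → ε ≤ δ → ∀ y : E3, y ≠ 0 →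
      (1 + ε / (2 * ‖y‖)) ^ 4 + ε ^ 2 * P (ε, y) = (K.conformal (ε, y) ^ 2)⁻¹)
    (hg : ∀ x, g.toFun x = (baseFactor x + series P δ x) • euclid) (n : ℕ) {x : E3}
    (h1 : 1 / 2 < ‖scale δ n • x‖) (h2 : ‖scale δ n • x‖ < 4) :
    g.toFun x = (K.conformal (scale δ n, scale δ n • x) ^ 2)⁻¹ • euclid := by
  have hs := scale_pos hδ n
  have hle := scale_le hδ n
  have hn : ‖scale δ n • x‖ = scale δ n * ‖x‖ := by rw [norm_smul, Real.norm_of_nonneg hs.le]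
  have hx : 1 ≤ ‖x‖ := by
    rw [hn] at h1
    nlinarith [norm_nonneg x]
  have hy : scale δ n • x ≠ 0 := norm_pos_iff.1 (by linarith)
  rw [hg, series_eq h0 hδ ⟨by rw [← hn]; exact h1.le, by rw [← hn]; exact h2.le⟩,
    baseFactor_eq hx, ← hP _ hs hle _ hy, hn]
  congr 4
  field_simp

/-- The curvature at scale `ε` lies between `ε` and `3ε`, while consecutive scales differ by a
factor 64. -/
theorem strictAnti_meanCurvature {δ : ℝ} (hδ : 0 < δ)
    (h : ∀ ε, 0 < ε → ε ≤ δ → centredCurv ε ∈ Ioo (1 : ℝ) 3) :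
    StrictAnti fun n => scale δ n * centredCurv (scale δ n) := by
  refine strictAnti_nat_of_succ_lt fun n => ?_
  have h1 := h _ (scale_pos hδ n) (scale_le hδ n)
  have h2 := h _ (scale_pos hδ (n + 1)) (scale_le hδ (n + 1))
  have h3 := mul_scale_le hδ (Nat.lt_succ_self n)
  have h4 := scale_pos hδ (n + 1)
  nlinarith [h1.1, h2.2]

theorem tendsto_meanCurvature {δ : ℝ} (hδ : 0 < δ)
    (h : ∀ ε, 0 < ε → ε ≤ δ → centredCurv ε ∈ Ioo (1 : ℝ) 3) :
    Tendsto (fun n => scale δ n * centredCurv (scale δ n)) atTop (𝓝 0) := by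
  have h3 := (tendsto_scale δ).mul_const 3
  rw [zero_mul] at h3
  refine squeeze_zero (fun n => ?_) (fun n => ?_) h3
  · have h1 := h _ (scale_pos hδ n) (scale_le hδ n)
    nlinarith [h1.1, scale_pos hδ n]
  · have h1 := h _ (scale_pos hδ n) (scale_le hδ n)
    nlinarith [h1.2, scale_pos hδ n]

end Construction
end CMC

end

open CMC CMC.Correction

theorem theorem2 :
    ∃ g : CMC.Metric3,
      CMC.IsAsymptoticallySchwarzschild 1 g ∧ g.IsAxisymmetric ∧
      ∃ (H : ℕ → ℝ) (S₁ S₂ S₃ : ℕ → CMC.EmbeddedSphere),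
        (∀ n, 0 < H n) ∧ StrictAnti H ∧ Filter.Tendsto H Filter.atTop (nhds 0) ∧
        (∀ R : ℝ, ∀ᶠ n in Filter.atTop,
          ∀ x ∈ (S₁ n).carrier ∪ (S₂ n).carrier ∪ (S₃ n).carrier, R < ‖x‖) ∧
        ∀ n,
          (S₁ n).HasConstantMeanCurvature g (H n) ∧
          (S₂ n).HasConstantMeanCurvature g (H n) ∧
          (S₃ n).HasConstantMeanCurvature g (H n) ∧
          (S₁ n).IsAxisymmetric ∧ (S₂ n).IsAxisymmetric ∧ (S₃ n).IsAxisymmetric ∧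
          (S₁ n).IsOutlying ∧ (S₂ n).IsOutlying ∧
          (S₃ n).SeparatesCompactPart ∧
          ∃ P Q : CMC.E3, P ≠ Q ∧ (S₃ n).carrier ∩ CMC.axis = {P, Q} ∧
            (S₁ n).TangentExactlyAt (S₃ n) P ∧ (S₂ n).TangentExactlyAt (S₃ n) Q := by
  obtain ⟨K⟩ := nonempty_correction
  obtain ⟨δ₁, hδ₁, hδK, P, hPs, hPc, hP0, hProt, hP⟩ := K.exists_profile
  obtain ⟨C, hC⟩ := hPc.exists_bound_of_continuous hPs.continuous
  obtain ⟨δ₂, hδ₂, h₂⟩ := exists_outlying_diffeo axisDir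
  obtain ⟨δ₃, hδ₃, h₃⟩ := exists_outlying_diffeo (-axisDir)
  obtain ⟨δ₄, hδ₄, h₄⟩ := eventually_centredCurv_mem
  have hC0 : 0 ≤ C := (norm_nonneg _).trans (hC 0)
  obtain ⟨δ, hδ, hle⟩ : ∃ δ > 0, δ ≤ δ₁ ∧ δ ≤ δ₂ ∧ δ ≤ δ₃ ∧ δ ≤ δ₄ ∧ δ ≤ 1 / 2 ∧
      δ ≤ 1 / (2 * (C + 1)) := by
    refine ⟨min δ₁ (min δ₂ (min δ₃ (min δ₄ (min (1 / 2) (1 / (2 * (C + 1))))))), ?_, ?_⟩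
    · simp only [gt_iff_lt, lt_min_iff]
      exact ⟨hδ₁, hδ₂, hδ₃, hδ₄, by norm_num, by positivity⟩
    · simp only [← le_min_iff, le_refl]
  obtain ⟨hle₁, hle₂, hle₃, hle₄, hle₅, hle₆⟩ := hle
  -- Keeps the total conformal factor at least `1/2`, since the base factor is at least 1.
  have hδC : δ ^ 2 * C ≤ 1 / 2 := by
    rw [le_div_iff₀ (by positivity)] at hle₆
    nlinarith
  obtain ⟨g, hgS, hgA, hg⟩ := exists_metric hPs hPc hP0 hProt hC hδ (by linarith) hδC
  have hpos := scale_pos hδ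
  have hsc := scale_le hδ
  have hcurv : ∀ ε, 0 < ε → ε ≤ δ → centredCurv ε ∈ Set.Ioo (1 : ℝ) 3 := fun ε h0 h =>
    h₄ ε h0 (h.trans hle₄)
  choose hb₁ Φ₁ hΦ₁ using fun n => h₂ (scale δ n) (hpos n) ((hsc n).trans hle₂)
  choose hb₂ Φ₂ hΦ₂ using fun n => h₃ (scale δ n) (hpos n) ((hsc n).trans hle₃)
  have hK : ∀ n, scale δ n < K.δ := fun n => ((hsc n).trans hle₁).trans_lt hδK
  have hw : ∀ n (y : E3), y ≠ 0 → 0 < K.conformal (scale δ n, y) := fun n y hy =>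
    (hP _ (hpos n) ((hsc n).trans hle₁) y hy).1
  have hgn : ∀ n (x : E3), 1 / 2 < ‖scale δ n • x‖ → ‖scale δ n • x‖ < 4 →
      g.toFun x = (K.conformal (scale δ n, scale δ n • x) ^ 2)⁻¹ • euclid := fun n x =>
    toFun_eq_conformal hP0 hδ hle₅ (fun ε h0 h y hy => (hP ε h0 (h.trans hle₁) y hy).2) hg n
  have hneg : ‖-axisDir‖ = 1 := by rw [norm_neg, norm_axisDir]
  refine ⟨g, hgS, hgA, fun n => scale δ n * centredCurv (scale δ n), fun n => (Φ₁ n).sphere,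
    fun n => (Φ₂ n).sphere, fun n => (scaling (hpos n)).sphere, fun n => ?_,
    strictAnti_meanCurvature hδ hcurv, tendsto_meanCurvature hδ hcurv, fun R => ?_, fun n =>
    ⟨outlying_hasConstantMeanCurvature (hpos n) (hK n) (Or.inl rfl) norm_axisDir (hw n) (hgn n)
      (hb₁ n) (hΦ₁ n),
    outlying_hasConstantMeanCurvature (hpos n) (hK n) (Or.inr rfl) hneg (hw n) (hgn n)
      (hb₂ n) (hΦ₂ n),
    centred_hasConstantMeanCurvature (hpos n) (hK n) (hw n) (hgn n),
    isAxisymmetric_of_invFun_eq (Or.inl rfl) norm_axisDir (hΦ₁ n),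
    isAxisymmetric_of_invFun_eq (Or.inr rfl) hneg (hΦ₂ n), isAxisymmetric_scaling (hpos n),
    isOutlying_of_invFun_eq norm_axisDir (hb₁ n) (hΦ₁ n) (hpos n) ((hsc n).trans hle₅),
    isOutlying_of_invFun_eq hneg (hb₂ n) (hΦ₂ n) (hpos n) ((hsc n).trans hle₅),
    separatesCompactPart_scaling (hpos n) (by linarith [hsc n]),
    (scale δ n)⁻¹ • axisDir, (scale δ n)⁻¹ • -axisDir, ?_, carrier_scaling_inter_axis (hpos n),
    tangentExactlyAt_scaling (hpos n) (hK n) norm_axisDir (hb₁ n) (hΦ₁ n),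
    tangentExactlyAt_scaling (hpos n) (hK n) hneg (hb₂ n) (hΦ₂ n)⟩⟩
  · exact mul_pos (hpos n) (one_pos.trans (hcurv _ (hpos n) (hsc n)).1)
  -- All three surfaces lie in `{4/5 < ε ‖x‖}`, and `ε R` tends to zero.
  · have hR := (tendsto_scale δ).mul_const R
    rw [zero_mul] at hR
    filter_upwards [hR.eventually (gt_mem_nhds (by norm_num : (0 : ℝ) < 4 / 5))] with n hn x hx
    refine lt_of_mul_lt_mul_left (hn.trans ?_) (hpos n).le
    rcases hx with (hx | hx) | hx
    · exact lt_mul_norm_of_mem_carrier norm_axisDir (hb₁ n) (hΦ₁ n) (hpos n) hx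
    · exact lt_mul_norm_of_mem_carrier hneg (hb₂ n) (hΦ₂ n) (hpos n) hx
    · rw [mem_carrier_scaling, norm_smul, Real.norm_of_nonneg (hpos n).le] at hx
      rw [hx]
      norm_num
  · intro h
    have h1 := smul_right_injective E3 (inv_ne_zero (hpos n).ne') h
    have h2 := congrArg (fun x : E3 => x 0) h1
    norm_num [axisDir] at h2
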